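/- **Proposition (triangle comparison implies Lorentzianity).** Let $M$ be a connected (Hausdorff, second countable) $C^\infty$-manifold without boundary of dimension $n\ge 2$, and let $L:TM\to\mathbb R$ be a Lorentz–Finsler structure: $L$ is $C^\infty$ off the zero section, $L(cv)=c^2L(v)$ for all $c>0$, and for every $v\in T_xM\setminus\{0\}$ the fundamental tensor $g_v$, i.e. the bilinear form $g_v(u,w)=\frac{\partial^2}{\partial s\,\partial t}\big|_{s=t=0}L(v+su+tw)$ on $T_xM$, has signature $(-,+,\dots,+)$. Let $X$ be a smooth vector field with $L(X)<0$ (a time orientation). Let $\Omega'_x=\{v\in T_xM: L(v)<0\}$, call the elements of the connected component of $\overline{\Omega'_x}\setminus\{0\}$ containing $X(x)$ future-directed causal, and let $\Omega_x$ be the set of $v\in\Omega'_x$ that are future-directed causal. Causal (timelike) curves are $C^1$-curves $[0,1]\to M$ with future-directed causal velocities (velocities in $\Omega$). Write $x\ll y$ if there is a timelike curve from $x$ to $y$, and $x\le y$ if $x=y$ or there is a causal curve from $x$ to $y$. Let $l(x,y)$ be the supremum of $\int_0^1\sqrt{-2L(\dot\gamma)}\,dt$ over the causal curves $\gamma$ from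 $x$ to $y$, with $l(x,y)=-\infty$ if there is none; a causal curve attaining the supremum is called maximizing. Assume that $(M,L)$ is globally hyperbolic: every neighborhood of every point $x$ contains a neighborhood $V$ of $x$ to which no causal curve returns after having left it, and all sets $\{z: x\le z\le y\}$ are compact. For $k\in\mathbb R$ let $\mathbb M^2_k$ be the simply connected Lorentzian model plane of constant sectional curvature $k$ (the Minkowski plane if $k=0$, the universal cover of the two-dimensional de Sitter space if $k>0$ and of the two-dimensional anti-de Sitter space if $k<0$, rescaled), and let $\bar l$ be its time separation function, defined as above. A triangle $\triangle(x,y,z)$ consists of points $x\ll y\ll z$ and maximizing causal curves (sides) from $x$ to $y$, from $y$ to $z$, and from $x$ to $z$. Let $a=l(x,y)$, $b=l(y,z)$, $c=l(x,z)$, and suppose that $a,b,c$ are finite and positive, $a+b\le c$, that $c<\pi/\sqrt k$ if $a+b=c$ and $k>0$, and that $c<\pi/\sqrt{-k}$ if $a+b<c$ and $k<0$. A comparison triangle is then a triangle $\triangle(\bar x,\bar y,\bar z)$ in $\mathbb M^2_k$ with $\bar l(\bar x,\bar y)=a$, $\bar l(\bar y,\bar z)=b$, $\bar l(\bar x,\bar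 z)=c$. A point on a side of $\triangle(x,y,z)$ and a point on the respective side of $\triangle(\bar x,\bar y,\bar z)$ correspond to each other if they have the same time separations from the endpoints of these sides. We say that $(M,L)$ has timelike curvature bounded below (above) by $k$ in the sense of triangle comparison if every point of $M$ has a neighborhood $U$ such that for all triangles $\triangle(x,y,z)$ with $x,y,z\in U$, all comparison triangles of them in $\mathbb M^2_k$, all points $p,q$ on the sides of $\triangle(x,y,z)$ and all corresponding points $\bar p,\bar q$ on the sides of the comparison triangle, $l(p,q)\le\bar l(\bar p,\bar q)$ (respectively $l(p,q)\ge\bar l(\bar p,\bar q)$). If there is $k\in\mathbb R$ such that $(M,L)$ has timelike curvature bounded below by $k$ or bounded above by $k$ in the sense of triangle comparison, then $g_v(w,w)=2L(w)$ for all $x\in M$ and all $v,w\in\Omega_x$. In particular $L$ is quadratic and Lorentzian on each $\Omega_x$: for every $x\in M$ there is a symmetric bilinear form $B$ of signature $(-,+,\dots,+)$ on $T_xM$ with $L(w)=\tfrac12B(w,w)$ for all $w\in\Omega_x$. -/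

import Mathlib

open Set Filter Topology
open scoped Manifold ContDiff

noncomputable section

/-- A continuous bilinear form on `ℝⁿ` that has signature `(-,+,…,+)`: in a suitable basis its
Gram matrix is `diag(-1, 1, …, 1)`. -/
def HasLorentzianSignature {n : ℕ}
    (B : EuclideanSpace ℝ (Fin n) →L[ℝ] EuclideanSpace ℝ (Fin n) →L[ℝ] ℝ) : Prop :=
  ∃ b : Module.Basis (Fin n) ℝ (EuclideanSpace ℝ (Fin n)), ∀ i j : Fin n,
    B (b i) (b j) = if i = j then (if (i : ℕ) = 0 then -1 else 1) else 0

/-- The fundamental tensor `g_v` of `L` at `v ∈ T_x M`: the Hessian at `v` of the restriction of `L`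
to the vector space `T_x M` (which is, as a vector space, a copy of `ℝⁿ`). -/
def fundamentalTensor {n : ℕ} {M : Type*} [TopologicalSpace M]
    [ChartedSpace (EuclideanSpace ℝ (Fin n)) M] (L : TangentBundle (𝓡 n) M → ℝ) (x : M)
    (v : EuclideanSpace ℝ (Fin n)) :
    EuclideanSpace ℝ (Fin n) →L[ℝ] EuclideanSpace ℝ (Fin n) →L[ℝ] ℝ :=
  fderiv ℝ (fderiv ℝ (fun u : EuclideanSpace ℝ (Fin n) => L ⟨x, u⟩)) v

/-- A Finsler spacetime structure on the smooth `n`-manifold `M`: a Lorentz–Finsler structure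
`L : TM → ℝ` together with a smooth timelike vector field `X`, the time orientation. -/
structure FinslerSpacetime (n : ℕ) (M : Type*) [TopologicalSpace M]
    [ChartedSpace (EuclideanSpace ℝ (Fin n)) M] [IsManifold (𝓡 n) ∞ M] where
  /-- the Lorentz–Finsler structure -/
  L : TangentBundle (𝓡 n) M → ℝ
  /-- `L` is smooth off the zero section -/
  smooth_L : ContMDiffOn (𝓡 n).tangent 𝓘(ℝ, ℝ) ∞ L {p | p.2 ≠ 0}
  /-- `L` is positively homogeneous of degree two -/
  homogeneous_L : ∀ (x : M) (v : TangentSpace (𝓡 n) x) (c : ℝ), 0 < c →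
    L ⟨x, c • v⟩ = c ^ 2 * L ⟨x, v⟩
  /-- `g_v` has signature `(-,+,…,+)` for all nonzero `v` -/
  signature_L : ∀ (x : M) (v : TangentSpace (𝓡 n) x), v ≠ 0 →
    HasLorentzianSignature (fundamentalTensor L x v)
  /-- the time orientation -/
  X : ∀ x : M, TangentSpace (𝓡 n) x
  /-- `X` is smooth -/
  smooth_X : ContMDiff (𝓡 n) (𝓡 n).tangent ∞
    (fun x => (⟨x, X x⟩ : TangentBundle (𝓡 n) M))
  /-- `X` is timelike -/
  timelike_X : ∀ x : M, L ⟨x, X x⟩ < 0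

namespace FinslerSpacetime

section Causality

variable {n : ℕ} {M : Type*} [TopologicalSpace M] [ChartedSpace (EuclideanSpace ℝ (Fin n)) M]
  [IsManifold (𝓡 n) ∞ M] (S : FinslerSpacetime n M)

/-- The fundamental tensor `g_v` of the spacetime, for `v ∈ T_x M`. -/
def g (x : M) (v : TangentSpace (𝓡 n) x) :
    EuclideanSpace ℝ (Fin n) →L[ℝ] EuclideanSpace ℝ (Fin n) →L[ℝ] ℝ :=
  fundamentalTensor S.L x v

/-- `Ω'_x`, the set of timelike vectors at `x`. -/
def timelike (x : M) : Set (TangentSpace (𝓡 n) x) := {v | S.L ⟨x, v⟩ < 0}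

/-- The future-directed causal vectors at `x`: the connected component of `X(x)` in
`closure Ω'_x \ {0}`. -/
def futureCausal (x : M) : Set (TangentSpace (𝓡 n) x) :=
  connectedComponentIn (closure (S.timelike x) \ {0}) (S.X x)

/-- `Ω_x`, the set of future-directed timelike vectors at `x`. -/
def futureTimelike (x : M) : Set (TangentSpace (𝓡 n) x) := S.timelike x ∩ S.futureCausal x

/-- `F(v) = √(-2 L(v))`, used for causal vectors. -/
def F (x : M) (v : TangentSpace (𝓡 n) x) : ℝ := Real.sqrt (-2 * S.L ⟨x, v⟩)

/-- The velocity at `t ∈ [0,1]` of a curve `c : [0,1] → M` (one-sided at the endpoints). A curve is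
given as a function on `ℝ`, of which only the restriction to `[0,1]` matters. -/
def velocity (c : ℝ → M) (t : ℝ) : TangentSpace (𝓡 n) (c t) :=
  mfderivWithin 𝓘(ℝ, ℝ) (𝓡 n) c (Icc 0 1) t (1 : ℝ)

/-- Future-directed timelike `C¹` curves `c : [0,1] → M` from `x` to `y`. -/
structure IsTimelikeCurve (c : ℝ → M) (x y : M) : Prop where
  contMDiffOn : ContMDiffOn 𝓘(ℝ, ℝ) (𝓡 n) 1 c (Icc 0 1)
  velocity_mem : ∀ t ∈ Icc (0 : ℝ) 1, velocity c t ∈ S.futureTimelike (c t)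
  source : c 0 = x
  target : c 1 = y

/-- Future-directed causal `C¹` curves `c : [0,1] → M` from `x` to `y`. -/
structure IsCausalCurve (c : ℝ → M) (x y : M) : Prop where
  contMDiffOn : ContMDiffOn 𝓘(ℝ, ℝ) (𝓡 n) 1 c (Icc 0 1)
  velocity_mem : ∀ t ∈ Icc (0 : ℝ) 1, velocity c t ∈ S.futureCausal (c t)
  source : c 0 = x
  target : c 1 = y

/-- `x ≪ y`. -/
def Chron (x y : M) : Prop := ∃ c : ℝ → M, S.IsTimelikeCurve c x y

/-- `x ≤ y`: either `x = y` or there is a causal curve from `x` to `y`. -/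
def CausalLE (x y : M) : Prop := x = y ∨ ∃ c : ℝ → M, S.IsCausalCurve c x y

/-- Strong causality: every neighborhood `U` of a point `x` contains a neighborhood `V` of `x` which
no causal curve meets more than once, i.e. no causal curve returns to `V` after having left it. -/
def StronglyCausal : Prop :=
  ∀ x : M, ∀ U ∈ 𝓝 x, ∃ V ∈ 𝓝 x, V ⊆ U ∧
    ∀ (c : ℝ → M) (y z : M), S.IsCausalCurve c y z →
      ∀ r ∈ Icc (0 : ℝ) 1, ∀ t ∈ Icc (0 : ℝ) 1, c r ∈ V → c t ∈ V → ∀ s ∈ Icc r t, c s ∈ V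

/-- Global hyperbolicity: strong causality and compactness of all causal diamonds. -/
def GloballyHyperbolic : Prop :=
  S.StronglyCausal ∧ ∀ x y : M, IsCompact {z | S.CausalLE x z ∧ S.CausalLE z y}

/-- The length `∫₀¹ F(ċ(t)) dt` of a curve. -/
def length (c : ℝ → M) : ℝ := ∫ t in (0 : ℝ)..1, S.F (c t) (velocity c t)

/-- The Lorentz–Finsler distance (time separation) `l(x,y)`: the supremum of the lengths of the
causal curves from `x` to `y`, which is `-∞` if there is no such curve. -/
def l (x y : M) : EReal := ⨆ (c : ℝ → M) (_ : S.IsCausalCurve c x y), (S.length c : EReal)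

/-- Maximizing causal curves from `x` to `y`. -/
def IsMaximizing (c : ℝ → M) (x y : M) : Prop :=
  S.IsCausalCurve c x y ∧ S.l x y = (S.length c : EReal)

/-- A timelike geodesic triangle `△(x,y,z)`: vertices `x ≪ y ≪ z`, with maximizing curves
`c₁` from `x` to `y`, `c₂` from `y` to `z` and `c₃` from `x` to `z` as sides. -/
structure IsTriangle (x y z : M) (c₁ c₂ c₃ : ℝ → M) : Prop where
  chron_xy : S.Chron x y
  chron_yz : S.Chron y z
  side_xy : S.IsMaximizing c₁ x y
  side_yz : S.IsMaximizing c₂ y z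
  side_xz : S.IsMaximizing c₃ x z

end Causality

section Model

/-- The coefficient of `-(dx⁰)²` in the metric of the model plane of curvature `k`. It is
`cosh²(√(-k) x¹)` if `k < 0` and `1` if `k ≥ 0` (recall that `√` of a negative number is `0`). -/
def modelA (k : ℝ) (p : EuclideanSpace ℝ (Fin 2)) : ℝ := Real.cosh (Real.sqrt (-k) * p 1) ^ 2

/-- The coefficient of `(dx¹)²` in the metric of the model plane of curvature `k`. It is
`cosh²(√k x⁰)` if `k > 0` and `1` if `k ≤ 0`. -/
def modelB (k : ℝ) (p : EuclideanSpace ℝ (Fin 2)) : ℝ := Real.cosh (Real.sqrt k * p 0) ^ 2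

/-- Half of the squared norm `-A(p) (v⁰)² + B(p) (v¹)²` of a tangent vector of the model plane. -/
def modelQ (k : ℝ) (p v : EuclideanSpace ℝ (Fin 2)) : ℝ :=
  (1 / 2) * (-(modelA k p * v 0 ^ 2) + modelB k p * v 1 ^ 2)

/-- The Lorentz–Finsler structure of the model plane. -/
def modelL (k : ℝ) (q : TangentBundle (𝓡 2) (EuclideanSpace ℝ (Fin 2))) : ℝ := modelQ k q.1 q.2

theorem modelA_pos (k : ℝ) (p : EuclideanSpace ℝ (Fin 2)) : 0 < modelA k p :=
  pow_pos (Real.cosh_pos _) 2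

theorem modelB_pos (k : ℝ) (p : EuclideanSpace ℝ (Fin 2)) : 0 < modelB k p :=
  pow_pos (Real.cosh_pos _) 2

theorem fundamentalTensor_modelL (k : ℝ) (p v u w : EuclideanSpace ℝ (Fin 2)) :
    fundamentalTensor (modelL k) p v u w = -(modelA k p * u 0 * w 0) + modelB k p * u 1 * w 1 := by
  have h0 : ∀ i : Fin 2, ∀ v : EuclideanSpace ℝ (Fin 2), HasFDerivAt
      (fun u : EuclideanSpace ℝ (Fin 2) => u i) (EuclideanSpace.proj i : EuclideanSpace ℝ (Fin 2) →L[ℝ] ℝ) v :=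
    fun i v => (EuclideanSpace.proj i : EuclideanSpace ℝ (Fin 2) →L[ℝ] ℝ).hasFDerivAt
  have h1 : fderiv ℝ (fun u : EuclideanSpace ℝ (Fin 2) => modelL k ⟨p, u⟩) = fun v =>
      (-(modelA k p) * v 0) • (EuclideanSpace.proj 0 : EuclideanSpace ℝ (Fin 2) →L[ℝ] ℝ)
      + (modelB k p * v 1) • (EuclideanSpace.proj 1 : EuclideanSpace ℝ (Fin 2) →L[ℝ] ℝ) := by
    funext v
    have h := ((((h0 0 v).pow 2).const_mul (modelA k p)).neg.add
      (((h0 1 v).pow 2).const_mul (modelB k p))).const_mul (1 / 2 : ℝ)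
    refine (HasFDerivAt.fderiv (f := fun u : EuclideanSpace ℝ (Fin 2) => modelL k ⟨p, u⟩)
      (h.congr_of_eventuallyEq (Eventually.of_forall fun _ => rfl))).trans ?_
    ext w
    simp
    ring
  have h2 := (((h0 0 v).const_mul (-(modelA k p))).smul_const
      (EuclideanSpace.proj 0 : EuclideanSpace ℝ (Fin 2) →L[ℝ] ℝ)).add
    (((h0 1 v).const_mul (modelB k p)).smul_const
      (EuclideanSpace.proj 1 : EuclideanSpace ℝ (Fin 2) →L[ℝ] ℝ))
  unfold fundamentalTensor
  rw [h1]
  refine (congrArg (fun T : EuclideanSpace ℝ (Fin 2) →L[ℝ] EuclideanSpace ℝ (Fin 2) →L[ℝ] ℝ =>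
    T u w) h2.fderiv).trans ?_
  simp

theorem hasLorentzianSignature_modelL (k : ℝ) (p v : EuclideanSpace ℝ (Fin 2)) :
    HasLorentzianSignature (fundamentalTensor (modelL k) p v) := by
  have hA := modelA_pos k p
  have hB := modelB_pos k p
  refine ⟨(EuclideanSpace.basisFun (Fin 2) ℝ).toBasis.isUnitSMul
    (w := ![(Real.sqrt (modelA k p))⁻¹, (Real.sqrt (modelB k p))⁻¹]) ?_, ?_⟩
  · intro i
    fin_cases i
    · simpa using (Real.sqrt_pos.2 hA).ne'
    · simpa using (Real.sqrt_pos.2 hB).ne'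
  · have eA := Real.mul_self_sqrt hA.le
    have eB := Real.mul_self_sqrt hB.le
    have nA := (Real.sqrt_pos.2 hA).ne'
    have nB := (Real.sqrt_pos.2 hB).ne'
    intro i j
    rw [fundamentalTensor_modelL]
    fin_cases i <;> fin_cases j <;> simp [Module.Basis.isUnitSMul_apply]
    · rw [mul_assoc, ← mul_inv, eA, mul_inv_cancel₀ hA.ne']
    · rw [mul_assoc, ← mul_inv, eB, mul_inv_cancel₀ hB.ne']

theorem contDiff_modelQ (k : ℝ) :
    ContDiff ℝ ∞ (fun r : EuclideanSpace ℝ (Fin 2) × EuclideanSpace ℝ (Fin 2) =>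
      modelQ k r.1 r.2) := by
  have h : ∀ i : Fin 2, ContDiff ℝ ∞ (fun v : EuclideanSpace ℝ (Fin 2) => v i) := fun i =>
    (EuclideanSpace.proj i : EuclideanSpace ℝ (Fin 2) →L[ℝ] ℝ).contDiff
  have h1 := fun i => (h i).comp (contDiff_fst (𝕜 := ℝ) (n := ∞)
    (E := EuclideanSpace ℝ (Fin 2)) (F := EuclideanSpace ℝ (Fin 2)))
  have h2 := fun i => (h i).comp (contDiff_snd (𝕜 := ℝ) (n := ∞)
    (E := EuclideanSpace ℝ (Fin 2)) (F := EuclideanSpace ℝ (Fin 2)))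
  have hA := ((Real.contDiff_cosh (n := ∞)).comp
    ((contDiff_const (c := Real.sqrt (-k))).mul (h1 1))).pow 2
  have hB := ((Real.contDiff_cosh (n := ∞)).comp
    ((contDiff_const (c := Real.sqrt k)).mul (h1 0))).pow 2
  exact contDiff_const.mul (((hA.mul ((h2 0).pow 2)).neg).add (hB.mul ((h2 1).pow 2)))

theorem modelQ_smul (k c : ℝ) (p v : EuclideanSpace ℝ (Fin 2)) :
    modelQ k p (c • v) = c ^ 2 * modelQ k p v := by
  simp only [modelQ, PiLp.smul_apply, smul_eq_mul]
  ring

theorem modelQ_single_neg (k : ℝ) (p : EuclideanSpace ℝ (Fin 2)) :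
    modelQ k p (EuclideanSpace.single 0 1) < 0 := by
  simp [modelQ, modelA_pos k p]

theorem contMDiff_modelL (k : ℝ) : ContMDiff (𝓡 2).tangent 𝓘(ℝ, ℝ) ∞ (modelL k) := by
  have h1 : ContMDiff (𝓡 2).tangent (𝓡 2) ∞
      (fun q : TangentBundle (𝓡 2) (EuclideanSpace ℝ (Fin 2)) => q.1) :=
    Bundle.contMDiff_proj (TangentSpace (𝓡 2))
  have h2 : ContMDiff (𝓡 2).tangent (𝓡 2) ∞
      (fun q : TangentBundle (𝓡 2) (EuclideanSpace ℝ (Fin 2)) =>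
        (q.2 : EuclideanSpace ℝ (Fin 2))) :=
    contMDiff_snd_tangentBundle_modelSpace (EuclideanSpace ℝ (Fin 2)) (𝓡 2)
  have h3 : ContMDiff 𝓘(ℝ, EuclideanSpace ℝ (Fin 2) × EuclideanSpace ℝ (Fin 2)) 𝓘(ℝ, ℝ) ∞
      (fun r : EuclideanSpace ℝ (Fin 2) × EuclideanSpace ℝ (Fin 2) => modelQ k r.1 r.2) :=
    (contDiff_modelQ k).contMDiff
  have h4 : ContMDiff (𝓡 2).tangent 𝓘(ℝ, ℝ) ∞
      (fun q : TangentBundle (𝓡 2) (EuclideanSpace ℝ (Fin 2)) => modelQ k q.1 q.2) := by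
    have h := ContMDiff.comp h3 (h1.prodMk_space h2)
    exact h
  exact h4

/-- The model plane `𝕄²_k` of constant sectional curvature `k`, as the plane with the metric
* `-dt² + cosh²(√k t) dx²` if `k > 0` (universal cover of de Sitter space),
* `-dt² + dx²` if `k = 0` (Minkowski space),
* `-cosh²(√(-k) x) dt² + dx²` if `k < 0` (universal cover of anti-de Sitter space),
time-oriented by `∂/∂t`. -/
def model (k : ℝ) : FinslerSpacetime 2 (EuclideanSpace ℝ (Fin 2)) where
  L := modelL k
  smooth_L := (contMDiff_modelL k).contMDiffOn
  homogeneous_L := fun x v c _ => modelQ_smul k c x v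
  signature_L := fun x v _ => hasLorentzianSignature_modelL k x v
  X := fun _ => (EuclideanSpace.single 0 1 : EuclideanSpace ℝ (Fin 2))
  smooth_X := contMDiff_vectorSpace_iff_contDiff.2 contDiff_const
  timelike_X := fun x => modelQ_single_neg k x

end Model

section Comparison

variable {n : ℕ} {M : Type*} [TopologicalSpace M] [ChartedSpace (EuclideanSpace ℝ (Fin n)) M]
  [IsManifold (𝓡 n) ∞ M] (S : FinslerSpacetime n M)

/-- The size bounds under which side lengths `a, b, c` are compared with a triangle in `𝕄²_k`. -/
def SizeBounds (k a b c : ℝ) : Prop :=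
  0 < a ∧ 0 < b ∧ a + b ≤ c ∧ (a + b = c → 0 < k → c < Real.pi / Real.sqrt k) ∧
    (a + b < c → k < 0 → c < Real.pi / Real.sqrt (-k))

/-- The point `p` of the side `c` from `x` to `y` in `S` and the point `p'` of the side `c'` from
`x'` to `y'` in `𝕄²_k`, of the same length as `c`, correspond to each other: they have the same
time separations from the endpoints. -/
def Corresponding (k : ℝ) (x y : M) (c : ℝ → M) (x' y' : EuclideanSpace ℝ (Fin 2))
    (c' : ℝ → EuclideanSpace ℝ (Fin 2)) (p : M) (p' : EuclideanSpace ℝ (Fin 2)) : Prop :=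
  p ∈ c '' Icc 0 1 ∧ p' ∈ c' '' Icc 0 1 ∧
    (model k).l x' p' = S.l x p ∧ (model k).l p' y' = S.l p y

/-- The relation `R (l(p,q)) (l'(p',q'))` holds for all triangles `△(x,y,z)` with vertices in `U`,
all comparison triangles `△(x',y',z')` in `𝕄²_k`, and all points `p, q` on the sides of `△(x,y,z)`
with corresponding points `p', q'` on the sides of `△(x',y',z')`. -/
def TriangleComparisonOn (k : ℝ) (R : EReal → EReal → Prop) (U : Set M) : Prop :=
  ∀ x ∈ U, ∀ y ∈ U, ∀ z ∈ U, ∀ (c₁ c₂ c₃ : ℝ → M), S.IsTriangle x y z c₁ c₂ c₃ →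
    ∀ a b c : ℝ, S.l x y = a → S.l y z = b → S.l x z = c → SizeBounds k a b c →
    ∀ (x' y' z' : EuclideanSpace ℝ (Fin 2)) (c₁' c₂' c₃' : ℝ → EuclideanSpace ℝ (Fin 2)),
      (model k).IsTriangle x' y' z' c₁' c₂' c₃' →
      (model k).l x' y' = a → (model k).l y' z' = b → (model k).l x' z' = c →
    ∀ (p q : M) (p' q' : EuclideanSpace ℝ (Fin 2)),
      (S.Corresponding k x y c₁ x' y' c₁' p p' ∨ S.Corresponding k y z c₂ y' z' c₂' p p' ∨
        S.Corresponding k x z c₃ x' z' c₃' p p') →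
      (S.Corresponding k x y c₁ x' y' c₁' q q' ∨ S.Corresponding k y z c₂ y' z' c₂' q q' ∨
        S.Corresponding k x z c₃ x' z' c₃' q q') →
      R (S.l p q) ((model k).l p' q')

/-- Timelike curvature bounded below by `k` in the sense of triangle comparison. -/
def TimelikeCurvatureBoundedBelow (k : ℝ) : Prop :=
  ∀ x₀ : M, ∃ U ∈ 𝓝 x₀, S.TriangleComparisonOn k (· ≤ ·) U

/-- Timelike curvature bounded above by `k` in the sense of triangle comparison. -/
def TimelikeCurvatureBoundedAbove (k : ℝ) : Prop :=
  ∀ x₀ : M, ∃ U ∈ 𝓝 x₀, S.TriangleComparisonOn k (· ≥ ·) U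

end Comparison

end FinslerSpacetime

end

open Set Filter Topology
open scoped Manifold ContDiff

noncomputable section

-- On infinitesimal triangles a curvature bound compares `L` with a quadratic form. Fix `x` and
-- linearly independent `v`, `w` in its future timecone, and consider the triangle with vertices
-- `x`, `x + εv`, `x + ε(v + w)` in a chart. Divided by `ε`, its side lengths tend to `F v`, `F w`,
-- `F (v + w)`, where `F = √(-2L)`; by the strict reverse triangle inequality the limit triangle is
-- non-degenerate. Suitable comparison triangles, rescaled, tend to a Minkowski triangle with these
-- sides, whatever `k` is. Take the point at parameter `(1 - α)/2` of the first side and the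
-- midpoint of the long side. Their displacement is `ε(αv + w)/2` up to `O(ε²)`, so their rescaled
-- time separation tends to `F (αv + w) / 2`. In the Minkowski plane the corresponding length is
-- determined by the three sides through polarization. A lower curvature bound therefore yields, for
-- `0 < α < 1`, `L (αv + w) ≥ α² L v + L w + α (L (v + w) - L v - L w)`, and an upper bound yields
-- the opposite inequality.
--
-- At `α = 1` both sides agree, so the inequality fixes the sign of the difference of their
-- derivatives there. Exchanging `v` and `w` gives a second such sign, and by Euler's identity the
-- two differences add up to zero. Hence `dL_{v+w}(v) = L v + L (v + w) - L w`. Applied to `δv` and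
-- `u - δv`, this reads `L (u - δv) = L u - δ dL_u(v) + δ² L v`, whose second derivative at `δ = 0`
-- is `g_u(v,v) = 2 L v` (`hessian_eq_of_interpolation`).
--
-- The limit requires short maximizing curves with controlled length and position. They are
-- solutions of a rescaled geodesic equation, obtained by contraction (`exists_isGeodesic`). They
-- maximize because `F` is strictly concave transversally to timelike vectors
-- (`IsGeodesic.exists_integral_le`), and strong causality keeps all competitors inside the chart
-- (`exists_isShortGeodesic`). An intermediate value argument provides comparison triangles with
-- exactly the given sides (`neBot_model_triangles`), and `exists_comparison` carries out the limit.

local notation "𝔼" n:max => EuclideanSpace ℝ (Fin n)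

/-! ### Linear algebra of Lorentzian bilinear forms -/

namespace HasLorentzianSignature

variable {n : ℕ} {B : 𝔼 n →L[ℝ] 𝔼 n →L[ℝ] ℝ}

theorem symm (hB : HasLorentzianSignature B) (u w : 𝔼 n) : B u w = B w u := by
  obtain ⟨b, hb⟩ := hB
  have h : B.toLinearMap₁₂ = B.flip.toLinearMap₁₂ := by
    refine LinearMap.ext_basis b b fun i j => ?_
    change B (b i) (b j) = B (b j) (b i)
    rw [hb, hb]
    by_cases h : i = j
    · subst h; rfl
    · rw [if_neg h, if_neg (Ne.symm h)]
  exact congrArg (fun T : 𝔼 n →ₗ[ℝ] 𝔼 n →ₗ[ℝ] ℝ => T u w) h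

/-- The functional is the coordinate of the negative basis vector: on its kernel only the plus signs
of the Gram matrix are left. -/
theorem exists_linear_pos (hB : HasLorentzianSignature B) :
    ∃ τ : 𝔼 n →ₗ[ℝ] ℝ, ∀ q, τ q = 0 → q ≠ 0 → 0 < B q q := by
  obtain ⟨b, hb⟩ := hB
  rcases Nat.eq_zero_or_pos n with h0 | hn
  · subst h0
    exact ⟨0, fun q _ hq => absurd (Subsingleton.elim q 0) hq⟩
  · refine ⟨b.coord ⟨0, hn⟩, fun q hq hq0 => ?_⟩
    have h1 : B q q = ∑ i, (b.repr q i) * ((b.repr q i) *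
        (if (i : ℕ) = 0 then -1 else 1)) := by
      conv_lhs => rw [← b.sum_repr q]
      simp only [map_sum, map_smul, sum_apply,
        smul_apply, smul_eq_mul, hb]
      refine Finset.sum_congr rfl fun i _ => ?_
      congr 1
      simp
    have h2 : ∀ i, 0 ≤ (b.repr q i) * ((b.repr q i) * (if (i : ℕ) = 0 then -1 else 1)) := by
      intro i
      by_cases hi : (i : ℕ) = 0
      · have : i = ⟨0, hn⟩ := Fin.ext hi
        subst this
        have : b.repr q ⟨0, hn⟩ = 0 := hq
        simp [this]
      · simp only [hi, if_false, mul_one]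
        exact mul_self_nonneg _
    rw [h1]
    refine (Finset.sum_nonneg fun i _ => h2 i).lt_of_ne fun h => hq0 ?_
    have h3 := (Finset.sum_eq_zero_iff_of_nonneg fun i _ => h2 i).1 h.symm
    refine b.repr.map_eq_zero_iff.1 (Finsupp.ext fun i => ?_)
    have h4 := h3 i (Finset.mem_univ i)
    by_cases hi : (i : ℕ) = 0
    · have : i = ⟨0, hn⟩ := Fin.ext hi
      subst this
      exact hq
    · simpa [hi] using h4

theorem eq_zero_of_forall (hB : HasLorentzianSignature B) {q : 𝔼 n} (h : ∀ w, B q w = 0) :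
    q = 0 := by
  obtain ⟨b, hb⟩ := hB
  refine b.repr.map_eq_zero_iff.1 (Finsupp.ext fun i => ?_)
  have h1 := h (b i)
  rw [← b.sum_repr q] at h1
  simp only [map_sum, map_smul, sum_apply,
        smul_apply, smul_eq_mul, hb] at h1
  simp only [mul_ite, mul_zero, Finset.sum_ite_eq', Finset.mem_univ, if_true] at h1
  split_ifs at h1 <;> simpa using h1

/-- A vector orthogonal to a causal vector, and independent of it, is spacelike. -/
theorem pos_of_orthogonal (hB : HasLorentzianSignature B) {p w : 𝔼 n} (hp : B p p ≤ 0)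
    (hpw : B p w = 0) (hi : LinearIndependent ℝ ![p, w]) : 0 < B w w := by
  obtain ⟨τ, hτ⟩ := hB.exists_linear_pos
  have hp0 : p ≠ 0 := by simpa using hi.ne_zero 0
  have hτp : τ p ≠ 0 := fun h => absurd (hτ p h hp0) (not_lt.2 hp)
  -- This combination lies in the kernel of `τ` and is nonzero by independence. As `B p w = 0`,
  -- positivity there reads `τ(w)² B(p,p) + τ(p)² B(w,w) > 0`, and the first summand is nonpositive.
  have hq := hτ (τ w • p - τ p • w) (by simp; ring) (by
    intro h
    have := LinearIndependent.pair_iff.1 hi (τ w) (-τ p) (by rw [← h]; module)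
    exact hτp (neg_eq_zero.1 this.2))
  have hwp : B w p = 0 := by rw [hB.symm, hpw]
  simp only [map_sub, map_smul, sub_apply, smul_apply,
    smul_eq_mul, hpw, hwp] at hq
  have h1 : 0 < τ p ^ 2 := by positivity
  by_contra hw
  nlinarith [mul_nonneg (sq_nonneg (τ w)) (neg_nonneg.2 hp), mul_nonneg h1.le (neg_nonneg.2 (not_lt.1 hw))]

/-- The component of `w` orthogonal to the timelike vector `p` is spacelike; expanding its square
gives the strict reverse Cauchy–Schwarz inequality. -/
theorem mul_lt_sq (hB : HasLorentzianSignature B) {p w : 𝔼 n} (hp : B p p < 0)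
    (hi : LinearIndependent ℝ ![p, w]) : B p p * B w w < B p w ^ 2 := by
  have hp0 := hp.ne
  have h := hB.pos_of_orthogonal (w := w - (B p w / B p p) • p) hp.le
    (by simp; field_simp; ring) (by
      rw [LinearIndependent.pair_iff] at hi ⊢
      intro s t hst
      have := hi (s - t * (B p w / B p p)) t (by rw [← hst]; module)
      obtain ⟨h1, h2⟩ := this
      subst h2
      simpa using h1)
  simp only [map_sub, map_smul, sub_apply, smul_apply,
    smul_eq_mul, hB.symm w p] at h
  have h2 : B w w - B p w ^ 2 / B p p > 0 := by
    have : B w w - B p w / B p p * B p w - B p w / B p p * (B p w - B p w / B p p * B p p) =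
      B w w - B p w ^ 2 / B p p := by field_simp; ring
    linarith
  have h3 : B p p * (B w w - B p w ^ 2 / B p p) < 0 := mul_neg_of_neg_of_pos hp h2
  have h4 : B p p * (B w w - B p w ^ 2 / B p p) = B p p * B w w - B p w ^ 2 := by
    field_simp
  linarith

end HasLorentzianSignature

/-! ### Lorentz–Minkowski functions: Euler identities, causal cones, reverse Cauchy–Schwarz -/

/-- A function on `ℝⁿ` that is smooth off the origin, positively homogeneous of degree two and has
Lorentzian Hessians. -/
structure IsLorentzMinkowski {n : ℕ} (f : 𝔼 n → ℝ) : Prop where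
  contDiffAt : ∀ v, v ≠ 0 → ContDiffAt ℝ ∞ f v
  homogeneous : ∀ (v : 𝔼 n) (c : ℝ), 0 < c → f (c • v) = c ^ 2 * f v
  signature : ∀ v, v ≠ 0 → HasLorentzianSignature (fderiv ℝ (fderiv ℝ f) v)

namespace IsLorentzMinkowski

variable {n : ℕ} {f : 𝔼 n → ℝ} (hf : IsLorentzMinkowski f)

theorem map_zero (hf : IsLorentzMinkowski f) : f 0 = 0 := by
  have := hf.homogeneous 0 2 two_pos
  rw [smul_zero] at this
  linarith

theorem differentiableAt (hf : IsLorentzMinkowski f) {v : 𝔼 n} (hv : v ≠ 0) :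
    DifferentiableAt ℝ f v := (hf.contDiffAt v hv).differentiableAt (by simp)

theorem contDiffAt_fderiv (hf : IsLorentzMinkowski f) {v : 𝔼 n} (hv : v ≠ 0) :
    ContDiffAt ℝ ∞ (fderiv ℝ f) v := (hf.contDiffAt v hv).fderiv_right (by simp)

theorem hasFDerivAt_fderiv (hf : IsLorentzMinkowski f) {v : 𝔼 n} (hv : v ≠ 0) :
    HasFDerivAt (fderiv ℝ f) (fderiv ℝ (fderiv ℝ f) v) v :=
  ((hf.contDiffAt_fderiv hv).differentiableAt (by simp)).hasFDerivAt

theorem ne_zero_of_neg (hf : IsLorentzMinkowski f) {v : 𝔼 n} (hv : f v < 0) : v ≠ 0 := by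
  rintro rfl
  exact absurd hf.map_zero hv.ne

theorem hasDerivAt_line (hf : IsLorentzMinkowski f) {u w : 𝔼 n} {s : ℝ} (h : u + s • w ≠ 0) :
    HasDerivAt (fun s : ℝ => f (u + s • w)) (fderiv ℝ f (u + s • w) w) s := by
  have h1 : HasDerivAt (fun s : ℝ => u + s • w) w s := by
    simpa using ((hasDerivAt_id s).smul_const w).const_add u
  exact (hf.differentiableAt h).hasFDerivAt.comp_hasDerivAt s h1

theorem hasDerivAt_fderiv_line (hf : IsLorentzMinkowski f) {u w : 𝔼 n} {s : ℝ} (z : 𝔼 n)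
    (h : u + s • w ≠ 0) :
    HasDerivAt (fun s : ℝ => fderiv ℝ f (u + s • w) z)
      (fderiv ℝ (fderiv ℝ f) (u + s • w) w z) s := by
  have h1 : HasDerivAt (fun s : ℝ => u + s • w) w s := by
    simpa using ((hasDerivAt_id s).smul_const w).const_add u
  have h2 := (hf.hasFDerivAt_fderiv h).comp_hasDerivAt s h1
  simpa using h2.clm_apply (hasDerivAt_const s z)

theorem fderiv_smul (hf : IsLorentzMinkowski f) {v : 𝔼 n} (hv : v ≠ 0) {c : ℝ} (hc : 0 < c) :
    fderiv ℝ f (c • v) = c • fderiv ℝ f v := by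
  have h1 : fderiv ℝ (fun u => f (c • u)) v = c • fderiv ℝ f (c • v) :=
    fderiv_comp_smul c
  have h2 : (fun u => f (c • u)) = fun u => c ^ 2 • f u := by
    funext u; exact hf.homogeneous u c hc
  have h3 : fderiv ℝ (fun u => f (c • u)) v = c ^ 2 • fderiv ℝ f v := by
    rw [h2]
    exact fderiv_fun_const_smul (hf.differentiableAt hv) (c ^ 2)
  rw [h1] at h3
  have h4 := congrArg (fun T => c⁻¹ • T) h3
  simp only [smul_smul] at h4
  rw [inv_mul_cancel₀ hc.ne', one_smul] at h4
  rw [h4]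
  congr 1
  field_simp

/-- Euler's identity, from differentiating `f ((1 + s) • v) = (1 + s)² f v` at `s = 0`. -/
theorem fderiv_self (hf : IsLorentzMinkowski f) {v : 𝔼 n} (hv : v ≠ 0) :
    fderiv ℝ f v v = 2 * f v := by
  have h1 : HasDerivAt (fun s : ℝ => f (v + s • v)) (fderiv ℝ f v v) 0 := by
    simpa using hf.hasDerivAt_line (u := v) (w := v) (s := 0) (by simpa using hv)
  have h2 : HasDerivAt (fun s : ℝ => (1 + s) ^ 2 * f v) (2 * f v) 0 := by
    have := ((((hasDerivAt_id (0 : ℝ)).const_add 1).pow 2).mul_const (f v))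
    simpa using this
  refine h1.unique (h2.congr_of_eventuallyEq ?_)
  filter_upwards [lt_mem_nhds (show (-1 : ℝ) < 0 by norm_num)] with s hs
  rw [← hf.homogeneous v (1 + s) (by linarith)]
  congr 1
  module

theorem fderiv_fderiv_self (hf : IsLorentzMinkowski f) {v : 𝔼 n} (hv : v ≠ 0) :
    fderiv ℝ (fderiv ℝ f) v v = fderiv ℝ f v := by
  have h1 : HasDerivAt (fun s : ℝ => fderiv ℝ f (v + s • v)) (fderiv ℝ (fderiv ℝ f) v v) 0 := by
    have h1 : HasDerivAt (fun s : ℝ => v + s • v) v 0 := by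
      simpa using ((hasDerivAt_id (0 : ℝ)).smul_const v).const_add v
    have := HasFDerivAt.comp_hasDerivAt (x := (0 : ℝ)) (f := fun s : ℝ => v + s • v)
      (l := fderiv ℝ f) (l' := fderiv ℝ (fderiv ℝ f) v) (by simpa using hf.hasFDerivAt_fderiv hv) h1
    exact this
  have h2 : HasDerivAt (fun s : ℝ => (1 + s) • fderiv ℝ f v) (fderiv ℝ f v) 0 := by
    simpa using ((hasDerivAt_id (0 : ℝ)).const_add 1).smul_const (fderiv ℝ f v)
  refine h1.unique (h2.congr_of_eventuallyEq ?_)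
  filter_upwards [lt_mem_nhds (show (-1 : ℝ) < 0 by norm_num)] with s hs
  rw [← hf.fderiv_smul hv (show 0 < 1 + s by linarith)]
  congr 1
  module

theorem fderiv_fderiv_self_self (hf : IsLorentzMinkowski f) {v : 𝔼 n} (hv : v ≠ 0) :
    fderiv ℝ (fderiv ℝ f) v v v = 2 * f v := by
  rw [hf.fderiv_fderiv_self hv, hf.fderiv_self hv]

/-- A critical point of `f` on a line not through the origin at which `f ≤ 0` is a strict local
minimum. -/
theorem eventually_lt_of_fderiv_eq_zero (hf : IsLorentzMinkowski f) {u w : 𝔼 n} {s : ℝ}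
    (hi : LinearIndependent ℝ ![u + s • w, w]) (hle : f (u + s • w) ≤ 0)
    (h0 : fderiv ℝ f (u + s • w) w = 0) :
    ∀ᶠ t in 𝓝[≠] s, f (u + s • w) < f (u + t • w) := by
  have hp0 : u + s • w ≠ 0 := by simpa using hi.ne_zero 0
  set d := fderiv ℝ (fderiv ℝ f) (u + s • w) w w with hd
  have hdpos : 0 < d := by
    refine (hf.signature _ hp0).pos_of_orthogonal ?_ ?_ hi
    · rw [hf.fderiv_fderiv_self_self hp0]; linarith
    · rw [hf.fderiv_fderiv_self hp0, h0]
  have hne : ∀ᶠ t in 𝓝 s, u + t • w ≠ 0 := by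
    have : ContinuousAt (fun t : ℝ => u + t • w) s := by fun_prop
    exact this.eventually_ne hp0
  -- Half of the second derivative `d` is subtracted: `φ` still has the positive second derivative
  -- `d / 2`, and a local minimum of `φ` is a strict one of `f`.
  set φ : ℝ → ℝ := fun t => f (u + t • w) - d / 4 * (t - s) ^ 2 with hφ
  have hder : ∀ᶠ t in 𝓝 s, HasDerivAt φ (fderiv ℝ f (u + t • w) w - d / 2 * (t - s)) t := by
    filter_upwards [hne] with t ht
    have h1 := hf.hasDerivAt_line ht
    have h2 := ((((hasDerivAt_id t).sub_const s).pow 2).const_mul (d / 4))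
    refine (h1.sub h2).congr_deriv ?_
    simp; ring
  have hder2 : HasDerivAt (deriv φ) (d / 2) s := by
    have h1 := hf.hasDerivAt_fderiv_line w hp0
    have h2 := ((hasDerivAt_id s).sub_const s).const_mul (d / 2)
    refine ((h1.sub h2).congr_deriv ?_).congr_of_eventuallyEq
      (hder.mono fun t ht => ht.deriv)
    rw [← hd]; ring
  have hmin : IsLocalMin φ s := by
    refine isLocalMin_of_deriv_deriv_pos ?_ ?_ hder.self_of_nhds.continuousAt
    · rw [hder2.deriv]; positivity
    · rw [hder.self_of_nhds.deriv, h0]; simp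
  filter_upwards [nhdsWithin_le_nhds hmin, self_mem_nhdsWithin] with t ht hts
  have : 0 < (t - s) ^ 2 := by
    have : t - s ≠ 0 := sub_ne_zero.2 hts
    positivity
  simp only [hφ] at ht
  nlinarith

/-- A zero of `f` inside a segment on which `f ≤ 0` would be a local maximum, hence a critical
point. But critical points with `f ≤ 0` are strict local minima. -/
theorem neg_of_segment (hf : IsLorentzMinkowski f) {u v : 𝔼 n} (hu : f u < 0)
    (hi : LinearIndependent ℝ ![u, v]) (hle : ∀ s ∈ Icc (0 : ℝ) 1, f (u + s • (v - u)) ≤ 0) :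
    ∀ s ∈ Ico (0 : ℝ) 1, f (u + s • (v - u)) < 0 := by
  intro s hs
  rcases hs.1.eq_or_lt with rfl | h0
  · simpa using hu
  refine (hle s ⟨hs.1, hs.2.le⟩).lt_of_ne fun heq => ?_
  have hi' : LinearIndependent ℝ ![u + s • (v - u), v - u] := by
    rw [LinearIndependent.pair_iff] at hi ⊢
    intro a b hab
    obtain ⟨h1, h2⟩ := hi (a * (1 - s) - b) (a * s + b) (by rw [← hab]; module)
    have h3 : a = 0 := by linarith
    subst h3
    exact ⟨rfl, by linarith⟩
  have hp0 : u + s • (v - u) ≠ 0 := by simpa using hi'.ne_zero 0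
  have hmax : IsLocalMax (fun s : ℝ => f (u + s • (v - u))) s := by
    filter_upwards [Icc_mem_nhds h0 hs.2] with t ht
    rw [heq]
    exact hle t ht
  have hd := hmax.hasDerivAt_eq_zero (hf.hasDerivAt_line hp0)
  have h1 := hf.eventually_lt_of_fderiv_eq_zero hi' heq.le hd
  obtain ⟨t, ht1, ht2⟩ := (h1.and (nhdsWithin_le_nhds (Icc_mem_nhds h0 hs.2))).exists
  linarith [hle t ht2]

/-- The strict reverse Cauchy–Schwarz inequality in integrated form: `√(-2f)` is strictly concave
along timelike segments. -/
theorem strictConcaveOn_sqrt (hf : IsLorentzMinkowski f) {u v : 𝔼 n}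
    (hi : LinearIndependent ℝ ![u, v]) (hlt : ∀ s ∈ Ioo (0 : ℝ) 1, f (u + s • (v - u)) < 0) :
    StrictConcaveOn ℝ (Icc (0 : ℝ) 1) fun s => Real.sqrt (-2 * f (u + s • (v - u))) := by
  have hi' : ∀ s : ℝ, LinearIndependent ℝ ![u + s • (v - u), v - u] := by
    intro s
    rw [LinearIndependent.pair_iff] at hi ⊢
    intro a b hab
    obtain ⟨h1, h2⟩ := hi (a * (1 - s) - b) (a * s + b) (by rw [← hab]; module)
    have h3 : a = 0 := by linarith
    subst h3
    exact ⟨rfl, by linarith⟩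
  have hp0 : ∀ s : ℝ, u + s • (v - u) ≠ 0 := fun s => by simpa using (hi' s).ne_zero 0
  have hder : ∀ s ∈ Ioo (0 : ℝ) 1, HasDerivAt (fun s => Real.sqrt (-2 * f (u + s • (v - u))))
      (-(fderiv ℝ f (u + s • (v - u)) (v - u)) / Real.sqrt (-2 * f (u + s • (v - u)))) s := by
    intro s hs
    have h := ((hf.hasDerivAt_line (hp0 s)).const_mul (-2)).sqrt (by linarith [hlt s hs])
    refine h.congr_deriv ?_
    rw [mul_comm 2 (Real.sqrt _), ← div_div]
    ring
  refine strictConcaveOn_of_deriv2_neg (convex_Icc 0 1) (Continuous.continuousOn ?_) ?_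
  · exact Real.continuous_sqrt.comp (continuous_const.mul (continuous_iff_continuousAt.2 fun s =>
      (hf.hasDerivAt_line (hp0 s)).continuousAt))
  · intro s hs
    rw [interior_Icc] at hs
    have hneg := hlt s hs
    set p := u + s • (v - u) with hp
    have hF : 0 < Real.sqrt (-2 * f p) := Real.sqrt_pos.2 (by linarith)
    have h2 : HasDerivAt (deriv fun s => Real.sqrt (-2 * f (u + s • (v - u))))
        (((-(fderiv ℝ (fderiv ℝ f) p (v - u) (v - u))) * Real.sqrt (-2 * f p) -
          (-(fderiv ℝ f p (v - u))) * (-(fderiv ℝ f p (v - u)) / Real.sqrt (-2 * f p))) /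
          Real.sqrt (-2 * f p) ^ 2) s := by
      have h3 := ((hf.hasDerivAt_fderiv_line (v - u) (hp0 s)).neg.div (hder s hs) hF.ne')
      refine h3.congr_of_eventuallyEq ?_
      filter_upwards [Ioo_mem_nhds hs.1 hs.2] with t ht
      exact (hder t ht).deriv
    have h4 : deriv^[2] (fun s => Real.sqrt (-2 * f (u + s • (v - u)))) s = _ := h2.deriv
    rw [h4]
    refine div_neg_of_neg_of_pos ?_ (by positivity)
    have hS := hf.signature p (hp0 s)
    -- The second derivative of `√(-2f)` along the segment has the sign of `2 f f'' - (f')²`, which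
    -- is negative by the reverse Cauchy–Schwarz inequality for the Hessian at `p`.
    have h5 := hS.mul_lt_sq (w := v - u) (by rw [hf.fderiv_fderiv_self_self (hp0 s)]; linarith)
      (hi' s)
    rw [hf.fderiv_fderiv_self_self (hp0 s), hf.fderiv_fderiv_self (hp0 s)] at h5
    have h6 := Real.sq_sqrt (show 0 ≤ -2 * f p by linarith)
    set r := Real.sqrt (-2 * f p)
    have h7 : (-(fderiv ℝ (fderiv ℝ f) p (v - u) (v - u)) * r -
        -(fderiv ℝ f p (v - u)) * (-(fderiv ℝ f p (v - u)) / r)) =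
        (2 * f p * fderiv ℝ (fderiv ℝ f) p (v - u) (v - u) - (fderiv ℝ f p (v - u)) ^ 2) / r := by
      have : 2 * f p = - r ^ 2 := by linarith
      rw [this]
      field_simp
    rw [h7]
    exact div_neg_of_neg_of_pos (by linarith) hF

/-- A strictly concave function lies below its tangent at `u`. With `F = √(-2f)` this is `F v < F u
+ dF_u(v - u)`, and Euler's identity removes the term in `u`. -/
theorem sqrt_lt_of_segment (hf : IsLorentzMinkowski f) {u v : 𝔼 n} (hu : f u < 0)
    (hi : LinearIndependent ℝ ![u, v]) (hle : ∀ s ∈ Icc (0 : ℝ) 1, f (u + s • (v - u)) ≤ 0) :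
    Real.sqrt (-2 * f u) * Real.sqrt (-2 * f v) < -(fderiv ℝ f u v) := by
  have hlt := hf.neg_of_segment hu hi hle
  have hc := hf.strictConcaveOn_sqrt hi fun s hs => hlt s ⟨hs.1.le, hs.2⟩
  have hu0 := hf.ne_zero_of_neg hu
  have hF : 0 < Real.sqrt (-2 * f u) := Real.sqrt_pos.2 (by linarith)
  have hd : HasDerivAt (fun s : ℝ => Real.sqrt (-2 * f (u + s • (v - u))))
      (-(fderiv ℝ f u (v - u)) / Real.sqrt (-2 * f u)) 0 := by
    have h := ((hf.hasDerivAt_line (u := u) (w := v - u) (s := 0) (by simpa using hu0)).const_mul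
      (-2)).sqrt (by simpa using hu.ne)
    simp only [zero_smul, add_zero] at h
    refine h.congr_deriv ?_
    rw [mul_comm 2 (Real.sqrt _), ← div_div]
    ring
  have h1 := StrictConcaveOn.slope_lt_of_hasDerivAt hc (x := 0) (y := 1) (by simp) (by simp) one_pos hd
  rw [slope_def_field] at h1
  simp only [one_smul, zero_smul, add_zero, sub_zero, div_one, add_sub_cancel] at h1
  rw [map_sub, hf.fderiv_self hu0, lt_div_iff₀ hF] at h1
  have h6 := Real.mul_self_sqrt (show 0 ≤ -2 * f u by linarith)
  nlinarith

/-- Self-improvement of the closed conditions that describe the causal cone of `u`: the weak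
inequality becomes strict, which is what makes these conditions open as well in `mem_cone`. -/
theorem fderiv_neg_of_segment (hf : IsLorentzMinkowski f) {u v : 𝔼 n} (hu : f u < 0)
    (hv : v ≠ 0) (hd : fderiv ℝ f u v ≤ 0)
    (hle : ∀ s ∈ Icc (0 : ℝ) 1, f (u + s • (v - u)) ≤ 0) : fderiv ℝ f u v < 0 := by
  have hu0 := hf.ne_zero_of_neg hu
  by_cases hi : LinearIndependent ℝ ![u, v]
  · have := hf.sqrt_lt_of_segment hu hi hle
    have h2 : 0 ≤ Real.sqrt (-2 * f u) * Real.sqrt (-2 * f v) := by positivity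
    linarith
  · rw [LinearIndependent.pair_iff' hu0] at hi
    push Not at hi
    obtain ⟨a, rfl⟩ := hi
    have ha : a ≠ 0 := fun h => hv (by simp [h])
    rw [map_smul, hf.fderiv_self hu0, smul_eq_mul] at hd ⊢
    refine hd.lt_of_ne ?_
    simp [ha, hu.ne]

theorem segment_neg (hf : IsLorentzMinkowski f) {u v : 𝔼 n} (hu : f u < 0)
    (hv : v ≠ 0) (hd : fderiv ℝ f u v ≤ 0)
    (hle : ∀ s ∈ Icc (0 : ℝ) 1, f (u + s • (v - u)) ≤ 0) :
    ∀ s ∈ Ico (0 : ℝ) 1, f (u + s • (v - u)) < 0 := by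
  have hu0 := hf.ne_zero_of_neg hu
  by_cases hi : LinearIndependent ℝ ![u, v]
  · exact hf.neg_of_segment hu hi hle
  · rw [LinearIndependent.pair_iff' hu0] at hi
    push Not at hi
    obtain ⟨a, rfl⟩ := hi
    have ha : 0 ≤ a := by
      rw [map_smul, hf.fderiv_self hu0, smul_eq_mul] at hd
      by_contra h
      nlinarith
    intro s hs
    have h1 : u + s • (a • u - u) = ((1 - s) + s * a) • u := by module
    have h2 : 0 < (1 - s) + s * a := by
      have := hs.1; have := hs.2
      nlinarith [mul_nonneg hs.1 ha]
    rw [h1, hf.homogeneous _ _ h2]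
    have : 0 < ((1 - s) + s * a) ^ 2 := by positivity
    nlinarith

theorem closure_subset (hf : IsLorentzMinkowski f) {v : 𝔼 n}
    (hv : v ∈ closure {v | f v < 0} \ {0}) : f v ≤ 0 := by
  by_contra h
  push Not at h
  have := (hf.differentiableAt hv.2).continuousAt.eventually (lt_mem_nhds h)
  obtain ⟨w, hw1, hw2⟩ := mem_closure_iff_nhds.1 hv.1 _ this
  exact absurd (show 0 < f w from hw1) (not_lt.2 (le_of_lt hw2))

/-- The causal cone of a timelike vector `u`: a description of the connected component of `u` in the
set of causal vectors. -/
theorem mem_cone (hf : IsLorentzMinkowski f) {u v : 𝔼 n} (hu : f u < 0)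
    (hv : v ∈ connectedComponentIn (closure {v | f v < 0} \ {0}) u) :
    v ≠ 0 ∧ fderiv ℝ f u v < 0 ∧ ∀ s ∈ Icc (0 : ℝ) 1, f (u + s • (v - u)) ≤ 0 := by
  set D := closure {v | f v < 0} \ {0} with hD
  have hu0 := hf.ne_zero_of_neg hu
  have huD : u ∈ D := ⟨subset_closure hu, hu0⟩
  -- `J` is relatively open and closed in the set `D` of causal vectors and contains `u`, so it
  -- contains the whole component of `u`.
  set J : Set (𝔼 n) := {v | fderiv ℝ f u v ≤ 0 ∧ ∀ s ∈ Icc (0 : ℝ) 1, f (u + s • (v - u)) ≤ 0}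
    with hJ
  suffices h : v ∈ J by
    have hvD := connectedComponentIn_subset D u hv
    exact ⟨hvD.2, hf.fderiv_neg_of_segment hu hvD.2 h.1 h.2, h.2⟩
  have hopen : ∀ v ∈ D, v ∈ J → ∀ᶠ v' in 𝓝[D] v, v' ∈ J := by
    intro v hvD hvJ
    have hv0 : v ≠ 0 := hvD.2
    have hd := hf.fderiv_neg_of_segment hu hv0 hvJ.1 hvJ.2
    have hneg := hf.segment_neg hu hv0 hvJ.1 hvJ.2
    have h1 : ∀ᶠ v' in 𝓝 v, fderiv ℝ f u v' < 0 :=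
      (fderiv ℝ f u).continuous.continuousAt.eventually (gt_mem_nhds hd)
    -- The condition `s ≤ 1` is repeated because the compactness argument lets the parameter range
    -- over a full neighbourhood of `s`, beyond `1` when `s = 1`.
    have h2 : ∀ᶠ v' in 𝓝 v, ∀ s ∈ Icc (0 : ℝ) 1, s ≤ 1 → v' ∈ D →
        f (u + s • (v' - u)) ≤ 0 := by
      refine isCompact_Icc.eventually_forall_of_forall_eventually fun s hs => ?_
      have hcont : ContinuousAt (fun z : 𝔼 n × ℝ => u + z.2 • (z.1 - u)) (v, s) := by fun_prop
      have hnegcase : f (u + s • (v - u)) < 0 →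
          ∀ᶠ z : 𝔼 n × ℝ in 𝓝 (v, s), z.2 ≤ 1 → z.1 ∈ D → f (u + z.2 • (z.1 - u)) ≤ 0 := by
        intro h
        have h3 : ContinuousAt f (u + s • (v - u)) :=
          (hf.differentiableAt (hf.ne_zero_of_neg h)).continuousAt
        have h4 := (ContinuousAt.comp (x := ((v, s) : 𝔼 n × ℝ)) (g := f) h3 hcont).eventually
          (gt_mem_nhds h)
        filter_upwards [h4] with z hz _ _ using le_of_lt hz
      rcases hs.2.lt_or_eq with hs1 | rfl
      · exact hnegcase (hneg s ⟨hs.1, hs1⟩)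
      · have hfv := hf.closure_subset hvD
        rcases hfv.lt_or_eq with hlt | heq
        · exact hnegcase (by simpa using hlt)
        · -- the boundary point is null
          have hi : LinearIndependent ℝ ![u, v] := by
            rw [LinearIndependent.pair_iff' hu0]
            rintro a rfl
            have ha : 0 ≤ a := by
              have := hvJ.1
              rw [map_smul, hf.fderiv_self hu0, smul_eq_mul] at this
              by_contra h
              nlinarith
            rcases ha.eq_or_lt with rfl | ha
            · simp at hv0
            · rw [hf.homogeneous _ _ ha] at heq
              have : 0 < a ^ 2 := by positivity
              nlinarith
          have hi' : LinearIndependent ℝ ![u + (1 : ℝ) • (v - u), v - u] := by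
            rw [LinearIndependent.pair_iff] at hi ⊢
            intro a b hab
            obtain ⟨h1, h2⟩ := hi (- b) (a + b) (by rw [← hab]; module)
            have h3 : b = 0 := by linarith
            subst h3
            exact ⟨by linarith, rfl⟩
          -- Along the segment `f` is negative before `v` and zero at `v`, so its derivative at `v`
          -- is nonnegative. It cannot vanish, since `v` would then be a strict local minimum.
          have hpos : 0 < fderiv ℝ f v (v - u) := by
            have hder : HasDerivAt (fun s : ℝ => f (u + s • (v - u))) (fderiv ℝ f v (v - u)) 1 := by
              have := hf.hasDerivAt_line (u := u) (w := v - u) (s := 1) (by simpa using hv0)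
              simpa using this
            have hnonneg : 0 ≤ fderiv ℝ f v (v - u) := by
              by_contra h
              push Not at h
              have h5 := (hasDerivAt_iff_tendsto_slope.1 hder).mono_left
                (nhdsWithin_mono (1 : ℝ) fun x (hx : x ∈ Iio 1) => ne_of_lt hx)
              obtain ⟨t, ht1, ht2⟩ := ((h5.eventually (gt_mem_nhds h)).and
                (Ioo_mem_nhdsLT (show (0 : ℝ) < 1 by norm_num))).exists
              have h8 := hneg t ⟨ht2.1.le, ht2.2⟩
              rw [slope_def_field, one_smul, add_sub_cancel, heq] at ht1
              have h9 : 0 < (f (u + t • (v - u)) - 0) / (t - 1) :=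
                div_pos_of_neg_of_neg (by linarith) (by linarith [ht2.2])
              linarith
            refine hnonneg.lt_of_ne fun h => ?_
            have h5 := hf.eventually_lt_of_fderiv_eq_zero hi' (by simpa using hfv)
              (by simpa using h.symm)
            have h6 : 𝓝[<] (1 : ℝ) ≤ 𝓝[≠] 1 := nhdsWithin_mono _ fun x hx => ne_of_lt hx
            have h7 := (h5.filter_mono h6).and (Ioo_mem_nhdsLT (show (0 : ℝ) < 1 by norm_num))
            obtain ⟨t, ht1, ht2⟩ := h7.exists
            have := hneg t ⟨ht2.1.le, ht2.2⟩
            simp only [one_smul, add_sub_cancel, heq] at ht1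
            linarith
          -- Strict differentiability makes the positive slope uniform for endpoints near `v` and
          -- parameters near `1`. Going back from an endpoint in `D`, where `f ≤ 0`, therefore keeps
          -- `f ≤ 0`.
          have hstrict : HasStrictFDerivAt f (fderiv ℝ f v) v :=
            (hf.contDiffAt v hv0).hasStrictFDerivAt (by simp)
          set d := fderiv ℝ f v (v - u) with hd'
          have hK : 0 < ‖v - u‖ + 1 := by positivity
          have h3 := hstrict.isLittleO.def (show 0 < d / 2 / (‖v - u‖ + 1) by positivity)
          have hcont2 : Tendsto (fun z : 𝔼 n × ℝ => (z.1, u + z.2 • (z.1 - u))) (𝓝 (v, 1))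
              (𝓝 (v, v)) := by
            have : Continuous (fun z : 𝔼 n × ℝ => (z.1, u + z.2 • (z.1 - u))) := by fun_prop
            simpa using this.tendsto (v, (1 : ℝ))
          have hsub : Tendsto (fun z : 𝔼 n × ℝ => z.1 - u) (𝓝 (v, 1)) (𝓝 (v - u)) := by
            have : Continuous (fun z : 𝔼 n × ℝ => z.1 - u) := by fun_prop
            exact this.tendsto (v, (1 : ℝ))
          have h4 := hsub.eventually ((fderiv ℝ f v).continuous.continuousAt.eventually
            (lt_mem_nhds (show d / 2 < fderiv ℝ f v (v - u) by rw [← hd']; linarith)))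
          have h5 := hsub.norm.eventually (gt_mem_nhds (show ‖v - u‖ < ‖v - u‖ + 1 by linarith))
          filter_upwards [hcont2.eventually h3, h4, h5] with z h3 h4 h5 hz1 hzD
          have h6 := hf.closure_subset hzD
          have h7 : z.1 - (u + z.2 • (z.1 - u)) = (1 - z.2) • (z.1 - u) := by module
          simp only [h7, map_smul, smul_eq_mul, norm_smul, Real.norm_eq_abs] at h3
          have h8 : 0 ≤ 1 - z.2 := by linarith
          rw [abs_of_nonneg h8] at h3
          have h9 := (abs_le.1 h3).1
          have h10 : d / 2 / (‖v - u‖ + 1) * ‖z.1 - u‖ ≤ d / 2 := by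
            rw [div_mul_eq_mul_div, div_le_iff₀ hK]
            gcongr
          have h11 := mul_le_mul_of_nonneg_left h10 h8
          have h12 := mul_le_mul_of_nonneg_left h4.le h8
          nlinarith
    filter_upwards [nhdsWithin_le_nhds h1, nhdsWithin_le_nhds h2, self_mem_nhdsWithin] with v' a b c
    exact ⟨a.le, fun s hs => b s hs hs.2 c⟩
  have hclosed : ∀ v ∈ D, v ∉ J → ∀ᶠ v' in 𝓝 v, v' ∉ J := by
    intro v hvD hvJ
    simp only [hJ, mem_ofPred_eq, not_and_or, not_le, not_forall] at hvJ
    rcases hvJ with h | ⟨s, hs, h⟩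
    · filter_upwards [(fderiv ℝ f u).continuous.continuousAt.eventually (lt_mem_nhds h)] with v' hv' hJ'
      exact absurd hJ'.1 (not_le.2 hv')
    · have hne : u + s • (v - u) ≠ 0 := fun h0 => by rw [h0, hf.map_zero] at h; exact lt_irrefl _ h
      have hcont : ContinuousAt (fun z : 𝔼 n => u + s • (z - u)) v := by fun_prop
      have h4 := (ContinuousAt.comp (x := v) (g := f)
        (hf.differentiableAt hne).continuousAt hcont).eventually (lt_mem_nhds h)
      filter_upwards [h4] with v' hv' hJ'
      exact absurd (hJ'.2 s hs) (not_le.2 hv')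
  set C := connectedComponentIn D u with hC
  have hCD : C ⊆ D := connectedComponentIn_subset D u
  have : PreconnectedSpace C :=
    isPreconnected_iff_preconnectedSpace.1 isPreconnected_connectedComponentIn
  have hclopen : IsClopen {c : C | (c : 𝔼 n) ∈ J} := by
    constructor
    · rw [← isOpen_compl_iff, isOpen_iff_mem_nhds]
      intro c hc
      exact continuous_subtype_val.continuousAt.eventually (hclosed c (hCD c.2) hc)
    · rw [isOpen_iff_mem_nhds]
      intro c hc
      have h1 := nhdsWithin_mono (c : 𝔼 n) hCD (hopen c (hCD c.2) hc)
      rw [nhds_subtype_eq_comap_nhdsWithin]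
      exact preimage_mem_comap h1
  have huJ : u ∈ J := by
    refine ⟨by rw [hf.fderiv_self hu0]; linarith, fun s _ => by simpa using hu.le⟩
  have huniv := hclopen.eq_univ ⟨⟨u, mem_connectedComponentIn huD⟩, huJ⟩
  have : (⟨v, hv⟩ : C) ∈ {c : C | (c : 𝔼 n) ∈ J} := by rw [huniv]; trivial
  exact this

/-- For dependent vectors, the cone condition makes `v` a positive multiple of `u`, and the function
is affine along the ray; otherwise strict concavity applies. -/
theorem concaveOn_sqrt (hf : IsLorentzMinkowski f) {u v : 𝔼 n} (hu : f u < 0)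
    (hv : v ∈ connectedComponentIn (closure {v | f v < 0} \ {0}) u) :
    ConcaveOn ℝ (Icc (0 : ℝ) 1) fun s => Real.sqrt (-2 * f (u + s • (v - u))) := by
  obtain ⟨hv0, hd, hle⟩ := hf.mem_cone hu hv
  have hu0 := hf.ne_zero_of_neg hu
  by_cases hi : LinearIndependent ℝ ![u, v]
  · exact (hf.strictConcaveOn_sqrt hi fun s hs =>
      hf.neg_of_segment hu hi hle s ⟨hs.1.le, hs.2⟩).concaveOn
  · rw [LinearIndependent.pair_iff' hu0] at hi
    push Not at hi
    obtain ⟨a, rfl⟩ := hi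
    rw [map_smul, hf.fderiv_self hu0, smul_eq_mul] at hd
    have ha : 0 < a := by
      by_contra h
      nlinarith
    have h : EqOn (fun s : ℝ => Real.sqrt (-2 * f u) + s * ((a - 1) * Real.sqrt (-2 * f u)))
        (fun s : ℝ => Real.sqrt (-2 * f (u + s • (a • u - u)))) (Icc 0 1) := by
      intro s hs
      have h1 : u + s • (a • u - u) = ((1 - s) + s * a) • u := by module
      have h2 : 0 < (1 - s) + s * a := by
        rcases hs.1.eq_or_lt with rfl | h
        · simp
        · have := hs.2
          nlinarith [mul_pos h ha]
      simp only [h1, hf.homogeneous _ _ h2]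
      rw [show -2 * (((1 - s) + s * a) ^ 2 * f u) = ((1 - s) + s * a) ^ 2 * (-2 * f u) by ring,
        Real.sqrt_mul (sq_nonneg ((1 - s) + s * a)), Real.sqrt_sq h2.le]
      ring
    refine ConcaveOn.congr ?_ h
    refine ⟨convex_Icc 0 1, fun x _ y _ p q _ _ hpq => le_of_eq ?_⟩
    simp only [smul_eq_mul]
    linear_combination hpq * Real.sqrt (-2 * f u)

theorem cone_of_segment (hf : IsLorentzMinkowski f) {u v : 𝔼 n}
    (h : ∀ s ∈ Icc (0 : ℝ) 1, f (u + s • (v - u)) < 0) :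
    v ∈ connectedComponentIn (closure {v | f v < 0} \ {0}) u := by
  have h1 : segment ℝ u v ⊆ closure {v | f v < 0} \ {0} := by
    rw [segment_eq_image']
    rintro _ ⟨s, hs, rfl⟩
    exact ⟨subset_closure (h s hs), hf.ne_zero_of_neg (h s hs)⟩
  exact (convex_segment u v).isPreconnected.subset_connectedComponentIn
    (left_mem_segment ℝ u v) h1 (right_mem_segment ℝ u v)

theorem sqrt_smul (hf : IsLorentzMinkowski f) (v : 𝔼 n) {c : ℝ} (hc : 0 < c) :
    Real.sqrt (-2 * f (c • v)) = c * Real.sqrt (-2 * f v) := by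
  rw [hf.homogeneous _ _ hc, show -2 * (c ^ 2 * f v) = c ^ 2 * (-2 * f v) by ring,
    Real.sqrt_mul (sq_nonneg c), Real.sqrt_sq hc.le]

end IsLorentzMinkowski

/-! ### Lorentz–Finsler structures on open sets: locally uniform estimates -/

/-- A time-oriented Lorentz–Finsler structure on an open subset of `ℝⁿ`. -/
structure LorentzFinslerDomain (n : ℕ) where
  U : Set (𝔼 n)
  isOpen_U : IsOpen U
  L : 𝔼 n × 𝔼 n → ℝ
  contDiffAt_L : ∀ x ∈ U, ∀ v, v ≠ 0 → ContDiffAt ℝ ∞ L (x, v)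
  homogeneous : ∀ x ∈ U, ∀ (v : 𝔼 n) (c : ℝ), 0 < c → L (x, c • v) = c ^ 2 * L (x, v)
  signature : ∀ x ∈ U, ∀ v, v ≠ 0 →
    HasLorentzianSignature (fderiv ℝ (fderiv ℝ fun u => L (x, u)) v)
  X : 𝔼 n → 𝔼 n
  continuousOn_X : ContinuousOn X U
  timelike_X : ∀ x ∈ U, L (x, X x) < 0

namespace LorentzFinslerDomain

variable {n : ℕ} (S : LorentzFinslerDomain n)

/-- The future-directed causal vectors at `x`. -/
def cone (x : 𝔼 n) : Set (𝔼 n) :=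
  connectedComponentIn (closure {v | S.L (x, v) < 0} \ {0}) (S.X x)

/-- `F = √(-2L)`. -/
def F (z : 𝔼 n × 𝔼 n) : ℝ := Real.sqrt (-2 * S.L z)

variable {S}

theorem fiber {x : 𝔼 n} (hx : x ∈ S.U) : IsLorentzMinkowski fun v => S.L (x, v) where
  contDiffAt v hv := (S.contDiffAt_L x hx v hv).comp v (by fun_prop)
  homogeneous v c hc := S.homogeneous x hx v c hc
  signature v hv := S.signature x hx v hv

theorem differentiableAt_L {x v : 𝔼 n} (hx : x ∈ S.U) (hv : v ≠ 0) :
    DifferentiableAt ℝ S.L (x, v) :=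
  (S.contDiffAt_L x hx v hv).differentiableAt (by simp)

theorem contDiffAt_fderiv_L {x v : 𝔼 n} (hx : x ∈ S.U) (hv : v ≠ 0) :
    ContDiffAt ℝ ∞ (fderiv ℝ S.L) (x, v) :=
  (S.contDiffAt_L x hx v hv).fderiv_right (by simp)

theorem fderiv_fiber {x v : 𝔼 n} (hx : x ∈ S.U) (hv : v ≠ 0) (w : 𝔼 n) :
    fderiv ℝ (fun u => S.L (x, u)) v w = fderiv ℝ S.L (x, v) (0, w) := by
  have h := (differentiableAt_L hx hv).hasFDerivAt.comp v (hasFDerivAt_prodMk_right x v)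
  exact congrArg (fun T : 𝔼 n →L[ℝ] ℝ => T w) h.fderiv

theorem snd_ne_zero {z : 𝔼 n × 𝔼 n} (hz : z.1 ∈ S.U) (h : S.L z < 0) : z.2 ≠ 0 :=
  (fiber hz).ne_zero_of_neg (v := z.2) h

theorem X_mem_cone {x : 𝔼 n} (hx : x ∈ S.U) : S.X x ∈ S.cone x :=
  mem_connectedComponentIn ⟨subset_closure (S.timelike_X x hx),
    (fiber hx).ne_zero_of_neg (S.timelike_X x hx)⟩

theorem cone_eq {x u : 𝔼 n} (hu : u ∈ S.cone x) :
    S.cone x = connectedComponentIn (closure {v | S.L (x, v) < 0} \ {0}) u :=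
  connectedComponentIn_eq hu

theorem ne_zero_of_mem_cone {x v : 𝔼 n} (hv : v ∈ S.cone x) : v ≠ 0 :=
  (connectedComponentIn_subset _ _ hv).2

/-- The cones are defined as components and give no direct control when `x` varies. A timelike
segment from `X x` to the vector certifies membership, and by compactness of `[0,1]` such a segment
persists under perturbation. -/
theorem eventually_mem_cone {x₀ u₀ : 𝔼 n} (hx : x₀ ∈ S.U) (hu : S.L (x₀, u₀) < 0)
    (huc : u₀ ∈ S.cone x₀) :
    ∀ᶠ z in 𝓝 (x₀, u₀), z.1 ∈ S.U ∧ S.L z < 0 ∧ z.2 ∈ S.cone z.1 := by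
  have hf := fiber hx
  have hu0 := hf.ne_zero_of_neg hu
  obtain ⟨h0, h1, h2⟩ := hf.mem_cone (S.timelike_X x₀ hx) huc
  have h3 := hf.segment_neg (S.timelike_X x₀ hx) h0 h1.le h2
  have hU : ∀ᶠ z : 𝔼 n × 𝔼 n in 𝓝 (x₀, u₀), z.1 ∈ S.U :=
    continuous_fst.continuousAt.eventually (S.isOpen_U.mem_nhds hx)
  have hL : ∀ᶠ z : 𝔼 n × 𝔼 n in 𝓝 (x₀, u₀), S.L z < 0 :=
    (differentiableAt_L hx hu0).continuousAt.eventually (gt_mem_nhds hu)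
  have hX : ContinuousAt S.X x₀ := S.continuousOn_X.continuousAt (S.isOpen_U.mem_nhds hx)
  have hseg : ∀ᶠ z : 𝔼 n × 𝔼 n in 𝓝 (x₀, u₀), ∀ s ∈ Icc (0 : ℝ) 1,
      S.L (z.1, S.X z.1 + s • (z.2 - S.X z.1)) < 0 := by
    refine isCompact_Icc.eventually_forall_of_forall_eventually fun s hs => ?_
    have h4 : S.L (x₀, S.X x₀ + s • (u₀ - S.X x₀)) < 0 := by
      rcases hs.2.lt_or_eq with h | rfl
      · exact h3 s ⟨hs.1, h⟩
      · simpa using hu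
    have h5 : ContinuousAt S.L (x₀, S.X x₀ + s • (u₀ - S.X x₀)) :=
      (differentiableAt_L hx (hf.ne_zero_of_neg h4)).continuousAt
    have h6 : ContinuousAt (fun q : (𝔼 n × 𝔼 n) × ℝ =>
        (q.1.1, S.X q.1.1 + q.2 • (q.1.2 - S.X q.1.1))) ((x₀, u₀), s) := by
      have hX' : ContinuousAt (fun q : (𝔼 n × 𝔼 n) × ℝ => S.X q.1.1) ((x₀, u₀), s) :=
        ContinuousAt.comp (x := (((x₀, u₀), s) : (𝔼 n × 𝔼 n) × ℝ)) (g := S.X)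
          (f := fun q : (𝔼 n × 𝔼 n) × ℝ => q.1.1) hX (by fun_prop)
      fun_prop
    exact (ContinuousAt.comp (x := (((x₀, u₀), s) : (𝔼 n × 𝔼 n) × ℝ)) (g := S.L) h5 h6).eventually
      (gt_mem_nhds h4)
  filter_upwards [hU, hL, hseg] with z a b c
  exact ⟨a, b, (fiber a).cone_of_segment c⟩

theorem mem_cone_of_timelike {x u v : 𝔼 n} (hx : x ∈ S.U) (hu : S.L (x, u) < 0)
    (huc : u ∈ S.cone x) (hv : v ∈ S.cone x) :
    fderiv ℝ S.L (x, u) (0, v) < 0 ∧ ∀ s ∈ Icc (0 : ℝ) 1, S.L (x, u + s • (v - u)) ≤ 0 := by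
  rw [cone_eq huc] at hv
  obtain ⟨-, h1, h2⟩ := (fiber hx).mem_cone hu hv
  rw [fderiv_fiber hx ((fiber hx).ne_zero_of_neg hu)] at h1
  exact ⟨h1, h2⟩

theorem fderiv_L_self {x u : 𝔼 n} (hx : x ∈ S.U) (hu : u ≠ 0) :
    fderiv ℝ S.L (x, u) (0, u) = 2 * S.L (x, u) := by
  rw [← fderiv_fiber hx hu, (fiber hx).fderiv_self hu]

theorem smul_mem_cone {x v : 𝔼 n} (hx : x ∈ S.U) (hv : v ∈ S.cone x) {c : ℝ} (hc : 0 < c) :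
    c • v ∈ S.cone x := by
  have hv0 := ne_zero_of_mem_cone hv
  have hD : v ∈ closure {v | S.L (x, v) < 0} \ {0} := connectedComponentIn_subset _ _ hv
  have h1 : (fun c : ℝ => c • v) '' Ioi 0 ⊆ closure {v | S.L (x, v) < 0} \ {0} := by
    rintro _ ⟨c, hc, rfl⟩
    refine ⟨?_, smul_ne_zero (ne_of_gt hc) hv0⟩
    have h2 : MapsTo (fun w : 𝔼 n => c • w) {v | S.L (x, v) < 0} {v | S.L (x, v) < 0} := by
      intro w hw
      have : S.L (x, c • w) = c ^ 2 * S.L (x, w) := S.homogeneous x hx w c hc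
      change S.L (x, c • w) < 0
      rw [this]
      exact mul_neg_of_pos_of_neg (pow_pos hc 2) hw
    exact map_mem_closure (continuous_const_smul c) hD.1 h2
  have h3 : IsPreconnected ((fun c : ℝ => c • v) '' Ioi 0) :=
    isPreconnected_Ioi.image _ (by fun_prop)
  rw [cone_eq hv]
  exact h3.subset_connectedComponentIn ⟨1, by simp, by simp⟩ h1 ⟨c, hc, rfl⟩

/-- The momentum of a timelike vector bounds the norm of causal vectors, locally uniformly. -/
theorem exists_norm_le {x₀ u₀ : 𝔼 n} (hx : x₀ ∈ S.U) (hu : S.L (x₀, u₀) < 0)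
    (huc : u₀ ∈ S.cone x₀) :
    ∃ κ > 0, ∀ᶠ x in 𝓝 x₀, ∀ v ∈ S.cone x, κ * ‖v‖ ≤ -(fderiv ℝ S.L (x₀, u₀) (0, v)) := by
  have hf := fiber hx
  have hu0 := hf.ne_zero_of_neg hu
  have hev : ∀ᶠ x in 𝓝 x₀, x ∈ S.U ∧ S.L (x, u₀) < 0 ∧ u₀ ∈ S.cone x := by
    have h : ContinuousAt (fun x : 𝔼 n => (x, u₀)) x₀ := by fun_prop
    exact h.eventually (eventually_mem_cone hx hu huc)
  have hD : ContinuousAt (fderiv ℝ S.L) (x₀, u₀) := (contDiffAt_fderiv_L hx hu0).continuousAt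
  have key : ∃ κ > 0, ∀ᶠ x in 𝓝 x₀, ∀ v ∈ Metric.sphere (0 : 𝔼 n) 1, v ∈ S.cone x →
      κ ≤ -(fderiv ℝ S.L (x₀, u₀) (0, v)) := by
    refine (isCompact_sphere (0 : 𝔼 n) 1).induction_on (p := fun s => ∃ κ > 0, ∀ᶠ x in 𝓝 x₀,
      ∀ v ∈ s, v ∈ S.cone x → κ ≤ -(fderiv ℝ S.L (x₀, u₀) (0, v))) ⟨1, one_pos, by simp⟩ ?_ ?_ ?_
    · rintro s t hst ⟨κ, hκ, h⟩
      exact ⟨κ, hκ, h.mono fun x hx v hv => hx v (hst hv)⟩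
    · rintro s t ⟨κ, hκ, h⟩ ⟨κ', hκ', h'⟩
      refine ⟨min κ κ', lt_min hκ hκ', (h.and h').mono fun x hx v hv hvc => ?_⟩
      rcases hv with hv | hv
      · exact (min_le_left _ _).trans (hx.1 v hv hvc)
      · exact (min_le_right _ _).trans (hx.2 v hv hvc)
    · intro v hv
      have hv0 : v ≠ 0 := by
        rintro rfl
        simp at hv
      suffices h : ∃ κ > 0, ∀ᶠ q : 𝔼 n × 𝔼 n in 𝓝 (x₀, v), q.2 ∈ S.cone q.1 →
          κ ≤ -(fderiv ℝ S.L (x₀, u₀) (0, q.2)) by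
        obtain ⟨κ, hκ, h⟩ := h
        rw [nhds_prod_eq, eventually_prod_iff] at h
        obtain ⟨pa, ha, pb, hb, hab⟩ := h
        exact ⟨{v | pb v}, nhdsWithin_le_nhds hb, κ, hκ, ha.mono fun x hx v hv => hab hx hv⟩
      -- By `mem_cone_of_timelike`, a positive value of `L` on the segment from `u₀`, or a positive
      -- pairing with the momentum, excludes all nearby vectors from the cones, so the bound is
      -- vacuous. In the remaining case the pairing at `v` is strictly negative, and half of it
      -- serves as bound nearby.
      by_cases hA : ∃ s ∈ Icc (0 : ℝ) 1, 0 < S.L (x₀, u₀ + s • (v - u₀))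
      · obtain ⟨s, hs, hpos⟩ := hA
        refine ⟨1, one_pos, ?_⟩
        have hne : u₀ + s • (v - u₀) ≠ 0 := fun h => by
          rw [h] at hpos
          exact hpos.ne' hf.map_zero
        have h6 : ContinuousAt (fun q : 𝔼 n × 𝔼 n => (q.1, u₀ + s • (q.2 - u₀))) (x₀, v) := by
          fun_prop
        have h7 := (ContinuousAt.comp (x := ((x₀, v) : 𝔼 n × 𝔼 n)) (g := S.L)
          (differentiableAt_L hx hne).continuousAt h6).eventually (lt_mem_nhds hpos)
        filter_upwards [h7, continuous_fst.continuousAt.eventually hev] with q h7 h8 h9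
        exact absurd ((mem_cone_of_timelike h8.1 h8.2.1 h8.2.2 h9).2 s hs) (not_le.2 h7)
      · push Not at hA
        by_cases hB : fderiv ℝ S.L (x₀, u₀) (0, v) ≤ 0
        · have hC := hf.fderiv_neg_of_segment hu hv0 (by rwa [fderiv_fiber hx hu0]) hA
          rw [fderiv_fiber hx hu0] at hC
          refine ⟨-(fderiv ℝ S.L (x₀, u₀) (0, v)) / 2, by linarith, ?_⟩
          have h6 : Continuous (fun q : 𝔼 n × 𝔼 n => fderiv ℝ S.L (x₀, u₀) (0, q.2)) := by fun_prop
          filter_upwards [h6.continuousAt.eventually (gt_mem_nhds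
            (show fderiv ℝ S.L (x₀, u₀) (0, v) < fderiv ℝ S.L (x₀, u₀) (0, v) / 2 by linarith))]
            with q hq _
          linarith
        · push Not at hB
          refine ⟨1, one_pos, ?_⟩
          have h6 : ContinuousAt (fun q : 𝔼 n × 𝔼 n => fderiv ℝ S.L (q.1, u₀) (0, q.2))
              (x₀, v) := by
            refine ContinuousAt.clm_apply ?_ (by fun_prop)
            exact ContinuousAt.comp (x := ((x₀, v) : 𝔼 n × 𝔼 n)) (g := fderiv ℝ S.L)
              (f := fun q => (q.1, u₀)) hD (by fun_prop)
          filter_upwards [h6.eventually (lt_mem_nhds hB),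
            continuous_fst.continuousAt.eventually hev] with q h7 h8 h9
          exact absurd (mem_cone_of_timelike h8.1 h8.2.1 h8.2.2 h9).1 (not_lt.2 h7.le)
  obtain ⟨κ, hκ, h⟩ := key
  refine ⟨κ, hκ, (h.and hev).mono fun x hx v hv => ?_⟩
  have hv0 := ne_zero_of_mem_cone hv
  have hnv : 0 < ‖v‖ := norm_pos_iff.2 hv0
  have hmem : ‖v‖⁻¹ • v ∈ S.cone x := smul_mem_cone hx.2.1 hv (inv_pos.2 hnv)
  have h1 := hx.1 (‖v‖⁻¹ • v) (by simp [norm_smul, hnv.ne']) hmem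
  have h2 : ((0 : 𝔼 n), ‖v‖⁻¹ • v) = ‖v‖⁻¹ • ((0 : 𝔼 n), v) := by simp
  rw [h2, map_smul, smul_eq_mul, ← mul_neg, inv_mul_eq_div, le_div_iff₀ hnv] at h1
  exact h1

theorem contDiffAt_F {z : 𝔼 n × 𝔼 n} (hz : z.1 ∈ S.U) (h : S.L z < 0) :
    ContDiffAt ℝ ∞ S.F z := by
  have h1 := S.contDiffAt_L z.1 hz z.2 (snd_ne_zero hz h)
  exact (contDiffAt_const.mul h1).sqrt (by simpa using h.ne)

theorem F_pos {z : 𝔼 n × 𝔼 n} (h : S.L z < 0) : 0 < S.F z :=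
  Real.sqrt_pos.2 (by linarith)

theorem fderiv_F {z : 𝔼 n × 𝔼 n} (hz : z.1 ∈ S.U) (h : S.L z < 0) :
    fderiv ℝ S.F z = (-(S.F z)⁻¹) • fderiv ℝ S.L z := by
  have h1 : HasFDerivAt S.L (fderiv ℝ S.L z) z :=
    (differentiableAt_L hz (snd_ne_zero hz h)).hasFDerivAt
  have h2 := (h1.const_mul (-2)).sqrt (by simpa using h.ne)
  refine h2.fderiv.trans ?_
  rw [smul_smul]
  congr 1
  change 1 / (2 * S.F z) * (-2) = _
  have := (F_pos h).ne'
  field_simp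

theorem F_smul {x : 𝔼 n} (hx : x ∈ S.U) (v : 𝔼 n) {c : ℝ} (hc : 0 < c) :
    S.F (x, c • v) = c * S.F (x, v) :=
  (fiber hx).sqrt_smul v hc

theorem F_nonneg (z : 𝔼 n × 𝔼 n) : 0 ≤ S.F z := Real.sqrt_nonneg _

theorem hasDerivAt_fderiv_F_line {x u w : 𝔼 n} (hx : x ∈ S.U) (hu : S.L (x, u) < 0) :
    HasDerivAt (fun s : ℝ => fderiv ℝ S.F (x, u + s • w) (0, w))
      (fderiv ℝ (fderiv ℝ S.F) (x, u) (0, w) (0, w)) 0 := by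
  have h1 : HasDerivAt (fun s : ℝ => (x, u + s • w)) ((0 : 𝔼 n), w) 0 :=
    (hasDerivAt_const (0 : ℝ) x).prodMk (by simpa using ((hasDerivAt_id (0 : ℝ)).smul_const w).const_add u)
  have h2 : HasFDerivAt (fderiv ℝ S.F) (fderiv ℝ (fderiv ℝ S.F) (x, u)) (x, u + (0 : ℝ) • w) := by
    rw [zero_smul, add_zero]
    exact (((contDiffAt_F hx hu).fderiv_right (m := ∞) (by simp)).differentiableAt
      (by simp)).hasFDerivAt
  have h3 : HasDerivAt (fun s : ℝ => fderiv ℝ S.F (x, u + s • w))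
      (fderiv ℝ (fderiv ℝ S.F) (x, u) (0, w)) 0 :=
    HasFDerivAt.comp_hasDerivAt (f := fun s : ℝ => (x, u + s • w)) (0 : ℝ) h2 h1
  have h4 := h3.clm_apply (hasDerivAt_const (0 : ℝ) ((0 : 𝔼 n), w))
  rwa [map_zero, add_zero] at h4

/-- The Hessian of `F` is negative definite transversally to a timelike vector. -/
theorem exists_hessian_F_le {x u : 𝔼 n} (hx : x ∈ S.U) (hu : S.L (x, u) < 0) :
    ∃ c > 0, ∀ w : 𝔼 n, fderiv ℝ S.L (x, u) (0, w) = 0 →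
      fderiv ℝ (fderiv ℝ S.F) (x, u) (0, w) (0, w) ≤ -c * ‖w‖ ^ 2 := by
  have hf := fiber hx
  have hu0 := hf.ne_zero_of_neg hu
  have key : ∀ w : 𝔼 n, w ≠ 0 → fderiv ℝ S.L (x, u) (0, w) = 0 →
      fderiv ℝ (fderiv ℝ S.F) (x, u) (0, w) (0, w) < 0 := by
    intro w hw h0
    have hpos : 0 < fderiv ℝ (fderiv ℝ fun u => S.L (x, u)) u w w := by
      refine (hf.signature u hu0).pos_of_orthogonal (p := u) ?_ ?_ ?_
      · rw [hf.fderiv_fderiv_self_self hu0]; linarith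
      · rw [hf.fderiv_fderiv_self hu0, fderiv_fiber hx hu0, h0]
      · rw [LinearIndependent.pair_iff' hu0]
        rintro a rfl
        have h2 : ((0 : 𝔼 n), a • u) = a • ((0 : 𝔼 n), u) := by simp
        rw [h2, map_smul, fderiv_L_self hx hu0, smul_eq_mul] at h0
        have ha : a ≠ 0 := fun h => hw (by simp [h])
        simp [ha, hu.ne] at h0
    have hcont : ContinuousAt (fun s : ℝ => (x, u + s • w)) 0 := by fun_prop
    have hneg : ∀ᶠ s in 𝓝 (0 : ℝ), S.L (x, u + s • w) < 0 := by
      have h3 : ContinuousAt S.L (x, u + (0 : ℝ) • w) := by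
        rw [zero_smul, add_zero]
        exact (differentiableAt_L hx hu0).continuousAt
      have := ContinuousAt.comp (x := (0 : ℝ)) (g := S.L) (f := fun s : ℝ => (x, u + s • w)) h3 hcont
      exact this.eventually (gt_mem_nhds (by simpa using hu))
    have hF0 := F_pos hu
    have h4 : HasDerivAt (fun s : ℝ => S.F (x, u + s • w)) (fderiv ℝ S.F (x, u) (0, w)) 0 := by
      have h1 : HasDerivAt (fun s : ℝ => (x, u + s • w)) ((0 : 𝔼 n), w) 0 :=
        (hasDerivAt_const (0 : ℝ) x).prodMk (by simpa using ((hasDerivAt_id (0 : ℝ)).smul_const w).const_add u)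
      have h2 : HasFDerivAt S.F (fderiv ℝ S.F (x, u)) (x, u + (0 : ℝ) • w) := by
        rw [zero_smul, add_zero]
        exact ((contDiffAt_F hx hu).differentiableAt (by simp)).hasFDerivAt
      exact h2.comp_hasDerivAt (0 : ℝ) h1
    have h5 := hf.hasDerivAt_fderiv_line (u := u) (w := w) (s := 0) w (by simpa using hu0)
    simp only [zero_smul, add_zero] at h5
    -- Along the line `dF(0,w) = -dL(0,w) / F`. Where `dL(0,w) = 0`, the quotient rule leaves
    -- `-d²L(w,w) / F`, which is negative because `w` is orthogonal to `u`.
    have h6 := h5.neg.div h4 (by simpa using hF0.ne')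
    have h7 := (hasDerivAt_fderiv_F_line (w := w) hx hu).unique (h6.congr_of_eventuallyEq (by
      filter_upwards [hneg] with s hs
      simp only [Pi.div_apply, Pi.neg_apply]
      rw [fderiv_F (z := (x, u + s • w)) hx hs, fderiv_fiber hx (hf.ne_zero_of_neg hs)]
      simp only [smul_apply, smul_eq_mul]
      ring))
    rw [h7]
    refine div_neg_of_neg_of_pos ?_ (by simp only [zero_smul, add_zero]; positivity)
    simp only [Pi.neg_apply, zero_smul, add_zero, fderiv_fiber hx hu0, h0]
    nlinarith
  have hcomp : IsCompact (Metric.sphere (0 : 𝔼 n) 1 ∩ {w | fderiv ℝ S.L (x, u) (0, w) = 0}) :=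
    (isCompact_sphere _ _).inter_right (isClosed_eq (by fun_prop) continuous_const)
  have hcont : Continuous fun w : 𝔼 n => fderiv ℝ (fderiv ℝ S.F) (x, u) (0, w) (0, w) := by
    fun_prop
  obtain ⟨c, hc, h⟩ : ∃ c > 0, ∀ w ∈ Metric.sphere (0 : 𝔼 n) 1 ∩
      {w | fderiv ℝ S.L (x, u) (0, w) = 0},
      fderiv ℝ (fderiv ℝ S.F) (x, u) (0, w) (0, w) ≤ -c := by
    rcases Set.eq_empty_or_nonempty (Metric.sphere (0 : 𝔼 n) 1 ∩
      {w | fderiv ℝ S.L (x, u) (0, w) = 0}) with he | hne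
    · exact ⟨1, one_pos, fun w hw => by rw [he] at hw; exact hw.elim⟩
    · obtain ⟨w, hw, hmax⟩ := hcomp.exists_isMaxOn hne hcont.continuousOn
      refine ⟨-(fderiv ℝ (fderiv ℝ S.F) (x, u) (0, w) (0, w)), ?_, fun w' hw' => ?_⟩
      · have hw0 : w ≠ 0 := by
          rintro rfl
          simp at hw
        have := key w hw0 hw.2
        linarith
      · rw [neg_neg]
        exact hmax hw'
  refine ⟨c, hc, fun w hw => ?_⟩
  by_cases hw0 : w = 0
  · rw [hw0, Prod.mk_zero_zero, map_zero, norm_zero]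
    simp
  have hnw : 0 < ‖w‖ := norm_pos_iff.2 hw0
  have h2 : ((0 : 𝔼 n), ‖w‖⁻¹ • w) = ‖w‖⁻¹ • ((0 : 𝔼 n), w) := by simp
  have h1 := h (‖w‖⁻¹ • w) ⟨by simp [norm_smul, hnw.ne'], by
    simp only [mem_ofPred_eq]; rw [h2, map_smul, hw, smul_zero]⟩
  rw [h2] at h1
  simp only [map_smul, smul_apply, smul_eq_mul] at h1
  have h3 := mul_le_mul_of_nonneg_left h1 (sq_nonneg ‖w‖)
  have h4 : ‖w‖ ^ 2 * (‖w‖⁻¹ * (‖w‖⁻¹ * fderiv ℝ (fderiv ℝ S.F) (x, u) (0, w) (0, w))) =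
      fderiv ℝ (fderiv ℝ S.F) (x, u) (0, w) (0, w) := by field_simp
  linarith

/-- Quantitative reverse Cauchy–Schwarz inequality: strict concavity of `F` transversally to
timelike vectors. -/
theorem exists_F_le {x₀ u₀ : 𝔼 n} (hx : x₀ ∈ S.U) (hu : S.L (x₀, u₀) < 0)
    (huc : u₀ ∈ S.cone x₀) :
    ∃ c > 0, ∀ᶠ z in 𝓝 (x₀, u₀), ∀ V ∈ S.cone z.1,
      fderiv ℝ S.L (x₀, u₀) (0, V - z.2) = 0 →
      S.F (z.1, V) ≤ S.F z + fderiv ℝ S.F z (0, V - z.2) - c * ‖V - z.2‖ ^ 2 := by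
  obtain ⟨c₀, hc₀, hH⟩ := exists_hessian_F_le hx hu
  obtain ⟨κ, hκ, hnorm⟩ := exists_norm_le hx hu huc
  set τ := fderiv ℝ S.L (x₀, u₀) with hτ
  have hstrict : HasStrictFDerivAt (fderiv ℝ S.F) (fderiv ℝ (fderiv ℝ S.F) (x₀, u₀)) (x₀, u₀) :=
    ((contDiffAt_F hx hu).fderiv_right (m := ∞) (by simp)).hasStrictFDerivAt (by simp)
  have h1 := hstrict.isLittleO.def (show 0 < c₀ / 2 by positivity)
  obtain ⟨r₁, hr₁, hb₁⟩ := Metric.eventually_nhds_iff_ball.1 h1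
  obtain ⟨r₂, hr₂, hb₂⟩ := Metric.eventually_nhds_iff_ball.1 (eventually_mem_cone hx hu huc)
  obtain ⟨r₃, hr₃, hb₃⟩ := Metric.eventually_nhds_iff_ball.1 hnorm
  set r := min (min r₁ r₂) (min r₃ 1) with hr
  have hr0 : 0 < r := by positivity
  have hrr₁ : r ≤ r₁ := (min_le_left _ _).trans (min_le_left _ _)
  have hrr₂ : r ≤ r₂ := (min_le_left _ _).trans (min_le_right _ _)
  have hrr₃ : r ≤ r₃ := (min_le_right _ _).trans (min_le_left _ _)
  have hr1 : r ≤ 1 := (min_le_right _ _).trans (min_le_right _ _)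
  -- `V` and `z.2` have the same pairing with the momentum `τ`, so `exists_norm_le` bounds `V`; `D`
  -- is the resulting bound for `‖V - z.2‖`.
  set D := ‖τ‖ * (‖u₀‖ + 1) / κ + ‖u₀‖ + 1 with hD
  have hD0 : 0 ≤ D := by positivity
  -- For `σ ≤ σ₀` the point `z.2 + σ • w` stays where the Hessian estimate is available. This yields
  -- a quadratic gain at `σ₀` only; concavity on the whole segment transports it to `σ = 1`, even
  -- though `V` may be far from `u₀` or null.
  set σ₀ := r / 2 / (D + 1) with hσ
  have hσ0 : 0 < σ₀ := by positivity
  have hσ1 : σ₀ ≤ 1 := by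
    rw [hσ, div_le_one (by positivity)]
    linarith
  have hσD : σ₀ * D < r / 2 := by
    rw [hσ, div_mul_eq_mul_div, div_lt_iff₀ (by positivity)]
    nlinarith
  refine ⟨c₀ / 4 * σ₀, by positivity, ?_⟩
  filter_upwards [Metric.ball_mem_nhds (x₀, u₀) (half_pos hr0)] with z hz V hV hτV
  have hz1 : dist z.1 x₀ < r / 2 := (le_max_left _ _).trans_lt hz
  have hz2 : dist z.2 u₀ < r / 2 := (le_max_right _ _).trans_lt hz
  set w := V - z.2 with hw
  have hw0 : ‖w‖ ≤ D := by
    have h2 : ‖z.2‖ ≤ ‖u₀‖ + 1 := by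
      have := norm_le_norm_add_norm_sub' z.2 u₀
      rw [← dist_eq_norm] at this
      linarith
    have h3 : κ * ‖V‖ ≤ ‖τ‖ * (‖u₀‖ + 1) := by
      refine (hb₃ z.1 (by rw [Metric.mem_ball]; linarith) V hV).trans ?_
      have h4 : ((0 : 𝔼 n), V) = (0, z.2) + (0, w) := by simp [hw]
      rw [h4, map_add, hτV, add_zero]
      refine (neg_le_abs _).trans ((τ.le_opNorm _).trans ?_)
      gcongr
      simpa [Prod.norm_def] using h2
    have h5 : ‖V‖ ≤ ‖τ‖ * (‖u₀‖ + 1) / κ := by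
      rw [le_div_iff₀ hκ]; linarith
    have := norm_sub_le V z.2
    rw [← hw] at this
    linarith
  have hball : ∀ σ ∈ Icc (0 : ℝ) σ₀, dist (z.1, z.2 + σ • w) (x₀, u₀) < r := by
    intro σ hσ'
    refine max_lt (by linarith : dist z.1 x₀ < r) ?_
    have h2 : dist (z.2 + σ • w) u₀ ≤ dist z.2 u₀ + σ * ‖w‖ := by
      rw [dist_eq_norm, dist_eq_norm]
      have : z.2 + σ • w - u₀ = (z.2 - u₀) + σ • w := by abel
      rw [this]
      refine (norm_add_le _ _).trans ?_
      rw [norm_smul, Real.norm_of_nonneg hσ'.1]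
    have h3 : σ * ‖w‖ ≤ σ₀ * D := mul_le_mul hσ'.2 hw0 (norm_nonneg _) hσ0.le
    change dist (z.2 + σ • w) u₀ < r
    linarith
  have hzr : dist z (x₀, u₀) < r := hz.trans (by linarith)
  have hmem := hb₂ z (hzr.trans_le hrr₂)
  have hder : ∀ σ ∈ Icc (0 : ℝ) σ₀, HasDerivAt (fun σ : ℝ => S.F (z.1, z.2 + σ • w))
      (fderiv ℝ S.F (z.1, z.2 + σ • w) (0, w)) σ := by
    intro σ hσ'
    have h2 := hb₂ _ ((hball σ hσ').trans_le hrr₂)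
    have h3 : HasDerivAt (fun s : ℝ => (z.1, z.2 + s • w)) ((0 : 𝔼 n), w) σ :=
      (hasDerivAt_const σ z.1).prodMk (by
        simpa using ((hasDerivAt_id σ).smul_const w).const_add z.2)
    exact ((contDiffAt_F h2.1 h2.2.1).differentiableAt (by simp)).hasFDerivAt.comp_hasDerivAt σ h3
  have hderle : ∀ σ ∈ Icc (0 : ℝ) σ₀, fderiv ℝ S.F (z.1, z.2 + σ • w) (0, w) ≤
      fderiv ℝ S.F z (0, w) - c₀ / 2 * σ * ‖w‖ ^ 2 := by
    intro σ hσ'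
    have h2 := hb₁ ((z.1, z.2 + σ • w), z) (max_lt ((hball σ hσ').trans_le hrr₁)
      (hzr.trans_le hrr₁))
    have h3 : ((z.1, z.2 + σ • w), z).1 - ((z.1, z.2 + σ • w), z).2 = σ • ((0 : 𝔼 n), w) := by
      ext <;> simp
    simp only [h3] at h2
    have h4 : ‖σ • ((0 : 𝔼 n), w)‖ = σ * ‖w‖ := by
      rw [norm_smul, Real.norm_of_nonneg hσ'.1]
      simp [Prod.norm_def]
    rw [h4, map_smul] at h2
    have h5 := ContinuousLinearMap.le_of_opNorm_le _ h2 ((0 : 𝔼 n), w)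
    simp only [sub_apply, smul_apply, smul_eq_mul] at h5
    have h6 : ‖((0 : 𝔼 n), w)‖ = ‖w‖ := by simp [Prod.norm_def]
    rw [h6] at h5
    have h7 := (abs_le.1 h5).2
    have h8 := mul_le_mul_of_nonneg_left (hH w hτV) hσ'.1
    nlinarith
  set φ : ℝ → ℝ := fun σ => S.F (z.1, z.2 + σ • w) - σ * fderiv ℝ S.F z (0, w) +
    c₀ / 4 * σ ^ 2 * ‖w‖ ^ 2 with hφ
  have hφd : ∀ σ ∈ Icc (0 : ℝ) σ₀, HasDerivAt φ (fderiv ℝ S.F (z.1, z.2 + σ • w) (0, w) -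
      fderiv ℝ S.F z (0, w) + c₀ / 2 * σ * ‖w‖ ^ 2) σ := by
    intro σ hσ'
    have h2 := (((hder σ hσ').sub ((hasDerivAt_id σ).mul_const (fderiv ℝ S.F z (0, w)))).add
      ((((hasDerivAt_id σ).pow 2).const_mul (c₀ / 4)).mul_const (‖w‖ ^ 2)))
    refine h2.congr_deriv ?_
    simp only [id_eq, Nat.cast_ofNat]
    ring
  have hanti : AntitoneOn φ (Icc 0 σ₀) := by
    refine antitoneOn_of_deriv_nonpos (convex_Icc _ _)
      (fun σ hσ' => (hφd σ hσ').continuousAt.continuousWithinAt)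
      (fun σ hσ' => (hφd σ (interior_subset hσ')).differentiableAt.differentiableWithinAt) ?_
    intro σ hσ'
    rw [(hφd σ (interior_subset hσ')).deriv]
    linarith [hderle σ (interior_subset hσ')]
  have h2 := hanti (left_mem_Icc.2 hσ0.le) (right_mem_Icc.2 hσ0.le) hσ0.le
  have hconc := (fiber hmem.1).concaveOn_sqrt (u := z.2) (v := V) hmem.2.1
    (by rw [← cone_eq hmem.2.2]; exact hV)
  have h3 := hconc.2 (show (0 : ℝ) ∈ Icc (0 : ℝ) 1 by simp) (show (1 : ℝ) ∈ Icc (0 : ℝ) 1 by simp)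
    (show 0 ≤ 1 - σ₀ by linarith) hσ0.le (by ring)
  simp only [smul_eq_mul, mul_zero, mul_one, zero_add, zero_smul, add_zero, one_smul,
    add_sub_cancel] at h3
  change (1 - σ₀) * S.F z + σ₀ * S.F (z.1, V) ≤ S.F (z.1, z.2 + σ₀ • w) at h3
  simp only [hφ, zero_smul, add_zero, Prod.mk.eta, zero_mul, sub_zero] at h2
  have h4 : σ₀ * S.F (z.1, V) ≤ σ₀ * (S.F z + fderiv ℝ S.F z (0, w) - c₀ / 4 * σ₀ * ‖w‖ ^ 2) := by
    nlinarith
  exact le_of_mul_le_mul_left h4 hσ0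

/-- Second-order upper bound of `F` at a causal vector in terms of the first-order expansion at a
timelike vector. -/
theorem exists_F_le_expansion {x₀ u₀ : 𝔼 n} (hx : x₀ ∈ S.U) (hu : S.L (x₀, u₀) < 0)
    (huc : u₀ ∈ S.cone x₀) :
    ∃ c > 0, ∃ C > 0, ∃ r > 0, ∀ x ∈ Metric.ball x₀ r, ∀ y ∈ Metric.ball x₀ r,
      ∀ u ∈ Metric.ball u₀ r, ∀ V ∈ S.cone x, fderiv ℝ S.L (x₀, u₀) (0, V - u) = 0 →
      S.F (x, V) ≤ S.F (y, u) + fderiv ℝ S.F (y, u) (x - y, V - u) + C * ‖x - y‖ ^ 2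
        - c * ‖V - u‖ ^ 2 := by
  obtain ⟨c, hc, h1⟩ := exists_F_le hx hu huc
  have hD : ContDiffAt ℝ ∞ (fderiv ℝ S.F) (x₀, u₀) := (contDiffAt_F hx hu).fderiv_right (by simp)
  obtain ⟨K, t, ht, hK⟩ := (hD.of_le (m := 1) (by simp)).exists_lipschitzOnWith
  obtain ⟨r, hr, hb⟩ := Metric.eventually_nhds_iff_ball.1
    ((h1.and (eventually_mem_cone hx hu huc)).and ht)
  -- The mixed term `K ‖x - y‖ ‖V - u‖`, due to the change of base point, is split by Young's
  -- inequality: it uses half of the gain `c` and adds `K² / (2c)` to the error in `x - y`.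
  refine ⟨c / 2, by positivity, K + K ^ 2 / (2 * c) + 1, by positivity, r, hr, ?_⟩
  intro x hx' y hy u hu' V hV hτ
  have hin : ∀ x' ∈ Metric.ball x₀ r, (x', u) ∈ Metric.ball (x₀, u₀) r := fun x' hx' =>
    Metric.mem_ball.2 (max_lt hx' hu')
  have h2 := (hb _ (hin x hx')).1.1 V hV hτ
  set w := V - u with hw
  have hlip : ∀ x' ∈ Metric.ball x₀ r,
      ‖fderiv ℝ S.F (x', u) - fderiv ℝ S.F (y, u)‖ ≤ K * ‖x' - y‖ := by
    intro x' hx'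
    have := hK.norm_sub_le (hb _ (hin x' hx')).2 (hb _ (hin y hy)).2
    simpa [Prod.norm_def] using this
  have h3 : fderiv ℝ S.F (x, u) (0, w) - fderiv ℝ S.F (y, u) (0, w) ≤ K * ‖x - y‖ * ‖w‖ := by
    have := ContinuousLinearMap.le_of_opNorm_le _ (hlip x hx') ((0 : 𝔼 n), w)
    have h6 : ‖((0 : 𝔼 n), w)‖ = ‖w‖ := by simp [Prod.norm_def]
    rw [h6] at this
    exact (le_abs_self _).trans this
  have hseg : segment ℝ y x ⊆ Metric.ball x₀ r := (convex_ball x₀ r).segment_subset hy hx'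
  have h4 : S.F (x, u) - S.F (y, u) - fderiv ℝ S.F (y, u) (x - y, 0) ≤ K * ‖x - y‖ * ‖x - y‖ := by
    have hd : ∀ x' ∈ segment ℝ y x, HasFDerivWithinAt (fun x' => S.F (x', u))
        ((fderiv ℝ S.F (x', u)).comp (ContinuousLinearMap.inl ℝ (𝔼 n) (𝔼 n))) (segment ℝ y x) x' := by
      intro x' hx''
      have h5 := (hb _ (hin x' (hseg hx''))).1.2
      exact (HasFDerivAt.comp (g := S.F) (f := fun e : 𝔼 n => (e, u)) x'
        ((contDiffAt_F h5.1 h5.2.1).differentiableAt (by simp)).hasFDerivAt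
        (hasFDerivAt_prodMk_left x' u)).hasFDerivWithinAt
    have h6 := (convex_segment y x).norm_image_sub_le_of_norm_hasFDerivWithin_le'
      (φ := (fderiv ℝ S.F (y, u)).comp (ContinuousLinearMap.inl ℝ (𝔼 n) (𝔼 n)))
      (C := K * ‖x - y‖) hd ?_ (left_mem_segment ℝ y x) (right_mem_segment ℝ y x)
    · exact (le_abs_self _).trans h6
    · intro x' hx''
      rw [← ContinuousLinearMap.sub_comp]
      refine (ContinuousLinearMap.opNorm_comp_le _ _).trans ?_
      have h7 : ‖x' - y‖ ≤ ‖x - y‖ := by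
        rw [segment_eq_image'] at hx''
        obtain ⟨s, hs, rfl⟩ := hx''
        rw [add_sub_cancel_left, norm_smul, Real.norm_of_nonneg hs.1]
        exact mul_le_of_le_one_left (norm_nonneg _) hs.2
      calc _ ≤ (K * ‖x' - y‖) * 1 := mul_le_mul (hlip x' (hseg hx''))
            (ContinuousLinearMap.norm_inl_le_one ℝ (𝔼 n) (𝔼 n)) (norm_nonneg _) (by positivity)
        _ ≤ K * ‖x - y‖ := by rw [mul_one]; gcongr
  have h5 : fderiv ℝ S.F (y, u) (x - y, w) =
      fderiv ℝ S.F (y, u) (x - y, 0) + fderiv ℝ S.F (y, u) (0, w) := by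
    rw [← map_add]; simp
  have h6 : K * ‖x - y‖ * ‖w‖ ≤ K ^ 2 / (2 * c) * ‖x - y‖ ^ 2 + c / 2 * ‖w‖ ^ 2 := by
    have : 0 ≤ (K * ‖x - y‖ - c * ‖w‖) ^ 2 / (2 * c) := by positivity
    have h7 : (K * ‖x - y‖ - c * ‖w‖) ^ 2 / (2 * c) = K ^ 2 / (2 * c) * ‖x - y‖ ^ 2 +
      c / 2 * ‖w‖ ^ 2 - K * ‖x - y‖ * ‖w‖ := by field_simp; ring
    linarith
  rw [h5]
  nlinarith [sq_nonneg ‖x - y‖]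

end LorentzFinslerDomain

/-! ### Rescaled second-order equations by contraction -/

namespace SecondOrderODE

variable {E : Type*} [NormedAddCommGroup E] [NormedSpace ℝ E]

/-- The acceleration along the curve with initial point `p` and velocity `ε • v`, up to scaling. -/
def accel (G : E × E → E) (ε : ℝ) (p : E) (v : ℝ → E) (s : ℝ) : E :=
  G (p + ε • ∫ r in (0 : ℝ)..s, v r, v s)

theorem continuous_primitive {v : ℝ → E} (hv : Continuous v) :
    Continuous fun s => ∫ r in (0 : ℝ)..s, v r :=
  intervalIntegral.continuous_primitive (fun _ _ => hv.intervalIntegrable _ _) 0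

theorem continuous_accel {G : E × E → E} (hG : Continuous G) (ε : ℝ) (p : E) {v : ℝ → E}
    (hv : Continuous v) : Continuous (accel G ε p v) := by
  have := continuous_primitive hv
  unfold accel
  fun_prop

/-- The integral operator whose fixed points are the solutions of the initial value problem
(`κ = 0`) or the boundary value problem (`κ = 1`). -/
def operator (G : E × E → E) (κ ε : ℝ) (z : E × E) (v : ℝ → E) (t : ℝ) : E :=
  z.2 + ε • ((∫ s in (0 : ℝ)..t, accel G ε z.1 v s) -
    κ • ∫ r in (0 : ℝ)..1, ∫ s in (0 : ℝ)..r, accel G ε z.1 v s)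

theorem continuous_operator {G : E × E → E} (hG : Continuous G) (κ ε : ℝ) (z : E × E) {v : ℝ → E}
    (hv : Continuous v) : Continuous (operator G κ ε z v) := by
  have := continuous_primitive (continuous_accel hG ε z.1 hv)
  unfold operator
  fun_prop

theorem norm_integral_le {f : ℝ → E} {C : ℝ} (hf : ∀ s ∈ Icc (0 : ℝ) 1, ‖f s‖ ≤ C)
    {t : ℝ} (ht : t ∈ Icc (0 : ℝ) 1) : ‖∫ s in (0 : ℝ)..t, f s‖ ≤ C := by
  have hC : 0 ≤ C := (norm_nonneg _).trans (hf 0 (by simp))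
  have h := intervalIntegral.norm_integral_le_of_norm_le_const (a := 0) (b := t) (f := f) (C := C)
    (fun s hs => hf s (by
      rw [uIoc_of_le ht.1] at hs
      exact ⟨hs.1.le, hs.2.trans ht.2⟩))
  refine h.trans ?_
  rw [sub_zero, abs_of_nonneg ht.1]
  exact mul_le_of_le_one_right hC ht.2

theorem norm_combination_le {κ : ℝ} (hκ : κ ∈ Icc (0 : ℝ) 1) {ε : ℝ} (hε : 0 ≤ ε) {f : ℝ → E}
    {C : ℝ} (hf : ∀ s ∈ Icc (0 : ℝ) 1, ‖f s‖ ≤ C) {t : ℝ} (ht : t ∈ Icc (0 : ℝ) 1) :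
    ‖ε • ((∫ s in (0 : ℝ)..t, f s) - κ • ∫ r in (0 : ℝ)..1, ∫ s in (0 : ℝ)..r, f s)‖
      ≤ 2 * ε * C := by
  have h1 := norm_integral_le hf ht
  have h2 := norm_integral_le (fun s hs => norm_integral_le hf hs) (right_mem_Icc.2 zero_le_one)
  have hC := (norm_nonneg _).trans h1
  rw [norm_smul, Real.norm_of_nonneg hε]
  have h3 : ‖κ • ∫ r in (0 : ℝ)..1, ∫ s in (0 : ℝ)..r, f s‖ ≤ C := by
    rw [norm_smul, Real.norm_of_nonneg hκ.1]
    exact (mul_le_of_le_one_left (norm_nonneg _) hκ.2).trans h2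
  have h4 := (norm_sub_le (∫ s in (0 : ℝ)..t, f s)
    (κ • ∫ r in (0 : ℝ)..1, ∫ s in (0 : ℝ)..r, f s)).trans (add_le_add h1 h3)
  nlinarith

/-- Only the acceleration terms depend on the curve, and they carry the factor `ε`. Hence the
operator contracts for small `ε`, while its dependence on the data `z` stays bounded. -/
theorem dist_operator_le {G : E × E → E} {K : NNReal} (hG : LipschitzWith K G) {κ ε : ℝ}
    (hκ : κ ∈ Icc (0 : ℝ) 1) (hε : ε ∈ Icc (0 : ℝ) 1) (z z' : E × E) {v w : ℝ → E}
    (hv : Continuous v) (hw : Continuous w) {d : ℝ} (hd : ∀ t ∈ Icc (0 : ℝ) 1, ‖v t - w t‖ ≤ d)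
    {t : ℝ} (ht : t ∈ Icc (0 : ℝ) 1) :
    ‖operator G κ ε z v t - operator G κ ε z' w t‖ ≤
      ‖z.2 - z'.2‖ + 2 * ε * (K * (‖z.1 - z'.1‖ + d)) := by
  have hd0 : 0 ≤ d := (norm_nonneg _).trans (hd 0 (by simp))
  have ha := continuous_accel hG.continuous ε z.1 hv
  have hb := continuous_accel hG.continuous ε z'.1 hw
  have h1 : ∀ s ∈ Icc (0 : ℝ) 1, ‖accel G ε z.1 v s - accel G ε z'.1 w s‖ ≤
      K * (‖z.1 - z'.1‖ + d) := by
    intro s hs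
    refine (hG.norm_sub_le _ _).trans ?_
    gcongr
    rw [Prod.norm_def]
    refine max_le ?_ ?_
    · have h2 : (z.1 + ε • ∫ r in (0 : ℝ)..s, v r) - (z'.1 + ε • ∫ r in (0 : ℝ)..s, w r) =
          (z.1 - z'.1) + ε • ∫ r in (0 : ℝ)..s, (v r - w r) := by
        rw [intervalIntegral.integral_sub (hv.intervalIntegrable _ _) (hw.intervalIntegrable _ _)]
        module
      change ‖(z.1 + ε • ∫ r in (0 : ℝ)..s, v r) - (z'.1 + ε • ∫ r in (0 : ℝ)..s, w r)‖ ≤ _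
      rw [h2]
      refine (norm_add_le _ _).trans (add_le_add le_rfl ?_)
      rw [norm_smul, Real.norm_of_nonneg hε.1]
      exact (mul_le_of_le_one_left (norm_nonneg _) hε.2).trans (norm_integral_le hd hs)
    · exact (hd s hs).trans (by linarith [norm_nonneg (z.1 - z'.1)])
  have h2 := norm_combination_le hκ hε.1 h1 ht
  have h3 : ∀ t, ∫ s in (0 : ℝ)..t, (accel G ε z.1 v s - accel G ε z'.1 w s) =
      (∫ s in (0 : ℝ)..t, accel G ε z.1 v s) - ∫ s in (0 : ℝ)..t, accel G ε z'.1 w s :=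
    fun t => intervalIntegral.integral_sub (ha.intervalIntegrable _ _) (hb.intervalIntegrable _ _)
  have h4 : operator G κ ε z v t - operator G κ ε z' w t = (z.2 - z'.2) +
      ε • ((∫ s in (0 : ℝ)..t, (accel G ε z.1 v s - accel G ε z'.1 w s)) -
        κ • ∫ r in (0 : ℝ)..1, ∫ s in (0 : ℝ)..r, (accel G ε z.1 v s - accel G ε z'.1 w s)) := by
    simp only [h3]
    rw [intervalIntegral.integral_sub ((continuous_primitive ha).intervalIntegrable _ _)
      ((continuous_primitive hb).intervalIntegrable _ _)]
    unfold operator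
    module
  rw [h4]
  exact (norm_add_le _ _).trans (add_le_add le_rfl h2)

/-- Existence, uniform smallness and Lipschitz dependence on the data of the solutions of the
rescaled initial and boundary value problems. -/
theorem exists_solution [CompleteSpace E] {G : E × E → E} {K : NNReal} (hG : LipschitzWith K G)
    {κ : ℝ} (hκ : κ ∈ Icc (0 : ℝ) 1) (z₀ : E × E) :
    ∃ C > 0, ∃ ε₀ > 0, ∀ ε ∈ Ioo 0 ε₀, ∃ V : E × E → ℝ → E,
      (∀ z, Continuous (V z)) ∧
      (∀ z, ∀ t ∈ Icc (0 : ℝ) 1, V z t = operator G κ ε z (V z) t) ∧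
      (∀ z z' t, ‖V z t - V z' t‖ ≤ 4 * ‖z - z'‖) ∧
      (∀ z ∈ Metric.ball z₀ 1, ∀ t, ‖V z t - z.2‖ ≤ C * ε) := by
  -- `B` bounds `G` along the line with constant velocity `z.2`. That initial guess is moved by at
  -- most `2εB`, so with contraction factor `1 / 2` the fixed point is within `4εB` of it.
  set B := ‖G z₀‖ + K * (‖z₀.2‖ + 2) with hB
  refine ⟨4 * B + 1, by positivity, min 1 (1 / (4 * (K + 1))), by positivity, fun ε hε => ?_⟩
  have hε1 : ε ∈ Icc (0 : ℝ) 1 := ⟨hε.1.le, hε.2.le.trans (min_le_left _ _)⟩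
  have hεK : 2 * ε * K ≤ 1 / 2 := by
    have h1 : ε < 1 / (4 * ((K : ℝ) + 1)) := hε.2.trans_le (min_le_right _ _)
    rw [lt_div_iff₀ (by positivity)] at h1
    nlinarith [hε.1]
  have h01 : (0 : ℝ) ≤ 1 := zero_le_one
  let T : E × E → C(Icc (0 : ℝ) 1, E) → C(Icc (0 : ℝ) 1, E) := fun z v =>
    ⟨fun t => operator G κ ε z (IccExtend h01 v) t,
      (continuous_operator hG.continuous κ ε z (v.continuous.Icc_extend' )).comp
        continuous_subtype_val⟩
  have hdist : ∀ z z' v w, dist (T z v) (T z' w) ≤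
      ‖z.2 - z'.2‖ + 2 * ε * (K * (‖z.1 - z'.1‖ + dist v w)) := by
    intro z z' v w
    rw [ContinuousMap.dist_le (by have := hε1.1; positivity)]
    intro t
    rw [dist_eq_norm]
    refine dist_operator_le hG hκ hε1 z z' (v.continuous.Icc_extend') (w.continuous.Icc_extend')
      (fun s hs => ?_) t.2
    rw [IccExtend_of_mem h01 _ hs, IccExtend_of_mem h01 _ hs, ← dist_eq_norm]
    exact ContinuousMap.dist_apply_le_dist _
  have hcontr : ∀ z, ContractingWith (1 / 2 : NNReal) (T z) := by
    intro z
    refine ⟨by norm_num, LipschitzWith.of_dist_le_mul fun v w => ?_⟩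
    have := hdist z z v w
    simp only [sub_self, norm_zero, zero_add] at this
    refine this.trans ?_
    rw [← mul_assoc]
    push_cast
    gcongr
  let fp : E × E → C(Icc (0 : ℝ) 1, E) := fun z => ContractingWith.fixedPoint (T z) (hcontr z)
  have hfix : ∀ z, Function.IsFixedPt (T z) (fp z) := fun z => (hcontr z).fixedPoint_isFixedPt
  refine ⟨fun z => IccExtend h01 (fp z), fun z =>
    (fp z).continuous.Icc_extend', fun z t ht => ?_, fun z z' t => ?_,
    fun z hz t => ?_⟩
  · refine (IccExtend_of_mem h01 _ ht).trans ?_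
    exact (DFunLike.congr_fun (hfix z) ⟨t, ht⟩).symm
  · have h1 := (hcontr z).dist_fixedPoint_fixedPoint_of_dist_le' (T z') (hfix z) (hfix z')
      (C := 2 * ‖z - z'‖) (fun v => by
        refine (hdist z z' v v).trans ?_
        rw [dist_self, add_zero, ← mul_assoc]
        have h2 : ‖z.2 - z'.2‖ ≤ ‖z - z'‖ := norm_snd_le (z - z')
        have h3 : ‖z.1 - z'.1‖ ≤ ‖z - z'‖ := norm_fst_le (z - z')
        have h4 : 2 * ε * K * ‖z.1 - z'.1‖ ≤ 1 / 2 * ‖z.1 - z'.1‖ := by gcongr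
        linarith [norm_nonneg (z - z')])
    have h2 := (ContinuousMap.dist_apply_le_dist (f := fp z)
      (g := fp z') (projIcc 0 1 h01 t)).trans h1
    rw [dist_eq_norm] at h2
    refine h2.trans (le_of_eq ?_)
    push_cast
    ring
  · set c : C(Icc (0 : ℝ) 1, E) := ContinuousMap.const _ z.2 with hc
    have hz1 : ‖z.1 - z₀.1‖ < 1 := by
      rw [← dist_eq_norm]; exact (le_max_left _ _).trans_lt hz
    have hz2 : ‖z.2 - z₀.2‖ < 1 := by
      rw [← dist_eq_norm]; exact (le_max_right _ _).trans_lt hz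
    have hz2' : ‖z.2‖ ≤ ‖z₀.2‖ + 1 := by
      have := norm_le_norm_add_norm_sub' z.2 z₀.2
      linarith
    have h1 : dist c (T z c) ≤ 2 * ε * B := by
      rw [ContinuousMap.dist_le (by have := hε1.1; positivity)]
      intro t
      rw [dist_comm, dist_eq_norm]
      have h2 : T z c t - c t = ε • ((∫ s in (0 : ℝ)..t, accel G ε z.1 (IccExtend h01 c) s) -
          κ • ∫ r in (0 : ℝ)..1, ∫ s in (0 : ℝ)..r, accel G ε z.1 (IccExtend h01 c) s) := by
        change operator G κ ε z (IccExtend h01 c) t - z.2 = _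
        unfold operator
        abel
      rw [h2]
      refine norm_combination_le hκ hε1.1 (fun s hs => ?_) t.2
      have hce : IccExtend h01 c = fun _ => z.2 := by
        funext s; rfl
      have h3 : accel G ε z.1 (IccExtend h01 c) s = G (z.1 + (ε * s) • z.2, z.2) := by
        unfold accel
        rw [hce]
        simp [smul_smul]
      rw [h3]
      have h4 := hG.norm_sub_le (z.1 + (ε * s) • z.2, z.2) z₀
      have h5 : ‖(z.1 + (ε * s) • z.2, z.2) - z₀‖ ≤ ‖z₀.2‖ + 2 := by
        rw [Prod.norm_def]
        refine max_le ?_ ?_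
        · change ‖z.1 + (ε * s) • z.2 - z₀.1‖ ≤ _
          have h6 : z.1 + (ε * s) • z.2 - z₀.1 = (z.1 - z₀.1) + (ε * s) • z.2 := by abel
          rw [h6]
          refine (norm_add_le _ _).trans ?_
          have h7 : ‖(ε * s) • z.2‖ ≤ ‖z.2‖ := by
            rw [norm_smul, Real.norm_of_nonneg (mul_nonneg hε1.1 hs.1)]
            exact mul_le_of_le_one_left (norm_nonneg _) (mul_le_one₀ hε1.2 hs.1 hs.2)
          linarith
        · change ‖z.2 - z₀.2‖ ≤ _
          linarith [norm_nonneg z₀.2]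
      have h6 := norm_le_norm_add_norm_sub' (G (z.1 + (ε * s) • z.2, z.2)) (G z₀)
      have h7 : (K : ℝ) * ‖(z.1 + (ε * s) • z.2, z.2) - z₀‖ ≤ K * (‖z₀.2‖ + 2) := by gcongr
      linarith
    have h2 := ((hcontr z).dist_fixedPoint_le c)
    have h3 := (ContinuousMap.dist_apply_le_dist (f := c)
      (g := fp z) (projIcc 0 1 h01 t)).trans h2
    rw [dist_comm, dist_eq_norm] at h3
    refine h3.trans ?_
    push_cast
    rw [div_le_iff₀ (by norm_num)]
    have := hε.1
    nlinarith

end SecondOrderODE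

/-! ### The geodesic spray and short geodesics -/

namespace LorentzFinslerDomain

variable {n : ℕ} (S : LorentzFinslerDomain n)

/-- The fundamental tensor at `z = (x, v)`. -/
def metric (z : 𝔼 n × 𝔼 n) : 𝔼 n →L[ℝ] 𝔼 n →L[ℝ] ℝ :=
  ((ContinuousLinearMap.compL ℝ (𝔼 n) (𝔼 n × 𝔼 n) ℝ).flip
    (ContinuousLinearMap.inr ℝ (𝔼 n) (𝔼 n))).comp
    ((fderiv ℝ (fderiv ℝ S.L) z).comp (ContinuousLinearMap.inr ℝ (𝔼 n) (𝔼 n)))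

/-- The right-hand side of the Euler–Lagrange equation of `L`. -/
def force (z : 𝔼 n × 𝔼 n) : 𝔼 n →L[ℝ] ℝ :=
  (fderiv ℝ S.L z).comp (ContinuousLinearMap.inl ℝ (𝔼 n) (𝔼 n)) -
    (fderiv ℝ (fderiv ℝ S.L) z (z.2, 0)).comp (ContinuousLinearMap.inr ℝ (𝔼 n) (𝔼 n))

/-- The geodesic spray. -/
def spray (z : 𝔼 n × 𝔼 n) : 𝔼 n := (S.metric z).inverse (S.force z)

variable {S}

theorem contDiffAt_hessian {x v : 𝔼 n} (hx : x ∈ S.U) (hv : v ≠ 0) :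
    ContDiffAt ℝ ∞ (fderiv ℝ (fderiv ℝ S.L)) (x, v) :=
  (contDiffAt_fderiv_L hx hv).fderiv_right (by simp)

theorem metric_apply {x v : 𝔼 n} (hx : x ∈ S.U) (hv : v ≠ 0) (w w' : 𝔼 n) :
    S.metric (x, v) w w' = fderiv ℝ (fderiv ℝ fun u => S.L (x, u)) v w w' := by
  have h1 : fderiv ℝ (fun u => S.L (x, u)) =ᶠ[𝓝 v] fun u =>
      (fderiv ℝ S.L (x, u)).comp (ContinuousLinearMap.inr ℝ (𝔼 n) (𝔼 n)) := by
    filter_upwards [isOpen_ne.mem_nhds hv] with u hu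
    ext w
    exact fderiv_fiber hx hu w
  have h2 : HasFDerivAt (fun u => fderiv ℝ S.L (x, u))
      ((fderiv ℝ (fderiv ℝ S.L) (x, v)).comp (ContinuousLinearMap.inr ℝ (𝔼 n) (𝔼 n))) v :=
    HasFDerivAt.comp (f := fun u : 𝔼 n => (x, u)) v
      ((contDiffAt_fderiv_L hx hv).differentiableAt (by simp)).hasFDerivAt
      (hasFDerivAt_prodMk_right x v)
  have h3 := h2.clm_comp (hasFDerivAt_const (ContinuousLinearMap.inr ℝ (𝔼 n) (𝔼 n)) v)
  rw [h1.fderiv_eq, h3.fderiv]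
  simp [metric]

/-- Nondegeneracy of the signature gives injectivity, and the dual space has the same finite
dimension. -/
theorem isInvertible_metric {x v : 𝔼 n} (hx : x ∈ S.U) (hv : v ≠ 0) :
    (S.metric (x, v)).IsInvertible := by
  have hinj : Function.Injective (S.metric (x, v)).toLinearMap := by
    rw [← LinearMap.ker_eq_bot, LinearMap.ker_eq_bot']
    intro q hq
    refine (S.signature x hx v hv).eq_zero_of_forall fun w => ?_
    rw [← metric_apply hx hv]
    exact congrArg (fun T : 𝔼 n →L[ℝ] ℝ => T w) hq
  have hdim : Module.finrank ℝ (𝔼 n) = Module.finrank ℝ (𝔼 n →L[ℝ] ℝ) := by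
    rw [← (LinearMap.toContinuousLinearMap (𝕜 := ℝ) (E := 𝔼 n) (F' := ℝ)).finrank_eq]
    exact (Subspace.dual_finrank_eq (K := ℝ) (V := 𝔼 n)).symm
  refine ⟨(LinearMap.linearEquivOfInjective _ hinj hdim).toContinuousLinearEquiv, ?_⟩
  ext w w'
  rfl

theorem metric_spray {x v : 𝔼 n} (hx : x ∈ S.U) (hv : v ≠ 0) :
    S.metric (x, v) (S.spray (x, v)) = S.force (x, v) := by
  obtain ⟨e, he⟩ := isInvertible_metric hx hv
  rw [spray, ← he, ContinuousLinearMap.inverse_equiv]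
  exact e.apply_symm_apply _

theorem contDiffAt_spray {x v : 𝔼 n} (hx : x ∈ S.U) (hv : v ≠ 0) :
    ContDiffAt ℝ ∞ S.spray (x, v) := by
  have hH := contDiffAt_hessian hx hv
  have hD := contDiffAt_fderiv_L hx hv
  have h1 : ContDiffAt ℝ ∞ S.metric (x, v) :=
    contDiffAt_const.clm_comp (hH.clm_comp contDiffAt_const)
  have h2 : ContDiffAt ℝ ∞ S.force (x, v) := by
    refine (hD.clm_comp contDiffAt_const).sub
      (ContDiffAt.clm_comp (hH.clm_apply ?_) contDiffAt_const)
    exact contDiffAt_snd.prodMk contDiffAt_const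
  exact ((isInvertible_metric hx hv).contDiffAt_map_inverse.comp (x, v) h1).clm_apply h2

/-- The curve with initial point `p` and velocity `ε • v`. -/
def curve (ε : ℝ) (p : 𝔼 n) (v : ℝ → 𝔼 n) (t : ℝ) : 𝔼 n := p + ε • ∫ s in (0 : ℝ)..t, v s

theorem hasDerivAt_curve (ε : ℝ) (p : 𝔼 n) {v : ℝ → 𝔼 n} (hv : Continuous v) (t : ℝ) :
    HasDerivAt (curve ε p v) (ε • v t) t :=
  ((hv.integral_hasStrictDerivAt 0 t).hasDerivAt.const_smul ε).const_add p

theorem curve_zero (ε : ℝ) (p : 𝔼 n) (v : ℝ → 𝔼 n) : curve ε p v 0 = p := by simp [curve]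

variable (S)

/-- The curve with initial point `p` and velocity `ε • v` is a timelike geodesic on `[0,1]`: its
velocity has constant length, and it satisfies the Euler–Lagrange equation of `F`. -/
structure IsGeodesic (ε : ℝ) (p : 𝔼 n) (v : ℝ → 𝔼 n) : Prop where
  continuous : Continuous v
  mem_U : ∀ t ∈ Icc (0 : ℝ) 1, curve ε p v t ∈ S.U
  timelike : ∀ t ∈ Icc (0 : ℝ) 1, S.L (curve ε p v t, v t) < 0
  mem_cone : ∀ t ∈ Icc (0 : ℝ) 1, v t ∈ S.cone (curve ε p v t)
  F_eq : ∀ t ∈ Icc (0 : ℝ) 1, S.F (curve ε p v t, v t) = S.F (p, v 0)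
  hasDerivAt_momentum : ∀ t ∈ Ioo (0 : ℝ) 1,
    HasDerivAt (fun t => (fderiv ℝ S.F (curve ε p v t, v t)).comp
      (ContinuousLinearMap.inr ℝ (𝔼 n) (𝔼 n)))
      (ε • (fderiv ℝ S.F (curve ε p v t, v t)).comp
        (ContinuousLinearMap.inl ℝ (𝔼 n) (𝔼 n))) t

variable {S}

/-- The spray equation is the Euler–Lagrange equation of `L`. Differentiating `2L = ∂_v L(v)` along
the curve then shows that `2L` and `L` have the same derivative, so `L` is constant. With `F`
constant, `dF = -dL / F` turns the equation into that of `F`. -/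
theorem isGeodesic_of_spray {ε : ℝ} {p : 𝔼 n} {v : ℝ → 𝔼 n} (hv : Continuous v)
    (hU : ∀ t ∈ Icc (0 : ℝ) 1, curve ε p v t ∈ S.U)
    (hL : ∀ t ∈ Icc (0 : ℝ) 1, S.L (curve ε p v t, v t) < 0)
    (hc : ∀ t ∈ Icc (0 : ℝ) 1, v t ∈ S.cone (curve ε p v t))
    (hd : ∀ t ∈ Ioo (0 : ℝ) 1, HasDerivAt v (ε • S.spray (curve ε p v t, v t)) t) :
    S.IsGeodesic ε p v := by
  set γ := curve ε p v with hγ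
  have hγd := hasDerivAt_curve ε p hv
  have hγc : Continuous γ := continuous_iff_continuousAt.2 fun t => (hγd t).continuousAt
  have hne : ∀ t ∈ Icc (0 : ℝ) 1, v t ≠ 0 := fun t ht => ne_zero_of_mem_cone (hc t ht)
  have hmom : ∀ t ∈ Ioo (0 : ℝ) 1, HasDerivAt (fun t => (fderiv ℝ S.L (γ t, v t)).comp
      (ContinuousLinearMap.inr ℝ (𝔼 n) (𝔼 n)))
      (ε • (fderiv ℝ S.L (γ t, v t)).comp (ContinuousLinearMap.inl ℝ (𝔼 n) (𝔼 n))) t := by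
    intro t ht
    have ht' := Ioo_subset_Icc_self ht
    have h1 : HasDerivAt (fun t => fderiv ℝ S.L (γ t, v t))
        (fderiv ℝ (fderiv ℝ S.L) (γ t, v t) (ε • v t, ε • S.spray (γ t, v t))) t :=
      HasFDerivAt.comp_hasDerivAt (f := fun t : ℝ => (γ t, v t)) t
        ((contDiffAt_fderiv_L (hU t ht') (hne t ht')).differentiableAt (by simp)).hasFDerivAt
        ((hγd t).prodMk (hd t ht))
    have h2 := h1.clm_comp (hasDerivAt_const t (ContinuousLinearMap.inr ℝ (𝔼 n) (𝔼 n)))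
    refine h2.congr_deriv ?_
    have h3 := metric_spray (hU t ht') (hne t ht')
    ext w
    have h4 := congrArg (fun T : 𝔼 n →L[ℝ] ℝ => T w) h3
    have h5 : (ε • v t, ε • S.spray (γ t, v t)) =
        ε • (((v t, 0) : 𝔼 n × 𝔼 n) + (0, S.spray (γ t, v t))) := by ext <;> simp
    rw [h5]
    simp only [metric, force, ContinuousLinearMap.comp_apply, ContinuousLinearMap.flip_apply,
      ContinuousLinearMap.compL_apply, sub_apply] at h4
    simp only [ContinuousLinearMap.inr_apply, ContinuousLinearMap.inl_apply] at h4
    simp only [ContinuousLinearMap.comp_apply, map_smul, map_add, smul_apply, add_apply,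
      ContinuousLinearMap.inr_apply, ContinuousLinearMap.inl_apply, smul_eq_mul,
      ContinuousLinearMap.comp_zero, add_zero]
    rw [h4]
    ring
  have hLd : ∀ t ∈ Ioo (0 : ℝ) 1, HasDerivAt (fun t => S.L (γ t, v t)) 0 t := by
    intro t ht
    have ht' := Ioo_subset_Icc_self ht
    have h1 : HasDerivAt (fun t => S.L (γ t, v t))
        (fderiv ℝ S.L (γ t, v t) (ε • v t, ε • S.spray (γ t, v t))) t :=
      HasFDerivAt.comp_hasDerivAt (f := fun t : ℝ => (γ t, v t)) t
        (differentiableAt_L (hU t ht') (hne t ht')).hasFDerivAt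
        ((hγd t).prodMk (hd t ht))
    have h2 : HasDerivAt (fun t => 2 * S.L (γ t, v t))
        (fderiv ℝ S.L (γ t, v t) (ε • v t, ε • S.spray (γ t, v t))) t := by
      have h3 := (hmom t ht).clm_apply (hd t ht)
      refine (h3.congr_deriv ?_).congr_of_eventuallyEq ?_
      · have h5 : (ε • v t, ε • S.spray (γ t, v t)) =
          ε • (((v t, 0) : 𝔼 n × 𝔼 n)) + (0, ε • S.spray (γ t, v t)) := by ext <;> simp
        have h6 : fderiv ℝ S.L (γ t, v t) (ε • v t, ε • S.spray (γ t, v t)) =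
            ε • fderiv ℝ S.L (γ t, v t) (v t, 0) +
              fderiv ℝ S.L (γ t, v t) (0, ε • S.spray (γ t, v t)) := by
          rw [h5, map_add, map_smul]
        rw [h6]
        rfl
      · filter_upwards [Ioo_mem_nhds ht.1 ht.2] with s hs
        have hs' := Ioo_subset_Icc_self hs
        exact (fderiv_L_self (hU s hs') (hne s hs')).symm
    have h3 := (h1.const_mul 2).unique h2
    have h4 : fderiv ℝ S.L (γ t, v t) (ε • v t, ε • S.spray (γ t, v t)) = 0 := by linarith
    rwa [h4] at h1
  have hLc : ContinuousOn (fun t => S.L (γ t, v t)) (Icc 0 1) := fun t ht =>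
    (ContinuousAt.comp (f := fun t : ℝ => (γ t, v t)) (g := S.L)
      (differentiableAt_L (hU t ht) (hne t ht)).continuousAt
      (by fun_prop)).continuousWithinAt
  have hLeq : ∀ t ∈ Icc (0 : ℝ) 1, S.L (γ t, v t) = S.L (γ 0, v 0) := by
    intro t ht
    rcases ht.1.eq_or_lt with rfl | h0
    · rfl
    obtain ⟨c, hc, h⟩ := exists_hasDerivAt_eq_slope (fun t => S.L (γ t, v t)) (fun _ => 0) h0
      (hLc.mono (Icc_subset_Icc_right ht.2))
      (fun s hs => hLd s ⟨hs.1, hs.2.trans_le ht.2⟩)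
    rw [eq_comm, div_eq_zero_iff] at h
    rcases h with h | h <;> linarith
  have hFeq : ∀ t ∈ Icc (0 : ℝ) 1, S.F (γ t, v t) = S.F (p, v 0) := by
    intro t ht
    rw [F, F, hLeq t ht, hγ, curve_zero]
  refine ⟨hv, hU, hL, hc, hFeq, fun t ht => ?_⟩
  have ht' := Ioo_subset_Icc_self ht
  have h1 := (hmom t ht).const_smul (-(S.F (p, v 0))⁻¹)
  refine (h1.congr_deriv ?_).congr_of_eventuallyEq ?_
  · rw [fderiv_F (hU t ht') (hL t ht'), hFeq t ht']
    ext w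
    simp
    ring
  · filter_upwards [Ioo_mem_nhds ht.1 ht.2] with s hs
    have hs' := Ioo_subset_Icc_self hs
    rw [fderiv_F (hU s hs') (hL s hs'), hFeq s hs']
    rfl

/-- Existence of short geodesics with prescribed initial point and initial velocity (`κ = 0`) or
displacement (`κ = 1`). -/
theorem exists_isGeodesic {x₀ u₀ : 𝔼 n} (hx : x₀ ∈ S.U) (hu : S.L (x₀, u₀) < 0)
    (huc : u₀ ∈ S.cone x₀) {κ : ℝ} (hκ : κ ∈ Icc (0 : ℝ) 1) {r : ℝ} (hr : 0 < r) :
    ∃ C > 0, ∃ δ > 0, ∃ ε₀ > 0, ∀ ε ∈ Ioo 0 ε₀, ∃ V : 𝔼 n × 𝔼 n → ℝ → 𝔼 n,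
      (∀ z z' t, ‖V z t - V z' t‖ ≤ 4 * ‖z - z'‖) ∧
      ∀ z ∈ Metric.ball (x₀, u₀) δ, S.IsGeodesic ε z.1 (V z) ∧
        (∀ t, ‖V z t - z.2‖ ≤ C * ε) ∧
        (∀ t, V z t ∈ Metric.ball u₀ r) ∧
        (∀ t ∈ Icc (0 : ℝ) 1, curve ε z.1 (V z) t ∈ Metric.ball x₀ r) ∧
        (κ = 0 → V z 0 = z.2) ∧ (κ = 1 → ∫ t in (0 : ℝ)..1, V z t = z.2) := by
  have hu0 : u₀ ≠ 0 := ne_zero_of_mem_cone huc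
  -- The spray is controlled only near `(x₀, u₀)`, whereas the contraction needs a globally
  -- Lipschitz field. It is replaced by a Lipschitz extension `G`; for small `ε` the solutions never
  -- leave the set where both agree.
  obtain ⟨K, t, ht, hK⟩ := ((contDiffAt_spray hx hu0).of_le (m := 1) (by simp)).exists_lipschitzOnWith
  obtain ⟨G, hG, hGeq⟩ := hK.extend_finite_dimension
  obtain ⟨r', hr', hb⟩ := Metric.eventually_nhds_iff_ball.1
    ((eventually_mem_cone hx hu huc).and ht)
  obtain ⟨C, hC, ε₁, hε₁, h⟩ := SecondOrderODE.exists_solution hG hκ (x₀, u₀)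
  set ρ := min (min r r') 1 with hρ
  have hρ0 : 0 < ρ := by positivity
  have hρr : ρ ≤ r := (min_le_left _ _).trans (min_le_left _ _)
  have hρr' : ρ ≤ r' := (min_le_left _ _).trans (min_le_right _ _)
  have hρ1 : ρ ≤ 1 := min_le_right _ _
  refine ⟨C, hC, ρ / 2, by positivity, min ε₁ (min (ρ / 2 / C) (ρ / 2 / (‖u₀‖ + 1))),
    by positivity, fun ε hε => ?_⟩
  have hε1 : ε < ε₁ := hε.2.trans_le (min_le_left _ _)
  have hεC : C * ε < ρ / 2 := by
    have h1 : ε < ρ / 2 / C := hε.2.trans_le ((min_le_right _ _).trans (min_le_left _ _))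
    rw [lt_div_iff₀ hC] at h1
    linarith
  have hεu : ε * (‖u₀‖ + 1) < ρ / 2 := by
    have h1 : ε < ρ / 2 / (‖u₀‖ + 1) := hε.2.trans_le ((min_le_right _ _).trans (min_le_right _ _))
    rwa [lt_div_iff₀ (by positivity)] at h1
  obtain ⟨V, hV1, hV2, hV3, hV4⟩ := h ε ⟨hε.1, hε1⟩
  refine ⟨V, hV3, fun z hz => ?_⟩
  have hz1 : dist z.1 x₀ < ρ / 2 := (le_max_left _ _).trans_lt hz
  have hz2 : dist z.2 u₀ < ρ / 2 := (le_max_right _ _).trans_lt hz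
  have hclose : ∀ t, ‖V z t - z.2‖ ≤ C * ε :=
    hV4 z (Metric.ball_subset_ball (by linarith) hz)
  have hVball : ∀ t, dist (V z t) u₀ < ρ := by
    intro t
    have h1 := dist_triangle (V z t) z.2 u₀
    have h2 := hclose t
    rw [← dist_eq_norm] at h2
    linarith
  have hcball : ∀ t ∈ Icc (0 : ℝ) 1, dist (curve ε z.1 (V z) t) x₀ < ρ := by
    intro t ht
    have h1 := dist_triangle (curve ε z.1 (V z) t) z.1 x₀
    have h2 : dist (curve ε z.1 (V z) t) z.1 ≤ ε * (‖u₀‖ + 1) := by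
      rw [dist_eq_norm, curve, add_sub_cancel_left, norm_smul, Real.norm_of_nonneg hε.1.le]
      refine mul_le_mul_of_nonneg_left ?_ hε.1.le
      refine SecondOrderODE.norm_integral_le (fun s _ => ?_) ht
      have h3 := norm_le_norm_add_norm_sub' (V z s) u₀
      rw [← dist_eq_norm] at h3
      linarith [hVball s]
    linarith
  have hin : ∀ t ∈ Icc (0 : ℝ) 1, (curve ε z.1 (V z) t, V z t) ∈ Metric.ball (x₀, u₀) r' :=
    fun t ht => Metric.mem_ball.2 ((max_lt (hcball t ht) (hVball t)).trans_le hρr')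
  refine ⟨isGeodesic_of_spray (hV1 z) (fun t ht => (hb _ (hin t ht)).1.1)
    (fun t ht => (hb _ (hin t ht)).1.2.1) (fun t ht => (hb _ (hin t ht)).1.2.2) ?_, hclose,
    fun t => (hVball t).trans_le hρr, fun t ht => (hcball t ht).trans_le hρr, ?_, ?_⟩
  · intro t ht
    have ht' := Ioo_subset_Icc_self ht
    have h1 : HasDerivAt (SecondOrderODE.operator G κ ε z (V z))
        (ε • SecondOrderODE.accel G ε z.1 (V z) t) t := by
      have h2 := ((SecondOrderODE.continuous_accel hG.continuous ε z.1
        (hV1 z)).integral_hasStrictDerivAt 0 t).hasDerivAt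
      exact ((h2.sub_const _).const_smul ε).const_add z.2
    have h3 : SecondOrderODE.accel G ε z.1 (V z) t = S.spray (curve ε z.1 (V z) t, V z t) :=
      (hGeq (hb _ (hin t ht')).2).symm
    rw [h3] at h1
    refine h1.congr_of_eventuallyEq ?_
    filter_upwards [Ioo_mem_nhds ht.1 ht.2] with s hs
    exact hV2 z s (Ioo_subset_Icc_self hs)
  · rintro rfl
    rw [hV2 z 0 (by simp)]
    simp [SecondOrderODE.operator]
  -- The double integral subtracted in the operator for `κ = 1` is the mean of the other correction,
  -- so the mean velocity is exactly `z.2`.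
  · rintro rfl
    have h1 : ∫ t in (0 : ℝ)..1, V z t =
        ∫ t in (0 : ℝ)..1, SecondOrderODE.operator G 1 ε z (V z) t :=
      intervalIntegral.integral_congr fun t ht => hV2 z t (by rwa [uIcc_of_le zero_le_one] at ht)
    have h2 := SecondOrderODE.continuous_primitive
      (SecondOrderODE.continuous_accel hG.continuous ε z.1 (hV1 z))
    rw [h1]
    unfold SecondOrderODE.operator
    rw [intervalIntegral.integral_add (by simp) (Continuous.intervalIntegrable (by fun_prop) _ _),
      intervalIntegral.integral_smul,
      intervalIntegral.integral_sub (h2.intervalIntegrable _ _) (by simp)]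
    simp

end LorentzFinslerDomain

/-! ### Maximality of short geodesics -/

/-- A continuously differentiable real function with derivative bounded below by a positive constant
has a differentiable inverse. -/
theorem exists_inverse_of_deriv_ge {θ θ' : ℝ → ℝ} {m : ℝ} (hm : 0 < m)
    (hθ : ∀ t, HasDerivAt θ (θ' t) t) (hle : ∀ t, m ≤ θ' t) :
    ∃ ψ : ℝ → ℝ, StrictMono ψ ∧ (∀ t, ψ (θ t) = t) ∧ (∀ y, θ (ψ y) = y) ∧
      ∀ y, HasDerivAt ψ (θ' (ψ y))⁻¹ y := by
  have hcont : Continuous θ := continuous_iff_continuousAt.2 fun t => (hθ t).continuousAt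
  have hmono : StrictMono θ := strictMono_of_deriv_pos fun t => by
    rw [(hθ t).deriv]; linarith [hle t]
  have hmono' : Monotone fun t => θ t - m * t := by
    refine monotone_of_deriv_nonneg
      (fun t => ((hθ t).sub ((hasDerivAt_id t).const_mul m)).differentiableAt) fun t => ?_
    have := ((hθ t).sub ((hasDerivAt_id t).const_mul m)).deriv
    have h2 : deriv (fun t => θ t - m * t) t = θ' t - m * 1 := this
    rw [h2]
    linarith [hle t]
  have htop : Tendsto θ atTop atTop := by
    refine tendsto_atTop_mono' atTop (f₁ := fun t => θ 0 + m * t) ?_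
      (tendsto_atTop_add_const_left _ _ (tendsto_id.const_mul_atTop hm))
    filter_upwards [eventually_ge_atTop (0 : ℝ)] with t ht
    have := hmono' ht
    simp only [mul_zero, sub_zero] at this
    linarith
  have hbot : Tendsto θ atBot atBot := by
    refine tendsto_atBot_mono' atBot (f₁ := fun t => θ 0 + m * t) ?_
      (tendsto_atBot_add_const_left _ _ (tendsto_id.const_mul_atBot hm))
    filter_upwards [eventually_le_atBot (0 : ℝ)] with t ht
    have := hmono' ht
    simp only [mul_zero, sub_zero] at this
    linarith
  let e := hmono.orderIsoOfSurjective θ (hcont.surjective htop hbot)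
  have hr : ∀ y, θ (e.symm y) = y := fun y => e.apply_symm_apply y
  refine ⟨e.symm, e.symm.strictMono, fun t => e.symm_apply_apply t, hr, fun y => ?_⟩
  exact HasDerivAt.of_local_left_inverse e.symm.continuous.continuousAt (hθ _)
    (ne_of_gt (hm.trans_le (hle _))) (Eventually.of_forall hr)

namespace LorentzFinslerDomain

variable {n : ℕ} {S : LorentzFinslerDomain n}

set_option maxHeartbeats 1000000 in
/-- Short geodesics maximize length among the causal curves in a fixed neighborhood. -/
theorem IsGeodesic.exists_integral_le {x₀ u₀ : 𝔼 n} (hx : x₀ ∈ S.U) (hu : S.L (x₀, u₀) < 0)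
    (huc : u₀ ∈ S.cone x₀) :
    ∃ r > 0, ∃ ε₀ > 0, ∀ ε ∈ Ioo 0 ε₀, ∀ (p : 𝔼 n) (v : ℝ → 𝔼 n), S.IsGeodesic ε p v →
      (∀ t, v t ∈ Metric.ball u₀ r) →
      (∀ t ∈ Icc (0 : ℝ) 1, curve ε p v t ∈ Metric.ball x₀ r) →
      ∀ a ∈ Icc (0 : ℝ) 1, ∀ b ∈ Icc (0 : ℝ) 1, ∀ η : ℝ → 𝔼 n, ContDiffOn ℝ 1 η (Icc 0 1) →
      (∀ s ∈ Icc (0 : ℝ) 1, η s ∈ Metric.ball x₀ r ∧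
        derivWithin η (Icc 0 1) s ∈ S.cone (η s)) →
      η 0 = curve ε p v a → η 1 = curve ε p v b →
      ∫ s in (0 : ℝ)..1, S.F (η s, derivWithin η (Icc 0 1) s) ≤ ε * (b - a) * S.F (p, v 0) := by
  obtain ⟨c, hc, C, hC, r₁, hr₁, hexp⟩ := exists_F_le_expansion hx hu huc
  obtain ⟨κ, hκ, hnorm⟩ := exists_norm_le hx hu huc
  obtain ⟨r₂, hr₂, hb₂⟩ := Metric.eventually_nhds_iff_ball.1
    (hnorm.and (S.isOpen_U.mem_nhds hx))
  -- The linear function `τ` is a local time function: it increases along all causal curves near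
  -- `x₀`, hence along both `γ` and the competitor `η`.
  set τ : 𝔼 n →L[ℝ] ℝ :=
    -((fderiv ℝ S.L (x₀, u₀)).comp (ContinuousLinearMap.inr ℝ (𝔼 n) (𝔼 n))) with hτ
  have hτ' : ∀ w, τ w = -(fderiv ℝ S.L (x₀, u₀) (0, w)) := fun w => rfl
  have hu0 : u₀ ≠ 0 := ne_zero_of_mem_cone huc
  have hτu : 0 < τ u₀ := by
    rw [hτ', fderiv_L_self hx hu0]; linarith
  obtain ⟨r₃, hr₃, hb₃⟩ := Metric.eventually_nhds_iff_ball.1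
    (τ.continuous.continuousAt.eventually (lt_mem_nhds (half_lt_self hτu)))
  set B := C + 1 with hB
  have hB0 : 0 < B := by positivity
  -- The bound on `ε` gives `(εB)² ≤ c`, needed to absorb the mixed term in the derivative of `Φ`
  -- below.
  refine ⟨min r₁ (min r₂ r₃), by positivity, min 1 (c / B ^ 2), by positivity, ?_⟩
  intro ε hε p v hgeo hvb hγb a ha b hb η hη hηc hη0 hη1
  have hr1 : min r₁ (min r₂ r₃) ≤ r₁ := min_le_left _ _
  have hr2 : min r₁ (min r₂ r₃) ≤ r₂ := (min_le_right _ _).trans (min_le_left _ _)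
  have hr3 : min r₁ (min r₂ r₃) ≤ r₃ := (min_le_right _ _).trans (min_le_right _ _)
  have hε0 := hε.1
  have hεB : (ε * B) ^ 2 ≤ c := by
    have h1 : ε < 1 := hε.2.trans_le (min_le_left _ _)
    have h2 : ε < c / B ^ 2 := hε.2.trans_le (min_le_right _ _)
    rw [lt_div_iff₀ (by positivity)] at h2
    nlinarith [mul_pos hε0 (pow_pos hB0 2)]
  set m := S.F (p, v 0) with hm
  set γ := curve ε p v with hγ
  have hγd := hasDerivAt_curve ε p hgeo.continuous
  have hγc : Continuous γ := continuous_iff_continuousAt.2 fun t => (hγd t).continuousAt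
  have hτv : ∀ t, τ u₀ / 2 ≤ τ (v t) := fun t =>
    (hb₃ _ (Metric.ball_subset_ball hr3 (hvb t))).le
  obtain ⟨ψ, hψmono, hψθ, hθψ, hψd⟩ := exists_inverse_of_deriv_ge (θ := fun t => τ (γ t))
    (θ' := fun t => τ (ε • v t)) (m := ε * (τ u₀ / 2)) (by positivity)
    (fun t => τ.hasFDerivAt.comp_hasDerivAt t (hγd t)) (fun t => by
      rw [map_smul, smul_eq_mul]
      exact mul_le_mul_of_nonneg_left (hτv t) hε0.le)
  set η' := derivWithin η (Icc 0 1) with hη'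
  have hηd : ∀ s ∈ Ioo (0 : ℝ) 1, HasDerivAt η (η' s) s := fun s hs =>
    ((hη.differentiableOn (by simp) s (Ioo_subset_Icc_self hs)).hasDerivWithinAt).hasDerivAt
      (Icc_mem_nhds hs.1 hs.2)
  have hτη : ∀ s ∈ Icc (0 : ℝ) 1, 0 < τ (η' s) := by
    intro s hs
    have h1 := (hb₂ _ (Metric.ball_subset_ball hr2 (hηc s hs).1)).1 _ (hηc s hs).2
    have h2 : 0 < ‖η' s‖ := norm_pos_iff.2 (ne_zero_of_mem_cone (hηc s hs).2)
    rw [hτ']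
    exact (mul_pos hκ h2).trans_le h1
  have hτηmono : StrictMonoOn (fun s => τ (η s)) (Icc 0 1) := by
    refine strictMonoOn_of_deriv_pos (convex_Icc _ _)
      (τ.continuous.comp_continuousOn hη.continuousOn) fun s hs => ?_
    rw [interior_Icc] at hs
    have h1 : HasDerivAt (fun s => τ (η s)) (τ (η' s)) s :=
      τ.hasFDerivAt.comp_hasDerivAt s (hηd s hs)
    rw [h1.deriv]
    exact hτη s (Ioo_subset_Icc_self hs)
  -- `γ (T s)` is the point of the geodesic at the same `τ`-level as `η s`. The deviation `y s = η s
  -- - γ (T s)` then lies in the kernel of `τ`.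
  set T : ℝ → ℝ := fun s => ψ (τ (η s)) with hT
  have hT0 : T 0 = a := by simp only [hT, hη0]; exact hψθ a
  have hT1 : T 1 = b := by simp only [hT, hη1]; exact hψθ b
  have hTmono : StrictMonoOn T (Icc 0 1) := fun s hs s' hs' h => hψmono (hτηmono hs hs' h)
  have h0mem : (0 : ℝ) ∈ Icc (0 : ℝ) 1 := by simp
  have h1mem : (1 : ℝ) ∈ Icc (0 : ℝ) 1 := by simp
  have hTIcc : ∀ s ∈ Icc (0 : ℝ) 1, T s ∈ Icc (0 : ℝ) 1 := by
    intro s hs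
    have h1 := hTmono.monotoneOn h0mem hs hs.1
    have h2 := hTmono.monotoneOn hs h1mem hs.2
    rw [hT0] at h1
    rw [hT1] at h2
    exact ⟨ha.1.trans h1, h2.trans hb.2⟩
  have hTIoo : ∀ s ∈ Ioo (0 : ℝ) 1, T s ∈ Ioo (0 : ℝ) 1 := by
    intro s hs
    have h1 := hTmono h0mem (Ioo_subset_Icc_self hs) hs.1
    have h2 := hTmono (Ioo_subset_Icc_self hs) h1mem hs.2
    rw [hT0] at h1
    rw [hT1] at h2
    exact ⟨ha.1.trans_lt h1, h2.trans_le hb.2⟩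
  set T' : ℝ → ℝ := fun s => τ (η' s) / (ε * τ (v (T s))) with hT'
  have hTd : ∀ s ∈ Ioo (0 : ℝ) 1, HasDerivAt T (T' s) s := by
    intro s hs
    have h1 := (hψd (τ (η s))).comp s (τ.hasFDerivAt.comp_hasDerivAt s (hηd s hs))
    refine h1.congr_deriv ?_
    rw [map_smul, smul_eq_mul, inv_mul_eq_div]
  have hTc : ContinuousOn T (Icc 0 1) := by
    have h1 : Continuous ψ := continuous_iff_continuousAt.2 fun y => (hψd y).continuousAt
    exact h1.comp_continuousOn (τ.continuous.comp_continuousOn hη.continuousOn)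
  set P : ℝ → 𝔼 n →L[ℝ] ℝ := fun t => (fderiv ℝ S.F (γ t, v t)).comp
      (ContinuousLinearMap.inr ℝ (𝔼 n) (𝔼 n)) with hP
  have hPc : ContinuousOn P (Icc 0 1) := by
    intro t ht
    have h1 : ContinuousAt (fderiv ℝ S.F) (γ t, v t) :=
      ((contDiffAt_F (hgeo.mem_U t ht) (hgeo.timelike t ht)).fderiv_right (m := ∞)
        (by simp)).continuousAt
    have hvc := hgeo.continuous
    have h2 : ContinuousAt (fun t => fderiv ℝ S.F (γ t, v t)) t :=
      ContinuousAt.comp (f := fun t : ℝ => (γ t, v t)) h1 (by fun_prop)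
    exact (h2.clm_comp continuousAt_const).continuousWithinAt
  set y : ℝ → 𝔼 n := fun s => η s - γ (T s) with hy
  have hyc : ContinuousOn y (Icc 0 1) :=
    hη.continuousOn.sub (hγc.comp_continuousOn hTc)
  have hyd : ∀ s ∈ Ioo (0 : ℝ) 1, HasDerivAt y (η' s - T' s • ε • v (T s)) s := fun s hs =>
    (hηd s hs).sub ((hγd (T s)).scomp s (hTd s hs))
  -- An approximate calibration: the length of `γ` up to `T s`, plus the first-order term given by
  -- the momentum, plus a quadratic correction with growing weight. As `y` vanishes at both ends,
  -- `Φ` increases by exactly the length of `γ`; it remains to see that its derivative dominates the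
  -- length element of `η`.
  set Φ : ℝ → ℝ := fun s => ε * m * T s + P (T s) (y s) + ε * B * T s * ‖y s‖ ^ 2 with hΦ
  set D : ℝ → ℝ := fun s => ε * m * T' s + ((T' s • ε • (fderiv ℝ S.F (γ (T s), v (T s))).comp
        (ContinuousLinearMap.inl ℝ (𝔼 n) (𝔼 n))) (y s) +
      P (T s) (η' s - T' s • ε • v (T s))) +
    (ε * B * T' s * ‖y s‖ ^ 2 +
      ε * B * T s * (2 * inner ℝ (y s) (η' s - T' s • ε • v (T s)))) with hD
  have hΦd : ∀ s ∈ Ioo (0 : ℝ) 1, HasDerivAt Φ (D s) s := by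
    intro s hs
    have h1 : HasDerivAt (fun s => P (T s)) (T' s • ε • (fderiv ℝ S.F (γ (T s), v (T s))).comp
        (ContinuousLinearMap.inl ℝ (𝔼 n) (𝔼 n))) s :=
      (hgeo.hasDerivAt_momentum (T s) (hTIoo s hs)).scomp s (hTd s hs)
    exact (((hTd s hs).const_mul (ε * m)).add (h1.clm_apply (hyd s hs))).add
      (((hTd s hs).const_mul (ε * B)).mul (hyd s hs).norm_sq)
  have hΦc : ContinuousOn Φ (Icc 0 1) := by
    have h1 : ContinuousOn (fun s => P (T s)) (Icc 0 1) := hPc.comp hTc hTIcc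
    exact ((continuousOn_const.mul hTc).add (h1.clm_apply hyc)).add
      ((continuousOn_const.mul hTc).mul (hyc.norm.pow 2))
  have hle : ∀ s ∈ Ioo (0 : ℝ) 1, S.F (η s, η' s) ≤ D s := by
    intro s hs
    have hs' := Ioo_subset_Icc_self hs
    have hTs := hTIcc s hs'
    set t := T s with ht
    have hτvt : 0 < τ (v t) := (half_pos hτu).trans_le (hτv t)
    have hT'pos : 0 < T' s := div_pos (hτη s hs') (mul_pos hε0 hτvt)
    set q := ε * T' s with hq
    have hq0 : 0 < q := mul_pos hε0 hT'pos
    -- `V` is the velocity of `η` rescaled so that `τ V = τ (v t)`, the normalization required by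
    -- `exists_F_le_expansion`. Homogeneity of `F` restores the factor `q`.
    set V := q⁻¹ • η' s with hV
    have hηV : η' s = q • V := by rw [hV, smul_smul, mul_inv_cancel₀ hq0.ne', one_smul]
    have hηU := (hb₂ _ (Metric.ball_subset_ball hr2 (hηc s hs').1)).2
    have hVc : V ∈ S.cone (η s) := smul_mem_cone hηU (hηc s hs').2 (inv_pos.2 hq0)
    have hFV : S.F (η s, η' s) = q * S.F (η s, V) := by rw [hηV, F_smul hηU V hq0]
    have hτV : fderiv ℝ S.L (x₀, u₀) (0, V - v t) = 0 := by
      have h1 : τ (V - v t) = 0 := by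
        rw [map_sub, hV, map_smul, smul_eq_mul, hq, hT']
        have h2 := (hτη s hs').ne'
        have h3 := hτvt.ne'
        have h4 := hε0.ne'
        field_simp
        ring
      rw [hτ', neg_eq_zero] at h1
      exact h1
    have hmain := hexp (η s) (Metric.ball_subset_ball hr1 (hηc s hs').1) (γ t)
      (Metric.ball_subset_ball hr1 (hγb t hTs)) (v t) (Metric.ball_subset_ball hr1 (hvb t)) V hVc
      hτV
    rw [hgeo.F_eq t hTs] at hmain
    change S.F (η s, V) ≤ m + fderiv ℝ S.F (γ t, v t) (y s, V - v t) + C * ‖y s‖ ^ 2 -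
      c * ‖V - v t‖ ^ 2 at hmain
    set w := V - v t with hw
    have hyw : η' s - T' s • ε • v t = q • w := by
      rw [hw, hηV, hq]; module
    have hsplit : fderiv ℝ S.F (γ t, v t) (y s, w) =
        fderiv ℝ S.F (γ t, v t) (y s, 0) + fderiv ℝ S.F (γ t, v t) (0, w) := by
      rw [← map_add]; simp
    have hDs : D s = q * (m + fderiv ℝ S.F (γ t, v t) (y s, w) + B * ‖y s‖ ^ 2 +
        2 * (ε * B) * t * inner ℝ (y s) w) := by
      simp only [hD, ← ht, hyw, hsplit, inner_smul_right, map_smul, smul_eq_mul]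
      simp only [hP, smul_apply, ContinuousLinearMap.comp_apply, ContinuousLinearMap.inl_apply,
        ContinuousLinearMap.inr_apply, smul_eq_mul, hq]
      ring
    rw [hFV, hDs]
    refine mul_le_mul_of_nonneg_left ?_ hq0.le
    -- The growing weight contributes an extra `‖y‖²` (since `B = C + 1`). Together with the
    -- concavity gain `c ‖w‖²` it dominates the mixed term from differentiating `‖y‖²`.
    have h1 : -(2 * (ε * B) * t * inner ℝ (y s) w) ≤ ‖y s‖ ^ 2 + c * ‖w‖ ^ 2 := by
      have h2 : |inner ℝ (y s) w| ≤ ‖y s‖ * ‖w‖ := abs_real_inner_le_norm _ _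
      have h3 : |t * inner ℝ (y s) w| ≤ ‖y s‖ * ‖w‖ := by
        rw [abs_mul, abs_of_nonneg hTs.1]
        exact (mul_le_of_le_one_left (abs_nonneg _) hTs.2).trans h2
      have h4 := (abs_le.1 h3).1
      have hεB0 : 0 < ε * B := mul_pos hε0 hB0
      have h5 : 0 ≤ (‖y s‖ - ε * B * ‖w‖) ^ 2 := sq_nonneg _
      have h6 : (ε * B) ^ 2 * ‖w‖ ^ 2 ≤ c * ‖w‖ ^ 2 := by gcongr
      nlinarith
    have h2 : B * ‖y s‖ ^ 2 = C * ‖y s‖ ^ 2 + ‖y s‖ ^ 2 := by rw [hB]; ring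
    linarith
  have hy0 : y 0 = 0 := by simp only [hy, hT0, hη0, sub_self]
  have hy1 : y 1 = 0 := by simp only [hy, hT1, hη1, sub_self]
  have hend : Φ 1 - Φ 0 = ε * (b - a) * m := by
    simp only [hΦ, hy0, hy1, hT0, hT1, map_zero, norm_zero]
    ring
  -- Without integrability the integral is `0` by convention, and the bound reduces to `a ≤ b`.
  by_cases hint : IntervalIntegrable (fun s => S.F (η s, η' s)) MeasureTheory.volume 0 1
  · rw [← hend]
    refine intervalIntegral.integral_le_sub_of_hasDeriv_right_of_le zero_le_one hΦc
      (fun s hs => (hΦd s hs).hasDerivWithinAt) ?_ hle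
    rwa [intervalIntegrable_iff_integrableOn_Icc_of_le zero_le_one] at hint
  · rw [intervalIntegral.integral_undef hint]
    have hab : a ≤ b := by
      rw [← hT0, ← hT1]
      exact hTmono.monotoneOn h0mem h1mem zero_le_one
    have := F_nonneg (S := S) (p, v 0)
    exact mul_nonneg (mul_nonneg hε0.le (by linarith)) this

end LorentzFinslerDomain

/-! ### Passage from the manifold to a chart -/

theorem fderiv_fderiv_comp_equiv {E F : Type*} [NormedAddCommGroup E] [NormedSpace ℝ E]
    [NormedAddCommGroup F] [NormedSpace ℝ F] (A : E ≃L[ℝ] F) {f : F → ℝ} {v : E}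
    (hf : DifferentiableAt ℝ (fderiv ℝ f) (A v)) (u w : E) :
    fderiv ℝ (fderiv ℝ fun x => f (A x)) v u w = fderiv ℝ (fderiv ℝ f) (A v) (A u) (A w) := by
  have h1 : (fderiv ℝ fun x => f (A x)) = fun x => (fderiv ℝ f (A x)).comp (A : E →L[ℝ] F) := by
    funext x
    exact A.comp_right_fderiv (f := f)
  rw [h1]
  have h2 : HasFDerivAt (fun x => fderiv ℝ f (A x))
      ((fderiv ℝ (fderiv ℝ f) (A v)).comp (A : E →L[ℝ] F)) v :=
    hf.hasFDerivAt.comp v A.hasFDerivAt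
  have h3 := h2.clm_comp (hasFDerivAt_const (A : E →L[ℝ] F) v)
  rw [h3.fderiv]
  simp

theorem HasLorentzianSignature.comp_equiv {n : ℕ} {B B' : 𝔼 n →L[ℝ] 𝔼 n →L[ℝ] ℝ}
    (hB : HasLorentzianSignature B) (A : 𝔼 n ≃L[ℝ] 𝔼 n) (h : ∀ u w, B' u w = B (A u) (A w)) :
    HasLorentzianSignature B' := by
  obtain ⟨b, hb⟩ := hB
  refine ⟨b.map A.symm.toLinearEquiv, fun i j => ?_⟩
  rw [h, ← hb i j]
  simp

namespace FinslerSpacetime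

variable {n : ℕ} {M : Type*} [TopologicalSpace M] [ChartedSpace (𝔼 n) M] [IsManifold (𝓡 n) ∞ M]
  (S : FinslerSpacetime n M) (x₀ : M)

/-- The derivative of the inverse of the chart at `x₀`. -/
def frame (x₀ : M) (x : 𝔼 n) : 𝔼 n →L[ℝ] 𝔼 n :=
  mfderiv (𝓡 n) (𝓡 n) (extChartAt (𝓡 n) x₀).symm x

/-- The derivative of the chart at `x₀`, at the point with coordinates `x`. -/
def coframe (x₀ : M) (x : 𝔼 n) : 𝔼 n →L[ℝ] 𝔼 n :=
  mfderiv (𝓡 n) (𝓡 n) (extChartAt (𝓡 n) x₀) ((extChartAt (𝓡 n) x₀).symm x)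

variable {x₀}

theorem contMDiffAt_chart_symm {x : 𝔼 n} (hx : x ∈ (extChartAt (𝓡 n) x₀).target) :
    ContMDiffAt (𝓡 n) (𝓡 n) ∞ (extChartAt (𝓡 n) x₀).symm x :=
  (contMDiffOn_extChartAt_symm x₀).contMDiffAt ((isOpen_extChartAt_target x₀).mem_nhds hx)

theorem contMDiffAt_chart {y : M} (hy : y ∈ (extChartAt (𝓡 n) x₀).source) :
    ContMDiffAt (𝓡 n) (𝓡 n) ∞ (extChartAt (𝓡 n) x₀) y :=
  contMDiffAt_extChartAt' (by rwa [extChartAt_source] at hy)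

theorem exists_frame_equiv {x : 𝔼 n} (hx : x ∈ (extChartAt (𝓡 n) x₀).target) :
    ∃ A : 𝔼 n ≃L[ℝ] 𝔼 n, (∀ v, A v = frame x₀ x v) ∧ ∀ v : 𝔼 n, A.symm v = coframe x₀ x v := by
  have h1 := mfderivWithin_extChartAt_symm_comp_mfderiv_extChartAt (I := 𝓡 n) hx
  have h2 := mfderiv_extChartAt_comp_mfderivWithin_extChartAt_symm (I := 𝓡 n) hx
  rw [ModelWithCorners.range_eq_univ, mfderivWithin_univ] at h1 h2
  refine ⟨ContinuousLinearEquiv.equivOfInverse (frame x₀ x) (coframe x₀ x) ?_ ?_, fun v => rfl,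
    fun v => rfl⟩
  · intro v
    exact congrArg (fun T : 𝔼 n →L[ℝ] 𝔼 n => T v) h2
  · intro v
    exact congrArg (fun T : 𝔼 n →L[ℝ] 𝔼 n => T v) h1

theorem frame_coframe {x : 𝔼 n} (hx : x ∈ (extChartAt (𝓡 n) x₀).target) (v : 𝔼 n) :
    frame x₀ x (coframe x₀ x v) = v := by
  obtain ⟨A, h1, h2⟩ := exists_frame_equiv hx
  rw [← h1, ← h2, A.apply_symm_apply]

/-- The tangent space at `x₀` is read in the preferred chart at `x₀`, so that chart has identity
derivative there. Hence `L` on the fibre over `x₀` needs no change of basis. -/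
theorem frame_self : frame x₀ (extChartAt (𝓡 n) x₀ x₀) = ContinuousLinearMap.id ℝ (𝔼 n) := by
  obtain ⟨A, h1, h2⟩ := exists_frame_equiv (mem_extChartAt_target (I := 𝓡 n) x₀)
  have h3 : ∀ v : 𝔼 n, A.symm v = v := by
    intro v
    rw [h2, coframe, extChartAt_to_inv]
    have h4 := mfderiv_chartAt_eq_tangentCoordChange (I := 𝓡 n) (x := x₀) (y := x₀)
      (mem_chart_source _ x₀)
    have h5 := tangentCoordChange_self (I := 𝓡 n) (x := x₀) (z := x₀) (v := v)
      (mem_extChartAt_source x₀)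
    rw [← h4] at h5
    exact h5
  ext1 v
  rw [← h1, A.symm_apply_eq.1 (h3 v)]
  simp [← A.symm_apply_eq.1 (h3 v)]

theorem contMDiffOn_bundle_chart_symm (x₀ : M) :
    ContMDiffOn 𝓘(ℝ, 𝔼 n × 𝔼 n) (𝓡 n).tangent ∞
      (fun z : 𝔼 n × 𝔼 n => (⟨(extChartAt (𝓡 n) x₀).symm z.1, frame x₀ z.1 z.2⟩ :
        TangentBundle (𝓡 n) M)) ((extChartAt (𝓡 n) x₀).target ×ˢ univ) := by
  have h1 : ContMDiffOn (𝓡 n).tangent (𝓡 n).tangent ∞ (tangentMapWithin (𝓡 n) (𝓡 n)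
      (extChartAt (𝓡 n) x₀).symm (extChartAt (𝓡 n) x₀).target) _ :=
    (contMDiffOn_extChartAt_symm (I := 𝓡 n) (n := ∞) x₀).contMDiffOn_tangentMapWithin (m := ∞)
      (by simp) (isOpen_extChartAt_target x₀).uniqueMDiffOn
  have h2 : ContMDiff ((𝓡 n).prod 𝓘(ℝ, 𝔼 n)) (𝓡 n).tangent ∞
    ((tangentBundleModelSpaceHomeomorph (𝓡 n)).symm : ModelProd (𝔼 n) (𝔼 n) → _) :=
    contMDiff_tangentBundleModelSpaceHomeomorph_symm
  have h3 : ContMDiff 𝓘(ℝ, 𝔼 n × 𝔼 n) (𝓡 n).tangent ∞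
      (fun z : 𝔼 n × 𝔼 n => (tangentBundleModelSpaceHomeomorph (𝓡 n)).symm z) := by
    rw [modelWithCornersSelf_prod]
    exact h2
  refine ((h1.comp h3.contMDiffOn ?_)).congr ?_ (s := (extChartAt (𝓡 n) x₀).target ×ˢ univ)
  · rintro z ⟨hz, -⟩
    exact hz
  · rintro z ⟨hz, -⟩
    exact congrArg (fun T : 𝔼 n →L[ℝ] 𝔼 n =>
      (⟨(extChartAt (𝓡 n) x₀).symm z.1, T z.2⟩ : TangentBundle (𝓡 n) M))
      (mfderivWithin_of_isOpen (isOpen_extChartAt_target x₀) hz).symm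

theorem contDiffAt_L_chart {x : 𝔼 n} (hx : x ∈ (extChartAt (𝓡 n) x₀).target) {v : 𝔼 n}
    (hv : v ≠ 0) : ContDiffAt ℝ ∞ (fun z : 𝔼 n × 𝔼 n =>
      S.L ⟨(extChartAt (𝓡 n) x₀).symm z.1, frame x₀ z.1 z.2⟩) (x, v) := by
  have h1 := (contMDiffOn_bundle_chart_symm x₀).mono
    (prod_mono (s₁ := (extChartAt (𝓡 n) x₀).target) subset_rfl (subset_univ ({0}ᶜ : Set (𝔼 n))))
  have h2 := S.smooth_L.comp h1 (by
    rintro z ⟨hz, hz0⟩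
    obtain ⟨A, hA, -⟩ := exists_frame_equiv hz
    change frame x₀ z.1 z.2 ≠ 0
    rw [← hA]
    simpa using hz0)
  exact (h2.contMDiffAt (((isOpen_extChartAt_target x₀).prod isOpen_compl_singleton).mem_nhds
    (show (x, v) ∈ _ from ⟨hx, hv⟩))).contDiffAt

/-- Smoothness on the fibre is obtained in the chart centred at `x` itself, where the frame is the
identity. -/
theorem isLorentzMinkowski (x : M) : IsLorentzMinkowski fun v : 𝔼 n => S.L ⟨x, v⟩ where
  contDiffAt v hv := by
    have h1 := S.contDiffAt_L_chart (mem_extChartAt_target (I := 𝓡 n) x) hv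
    have h2 : ContDiffAt ℝ ∞ (fun w : 𝔼 n => (extChartAt (𝓡 n) x x, w)) v := by fun_prop
    have h3 := h1.comp v h2
    simp only [Function.comp_def, frame_self] at h3
    refine h3.congr_of_eventuallyEq (Eventually.of_forall fun w => ?_)
    change S.L ⟨x, w⟩ = S.L ⟨_, w⟩
    rw [extChartAt_to_inv]
  homogeneous v c hc := S.homogeneous_L x v c hc
  signature v hv := S.signature_L x v hv

theorem continuousOn_X_chart (x₀ : M) : ContinuousOn (fun x : 𝔼 n => coframe x₀ x
      (S.X ((extChartAt (𝓡 n) x₀).symm x))) (extChartAt (𝓡 n) x₀).target := by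
  have h0 : IsOpen (extChartAt (𝓡 n) x₀).source := isOpen_extChartAt_source x₀
  have h' : ContMDiffOn (𝓡 n) (𝓡 n) ∞ (extChartAt (𝓡 n) x₀) (extChartAt (𝓡 n) x₀).source :=
    fun y hy => (contMDiffAt_chart hy).contMDiffWithinAt
  have h1 := h'.contMDiffOn_tangentMapWithin (m := ∞) (by simp) h0.uniqueMDiffOn
  have h2 := (S.smooth_X.continuous.comp_continuousOn (continuousOn_extChartAt_symm (I := 𝓡 n) x₀))
  have h3 := h1.continuousOn.comp h2 (fun x hx => (extChartAt (𝓡 n) x₀).map_target hx)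
  have h4 := (contMDiff_snd_tangentBundle_modelSpace (n := ∞) (𝔼 n)
    (𝓡 n)).continuous.comp_continuousOn h3
  refine h4.congr fun x hx => ?_
  have h5 : (extChartAt (𝓡 n) x₀).symm x ∈ (extChartAt (𝓡 n) x₀).source :=
    (extChartAt (𝓡 n) x₀).map_target hx
  exact congrArg (fun T : 𝔼 n →L[ℝ] 𝔼 n => T (S.X ((extChartAt (𝓡 n) x₀).symm x)))
    (mfderivWithin_of_isOpen (I := 𝓡 n) (I' := 𝓡 n) (f := extChartAt (𝓡 n) x₀) h0 h5).symm

/-- The coordinate representation of a Finsler spacetime in the chart at `x₀`. -/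
def inChart (x₀ : M) : LorentzFinslerDomain n where
  U := (extChartAt (𝓡 n) x₀).target
  isOpen_U := isOpen_extChartAt_target x₀
  L z := S.L ⟨(extChartAt (𝓡 n) x₀).symm z.1, frame x₀ z.1 z.2⟩
  contDiffAt_L x hx v hv := S.contDiffAt_L_chart hx hv
  homogeneous x hx v c hc := by
    rw [map_smul]
    exact S.homogeneous_L ((extChartAt (𝓡 n) x₀).symm x) (frame x₀ x v) c hc
  signature x hx v hv := by
    obtain ⟨A, h1, h2⟩ := exists_frame_equiv hx
    simp only [← h1]
    have hv' : A v ≠ 0 := by simpa using hv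
    have h3 := S.signature_L ((extChartAt (𝓡 n) x₀).symm x) (A v) hv'
    refine h3.comp_equiv A fun u w => ?_
    exact fderiv_fderiv_comp_equiv A (f := fun u : 𝔼 n =>
      S.L ⟨(extChartAt (𝓡 n) x₀).symm x, u⟩)
      (((S.isLorentzMinkowski _).contDiffAt_fderiv hv').differentiableAt (by simp)) u w
  X x := coframe x₀ x (S.X ((extChartAt (𝓡 n) x₀).symm x))
  continuousOn_X := S.continuousOn_X_chart x₀
  timelike_X x hx := by
    obtain ⟨A, h1, h2⟩ := exists_frame_equiv hx
    have h3 := frame_coframe hx (S.X ((extChartAt (𝓡 n) x₀).symm x))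
    exact (congrArg (fun v : 𝔼 n => S.L ⟨(extChartAt (𝓡 n) x₀).symm x, v⟩) h3).trans_lt
      (S.timelike_X _)

/-- The chart at `x₀`. -/
local notation "φ" => extChartAt (𝓡 n) x₀

theorem inChart_L_self (v : 𝔼 n) : (S.inChart x₀).L ((φ) x₀, v) = S.L ⟨x₀, v⟩ := by
  change S.L ⟨(φ).symm ((φ) x₀), frame x₀ ((φ) x₀) v⟩ = _
  rw [extChartAt_to_inv, frame_self]
  rfl

/-- The frame is a linear homeomorphism of the fibres that respects `L` and `X`, so it carries
closures and connected components to each other. -/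
theorem mem_inChart_cone {x : 𝔼 n} (hx : x ∈ (φ).target) (v : 𝔼 n) :
    v ∈ (S.inChart x₀).cone x ↔ (frame x₀ x v : 𝔼 n) ∈ S.futureCausal ((φ).symm x) := by
  obtain ⟨A, h1, h2⟩ := exists_frame_equiv hx
  have h3 : A '' {v | (S.inChart x₀).L (x, v) < 0} = S.timelike ((φ).symm x) := by
    ext w
    constructor
    · rintro ⟨v, hv, rfl⟩
      rw [h1]
      exact hv
    · intro hw
      refine ⟨A.symm w, ?_, by simp⟩
      change S.L ⟨_, frame x₀ x (A.symm w)⟩ < 0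
      rw [← h1, A.apply_symm_apply]
      exact hw
  have h4 : A '' (closure {v | (S.inChart x₀).L (x, v) < 0} \ {0}) =
      (closure (S.timelike ((φ).symm x)) \ {0} : Set (𝔼 n)) := by
    rw [image_sdiff A.injective, image_singleton, map_zero, ← h3]
    exact congrArg (· \ {0}) (A.toHomeomorph.image_closure _)
  have h5 : A '' ((S.inChart x₀).cone x) = S.futureCausal ((φ).symm x) := by
    have h6 := A.toHomeomorph.image_connectedComponentIn
      (s := closure {v | (S.inChart x₀).L (x, v) < 0} \ {0}) (x := (S.inChart x₀).X x)
      (connectedComponentIn_nonempty_iff.1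
        ⟨_, LorentzFinslerDomain.X_mem_cone (S := S.inChart x₀) hx⟩)
    have h7 : A ((S.inChart x₀).X x) = S.X ((φ).symm x) := by
      refine (congrArg A (h2 _).symm).trans (A.apply_symm_apply _)
    change A '' (S.inChart x₀).cone x = connectedComponentIn
      (A '' (closure {v | (S.inChart x₀).L (x, v) < 0} \ {0})) (A ((S.inChart x₀).X x)) at h6
    rw [h4, h7] at h6
    exact h6
  have h8 : (A v ∈ A '' (S.inChart x₀).cone x) ↔ v ∈ (S.inChart x₀).cone x :=
    A.injective.mem_set_image
  rw [h5, h1] at h8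
  exact h8.symm

end FinslerSpacetime

/-! ### Curves, velocities and lengths in a chart -/

namespace FinslerSpacetime

variable {n : ℕ} {M : Type*} [TopologicalSpace M] [ChartedSpace (𝔼 n) M] [IsManifold (𝓡 n) ∞ M]
  (S : FinslerSpacetime n M) {x₀ : M}

/-- The chart at `x₀`. -/
local notation "φ" => extChartAt (𝓡 n) x₀

theorem velocity_chart_symm {η : ℝ → 𝔼 n} (hη : ContDiffOn ℝ 1 η (Icc 0 1)) {t : ℝ}
    (ht : t ∈ Icc (0 : ℝ) 1) (h : η t ∈ (φ).target) :
    (velocity ((φ).symm ∘ η) t : 𝔼 n) = frame x₀ (η t) (derivWithin η (Icc 0 1) t) := by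
  have h1 : MDifferentiableAt (𝓡 n) (𝓡 n) (φ).symm (η t) :=
    (contMDiffAt_chart_symm h).mdifferentiableAt (by simp)
  have h2 : DifferentiableWithinAt ℝ η (Icc 0 1) t := hη.differentiableOn (by simp) t ht
  have hu := uniqueDiffOn_Icc (zero_lt_one' ℝ) t ht
  have h3 := mfderiv_comp_mfderivWithin t h1 h2.mdifferentiableWithinAt
    (uniqueMDiffWithinAt_iff_uniqueDiffWithinAt.2 hu)
  have h4 := congrArg (fun T : ℝ →L[ℝ] 𝔼 n => T 1) h3
  refine h4.trans ?_
  change frame x₀ (η t) (mfderivWithin 𝓘(ℝ, ℝ) (𝓡 n) η (Icc 0 1) t (1 : ℝ)) = _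
  rw [mfderivWithin_eq_fderivWithin]
  rfl

theorem velocity_congr {c c' : ℝ → M} (h : EqOn c c' (Icc 0 1)) {t : ℝ} (ht : t ∈ Icc (0 : ℝ) 1) :
    (velocity c t : 𝔼 n) = velocity c' t := by
  have h1 := mfderivWithin_congr (I := 𝓘(ℝ, ℝ)) (I' := 𝓡 n) h (h ht)
  exact congrArg (fun T : ℝ →L[ℝ] 𝔼 n => T 1) h1

theorem contDiffOn_chart {c : ℝ → M} (hc : ContMDiffOn 𝓘(ℝ, ℝ) (𝓡 n) 1 c (Icc 0 1))
    (h : ∀ t ∈ Icc (0 : ℝ) 1, c t ∈ (φ).source) : ContDiffOn ℝ 1 ((φ) ∘ c) (Icc 0 1) := by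
  have h1 : ContMDiffOn (𝓡 n) (𝓡 n) 1 (φ) (φ).source := fun y hy =>
    ((contMDiffAt_chart hy).of_le (by simp)).contMDiffWithinAt
  exact contMDiffOn_iff_contDiffOn.1 (h1.comp hc h)

theorem velocity_eq_frame {c : ℝ → M} (hc : ContMDiffOn 𝓘(ℝ, ℝ) (𝓡 n) 1 c (Icc 0 1))
    (h : ∀ t ∈ Icc (0 : ℝ) 1, c t ∈ (φ).source) {t : ℝ} (ht : t ∈ Icc (0 : ℝ) 1) :
    (velocity c t : 𝔼 n) = frame x₀ ((φ) (c t)) (derivWithin ((φ) ∘ c) (Icc 0 1) t) := by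
  rw [velocity_congr (c' := (φ).symm ∘ ((φ) ∘ c)) (fun s hs => ((φ).left_inv (h s hs)).symm) ht]
  exact velocity_chart_symm (contDiffOn_chart hc h) ht ((φ).map_source (h t ht))

theorem isCausalCurve_chart_symm {η : ℝ → 𝔼 n} (hη : ContDiffOn ℝ 1 η (Icc 0 1))
    (h : ∀ t ∈ Icc (0 : ℝ) 1,
      η t ∈ (φ).target ∧ derivWithin η (Icc 0 1) t ∈ (S.inChart x₀).cone (η t)) :
    S.IsCausalCurve ((φ).symm ∘ η) ((φ).symm (η 0)) ((φ).symm (η 1)) where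
  contMDiffOn := by
    have h1 : ContMDiffOn (𝓡 n) (𝓡 n) 1 (φ).symm (φ).target := fun y hy =>
      ((contMDiffAt_chart_symm hy).of_le (by simp)).contMDiffWithinAt
    exact h1.comp (contMDiffOn_iff_contDiffOn.2 hη) fun t ht => (h t ht).1
  velocity_mem t ht := by
    have h1 := (S.mem_inChart_cone (h t ht).1 _).1 (h t ht).2
    rw [← velocity_chart_symm hη ht (h t ht).1] at h1
    exact h1
  source := rfl
  target := rfl

theorem isTimelikeCurve_chart_symm {η : ℝ → 𝔼 n} (hη : ContDiffOn ℝ 1 η (Icc 0 1))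
    (h : ∀ t ∈ Icc (0 : ℝ) 1,
      η t ∈ (φ).target ∧ derivWithin η (Icc 0 1) t ∈ (S.inChart x₀).cone (η t))
    (h' : ∀ t ∈ Icc (0 : ℝ) 1, (S.inChart x₀).L (η t, derivWithin η (Icc 0 1) t) < 0) :
    S.IsTimelikeCurve ((φ).symm ∘ η) ((φ).symm (η 0)) ((φ).symm (η 1)) where
  contMDiffOn := (S.isCausalCurve_chart_symm hη h).contMDiffOn
  velocity_mem t ht := by
    refine ⟨?_, (S.isCausalCurve_chart_symm hη h).velocity_mem t ht⟩
    have h1 : S.L ⟨(φ).symm (η t), frame x₀ (η t) (derivWithin η (Icc 0 1) t)⟩ < 0 := h' t ht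
    rw [← velocity_chart_symm hη ht (h t ht).1] at h1
    exact h1
  source := rfl
  target := rfl

theorem IsCausalCurve.derivWithin_chart_mem {S : FinslerSpacetime n M} {c : ℝ → M} {x y : M}
    (hc : S.IsCausalCurve c x y)
    (h : ∀ t ∈ Icc (0 : ℝ) 1, c t ∈ (φ).source) {t : ℝ} (ht : t ∈ Icc (0 : ℝ) 1) :
    derivWithin ((φ) ∘ c) (Icc 0 1) t ∈ (S.inChart x₀).cone ((φ) (c t)) := by
  rw [S.mem_inChart_cone ((φ).map_source (h t ht)), ← velocity_eq_frame hc.contMDiffOn h ht]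
  rw [(φ).left_inv (h t ht)]
  exact hc.velocity_mem t ht

theorem length_eq_integral {c : ℝ → M} (hc : ContMDiffOn 𝓘(ℝ, ℝ) (𝓡 n) 1 c (Icc 0 1))
    (h : ∀ t ∈ Icc (0 : ℝ) 1, c t ∈ (φ).source) :
    S.length c =
      ∫ t in (0 : ℝ)..1, (S.inChart x₀).F (((φ) ∘ c) t, derivWithin ((φ) ∘ c) (Icc 0 1) t) := by
  refine intervalIntegral.integral_congr fun t ht => ?_
  rw [uIcc_of_le zero_le_one] at ht
  change S.F (c t) (velocity c t) =
    S.F ((φ).symm ((φ) (c t))) (frame x₀ ((φ) (c t)) (derivWithin ((φ) ∘ c) (Icc 0 1) t))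
  rw [← velocity_eq_frame hc h ht, (φ).left_inv (h t ht)]

theorem length_chart_symm {η : ℝ → 𝔼 n} (hη : ContDiffOn ℝ 1 η (Icc 0 1))
    (h : ∀ t ∈ Icc (0 : ℝ) 1, η t ∈ (φ).target) :
    S.length ((φ).symm ∘ η) =
      ∫ t in (0 : ℝ)..1, (S.inChart x₀).F (η t, derivWithin η (Icc 0 1) t) := by
  refine intervalIntegral.integral_congr fun t ht => ?_
  rw [uIcc_of_le zero_le_one] at ht
  change S.F ((φ).symm (η t)) (velocity ((φ).symm ∘ η) t) =
    S.F ((φ).symm (η t)) (frame x₀ (η t) (derivWithin η (Icc 0 1) t))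
  rw [← velocity_chart_symm hη ht (h t ht)]

end FinslerSpacetime

/-! ### Short maximizing curves in the spacetime -/

namespace FinslerSpacetime

variable {n : ℕ} {M : Type*} [TopologicalSpace M] [ChartedSpace (𝔼 n) M] [IsManifold (𝓡 n) ∞ M]
  (S : FinslerSpacetime n M) {x₀ : M}

/-- The chart at `x₀`. -/
local notation "φ" => extChartAt (𝓡 n) x₀

open LorentzFinslerDomain

/-- Causal curves with endpoints close to `x₀` stay close to `x₀`. -/
def LocallyCausalAt (x₀ : M) : Prop :=
  ∀ W ∈ 𝓝 x₀, ∃ V ∈ 𝓝 x₀, ∀ (c : ℝ → M) (y z : M), S.IsCausalCurve c y z → y ∈ V → z ∈ V →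
    ∀ t ∈ Icc (0 : ℝ) 1, c t ∈ W

theorem StronglyCausal.locallyCausalAt {S : FinslerSpacetime n M} (hS : S.StronglyCausal)
    (x₀ : M) : S.LocallyCausalAt x₀ := by
  intro W hW
  obtain ⟨V, hV, hVW, h⟩ := hS x₀ W hW
  refine ⟨V, hV, fun c y z hc hy hz t ht => hVW ?_⟩
  exact h c y z hc 0 (by simp) 1 (by simp) (by rwa [hc.source]) (by rwa [hc.target]) t ht

variable {S}

theorem isTimelikeCurve_subarc {ε : ℝ} (hε : 0 < ε) {p : 𝔼 n} {v : ℝ → 𝔼 n}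
    (h : (S.inChart x₀).IsGeodesic ε p v) {a b : ℝ} (ha : 0 ≤ a) (hab : a < b) (hb : b ≤ 1) :
    S.IsTimelikeCurve ((φ).symm ∘ fun r => curve ε p v (a + r * (b - a)))
      ((φ).symm (curve ε p v a)) ((φ).symm (curve ε p v b)) ∧
    S.length ((φ).symm ∘ fun r => curve ε p v (a + r * (b - a))) =
      ε * (b - a) * (S.inChart x₀).F (p, v 0) := by
  set η : ℝ → 𝔼 n := fun r => curve ε p v (a + r * (b - a)) with hη
  have hd : ∀ r, HasDerivAt η ((ε * (b - a)) • v (a + r * (b - a))) r := by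
    intro r
    have h1 : HasDerivAt (fun r : ℝ => a + r * (b - a)) (b - a) r := by
      simpa using ((hasDerivAt_id r).mul_const (b - a)).const_add a
    have h2 := (hasDerivAt_curve ε p h.continuous (a + r * (b - a))).scomp r h1
    rw [smul_smul, mul_comm] at h2
    exact h2
  have hC : ContDiff ℝ 1 η := by
    refine contDiff_one_iff_deriv.2 ⟨fun r => (hd r).differentiableAt, ?_⟩
    rw [funext fun r => (hd r).deriv]
    have := h.continuous
    fun_prop
  have hdw : ∀ r ∈ Icc (0 : ℝ) 1,
      derivWithin η (Icc 0 1) r = (ε * (b - a)) • v (a + r * (b - a)) := fun r hr =>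
    (hd r).hasDerivWithinAt.derivWithin (uniqueDiffOn_Icc (zero_lt_one' ℝ) r hr)
  have hpos : 0 < ε * (b - a) := mul_pos hε (sub_pos.2 hab)
  have hmem : ∀ r ∈ Icc (0 : ℝ) 1, a + r * (b - a) ∈ Icc (0 : ℝ) 1 := by
    intro r hr
    constructor <;> nlinarith [hr.1, hr.2]
  have h1 : ∀ t ∈ Icc (0 : ℝ) 1,
      η t ∈ (φ).target ∧ derivWithin η (Icc 0 1) t ∈ (S.inChart x₀).cone (η t) := fun t ht =>
    ⟨h.mem_U _ (hmem t ht), by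
      rw [hdw t ht]
      exact smul_mem_cone (h.mem_U _ (hmem t ht)) (h.mem_cone _ (hmem t ht)) hpos⟩
  have h2 : ∀ t ∈ Icc (0 : ℝ) 1, (S.inChart x₀).L (η t, derivWithin η (Icc 0 1) t) < 0 := by
    intro t ht
    rw [hdw t ht, (S.inChart x₀).homogeneous _ (h.mem_U _ (hmem t ht)) _ _ hpos]
    exact mul_neg_of_pos_of_neg (by positivity) (h.timelike _ (hmem t ht))
  constructor
  · have h3 := S.isTimelikeCurve_chart_symm hC.contDiffOn h1 h2
    have e0 : η 0 = curve ε p v a := by simp [hη]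
    have e1 : η 1 = curve ε p v b := by simp [hη]
    rwa [e0, e1] at h3
  · rw [S.length_chart_symm hC.contDiffOn fun t ht => (h1 t ht).1]
    have h4 : ∀ t ∈ uIcc (0 : ℝ) 1, (S.inChart x₀).F (η t, derivWithin η (Icc 0 1) t) =
        ε * (b - a) * (S.inChart x₀).F (p, v 0) := by
      intro t ht
      rw [uIcc_of_le zero_le_one] at ht
      rw [hdw t ht, F_smul (h.mem_U _ (hmem t ht)) _ hpos, ← h.F_eq _ (hmem t ht)]
    rw [intervalIntegral.integral_congr h4]
    simp

theorem IsTimelikeCurve.isCausalCurve {c : ℝ → M} {x y : M} (h : S.IsTimelikeCurve c x y) :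
    S.IsCausalCurve c x y :=
  ⟨h.contMDiffOn, fun t ht => (h.velocity_mem t ht).2, h.source, h.target⟩

variable (S x₀) in
/-- A maximizing timelike curve `c` whose coordinate representation is close to the segment from
`z.1` to `z.1 + ε • z.2`, of length `ε * m`. -/
structure IsShortGeodesic (C ε : ℝ) (z : 𝔼 n × 𝔼 n) (c : ℝ → M) (m : ℝ) : Prop where
  source : c 0 = (φ).symm z.1
  chron : S.Chron (c 0) (c 1)
  maximizing : S.IsMaximizing c (c 0) (c 1)
  l_eq : ∀ s t, 0 ≤ s → s < t → t ≤ 1 → S.l (c s) (c t) = ((ε * (t - s) * m : ℝ) : EReal)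
  mem_source : ∀ t ∈ Icc (0 : ℝ) 1, c t ∈ (φ).source
  abs_sub_le : |m - (S.inChart x₀).F z| ≤ C * ε
  norm_sub_le : ∀ t ∈ Icc (0 : ℝ) 1, ‖(φ) (c t) - (z.1 + (ε * t) • z.2)‖ ≤ C * ε ^ 2

theorem norm_integral_le_of_le {f : ℝ → 𝔼 n} {B t : ℝ} (ht : t ∈ Icc (0 : ℝ) 1)
    (h : ∀ s, ‖f s‖ ≤ B) : ‖∫ s in (0 : ℝ)..t, f s‖ ≤ B := by
  have h1 := intervalIntegral.norm_integral_le_of_norm_le_const (a := 0) (b := t) (f := f) (C := B)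
    fun s _ => h s
  rw [sub_zero, abs_of_nonneg ht.1] at h1
  exact h1.trans (mul_le_of_le_one_right ((norm_nonneg _).trans (h 0)) ht.2)

/-- Maximality is known only among curves near `x₀` in the chart; local causality forces every
causal curve between the endpoints to be one of these. Either the length (`κ = 0`) or the endpoint
(`κ = 1`) is prescribed exactly, and the other one up to a small error. -/
theorem exists_isShortGeodesic (hS : S.LocallyCausalAt x₀) {u₀ : 𝔼 n}
    (hu : (S.inChart x₀).L ((φ) x₀, u₀) < 0) (huc : u₀ ∈ (S.inChart x₀).cone ((φ) x₀))
    {κ : ℝ} (hκ : κ ∈ Icc (0 : ℝ) 1) :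
    ∃ C > 0, ∃ δ > 0, ∃ ε₀ > 0, ∀ ε ∈ Ioo 0 ε₀, ∃ (c : 𝔼 n × 𝔼 n → ℝ → M) (m : 𝔼 n × 𝔼 n → ℝ),
      (∀ t ∈ Icc (0 : ℝ) 1, ContinuousOn (fun z => (φ) (c z t)) (Metric.ball ((φ) x₀, u₀) δ)) ∧
      ContinuousOn m (Metric.ball ((φ) x₀, u₀) δ) ∧
      ∀ z ∈ Metric.ball ((φ) x₀, u₀) δ, S.IsShortGeodesic x₀ C ε z (c z) (m z) ∧
        (κ = 0 → m z = (S.inChart x₀).F z) ∧ (κ = 1 → c z 1 = (φ).symm (z.1 + ε • z.2)) := by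
  have hx : (φ) x₀ ∈ (S.inChart x₀).U := mem_extChartAt_target x₀
  obtain ⟨r₁, hr₁, ε₁, hε₁, hmax⟩ := IsGeodesic.exists_integral_le hx hu huc
  obtain ⟨K, N, hN, hK⟩ :=
    ((contDiffAt_F (S := S.inChart x₀) (z := ((φ) x₀, u₀)) hx hu).of_le
      (m := 1) (by simp)).exists_lipschitzOnWith
  obtain ⟨r₂, hr₂, hNb⟩ := Metric.mem_nhds_iff.1 hN
  have hW : (φ).source ∩ (φ) ⁻¹' (Metric.ball ((φ) x₀) r₁) ∈ 𝓝 x₀ :=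
    inter_mem (extChartAt_source_mem_nhds x₀)
      ((continuousAt_extChartAt x₀).preimage_mem_nhds (Metric.ball_mem_nhds _ hr₁))
  obtain ⟨V, hV, hVW⟩ := hS _ hW
  have hV' : (φ).symm ⁻¹' V ∈ 𝓝 ((φ) x₀) :=
    (continuousAt_extChartAt_symm x₀).preimage_mem_nhds (by rwa [extChartAt_to_inv])
  obtain ⟨r₃, hr₃, hVb⟩ := Metric.mem_nhds_iff.1 hV'
  set r := min (min r₁ r₂) r₃ with hr
  have hr0 : 0 < r := by positivity
  have hrr₁ : r ≤ r₁ := (min_le_left _ _).trans (min_le_left _ _)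
  have hrr₂ : r ≤ r₂ := (min_le_left _ _).trans (min_le_right _ _)
  have hrr₃ : r ≤ r₃ := min_le_right _ _
  obtain ⟨C, hC, δ, hδ, ε₂, hε₂, hgeo⟩ := exists_isGeodesic hx hu huc hκ hr0
  refine ⟨C * (1 + K), by positivity, min δ r₂, by positivity, min ε₁ ε₂, by positivity,
    fun ε hε => ?_⟩
  have hε0 : 0 < ε := hε.1
  obtain ⟨v, hlip, hv⟩ := hgeo ε ⟨hε.1, hε.2.trans_le (min_le_right _ _)⟩
  have hsub : Metric.ball ((φ) x₀, u₀) (min δ r₂) ⊆ Metric.ball ((φ) x₀, u₀) δ :=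
    Metric.ball_subset_ball (min_le_left _ _)
  -- Continuity in the data comes from the Lipschitz dependence of the velocities on `z`.
  have hvc : ∀ t, Continuous fun z => v z t := fun t => by
    refine (LipschitzWith.of_dist_le_mul (K := 4) fun z z' => ?_).continuous
    simpa [dist_eq_norm] using hlip z z' t
  have hN0 : ∀ z ∈ Metric.ball ((φ) x₀, u₀) (min δ r₂), (z.1, v z 0) ∈ N := by
    intro z hz
    refine hNb ?_
    rw [← ball_prod_same]
    have h1 := Metric.ball_subset_ball (min_le_right δ r₂) hz
    rw [← ball_prod_same] at h1
    exact ⟨h1.1, Metric.ball_subset_ball hrr₂ ((hv z (hsub hz)).2.2.1 0)⟩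
  refine ⟨fun z t => (φ).symm (curve ε z.1 (v z) t), fun z => (S.inChart x₀).F (z.1, v z 0),
    ?_, ?_, ?_⟩
  · intro t ht
    have h1 : ContinuousOn (fun z : 𝔼 n × 𝔼 n => ∫ s in (0 : ℝ)..t, v z s)
        (Metric.ball ((φ) x₀, u₀) (min δ r₂)) := by
      refine (LipschitzOnWith.of_dist_le_mul (K := 4) fun z hz z' hz' => ?_).continuousOn
      rw [dist_eq_norm, dist_eq_norm, ← intervalIntegral.integral_sub
        ((hv z (hsub hz)).1.continuous.intervalIntegrable _ _)
        ((hv z' (hsub hz')).1.continuous.intervalIntegrable _ _)]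
      refine (norm_integral_le_of_le ht fun s => hlip z z' s).trans_eq (by simp)
    have h2 : ContinuousOn (fun z : 𝔼 n × 𝔼 n => curve ε z.1 (v z) t)
        (Metric.ball ((φ) x₀, u₀) (min δ r₂)) :=
      continuous_fst.continuousOn.add (h1.const_smul ε)
    refine h2.congr fun z hz => ?_
    exact (φ).right_inv ((hv z (hsub hz)).1.mem_U t ht)
  · exact hK.continuousOn.comp (continuous_fst.prodMk (hvc 0)).continuousOn hN0
  · intro z hz
    obtain ⟨hg, hvC, hvb, hcb, hκ0, hκ1⟩ := hv z (hsub hz)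
    have hl : ∀ s t, 0 ≤ s → s < t → t ≤ 1 → S.l ((φ).symm (curve ε z.1 (v z) s))
        ((φ).symm (curve ε z.1 (v z) t)) =
          ((ε * (t - s) * (S.inChart x₀).F (z.1, v z 0) : ℝ) : EReal) := by
      intro s t hs hst ht
      obtain ⟨h1, h2⟩ := isTimelikeCurve_subarc (x₀ := x₀) hε0 hg hs hst ht
      have hs' : s ∈ Icc (0 : ℝ) 1 := ⟨hs, hst.le.trans ht⟩
      have ht' : t ∈ Icc (0 : ℝ) 1 := ⟨hs.trans hst.le, ht⟩
      refine le_antisymm (iSup₂_le fun c hc => ?_) ?_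
      · have h3 : ∀ r ∈ Icc (0 : ℝ) 1, c r ∈ (φ).source ∩ (φ) ⁻¹' (Metric.ball ((φ) x₀) r₁) :=
          hVW c _ _ hc (hVb (Metric.ball_subset_ball hrr₃ (hcb s hs')))
            (hVb (Metric.ball_subset_ball hrr₃ (hcb t ht')))
        have h4 := fun r hr => (h3 r hr).1
        rw [S.length_eq_integral hc.contMDiffOn h4]
        refine EReal.coe_le_coe_iff.2 (hmax ε ⟨hε.1, hε.2.trans_le (min_le_left _ _)⟩ z.1 (v z) hg
          (fun t => Metric.ball_subset_ball hrr₁ (hvb t))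
          (fun t ht => Metric.ball_subset_ball hrr₁ (hcb t ht)) s hs' t ht' _
          (contDiffOn_chart hc.contMDiffOn h4)
          (fun r hr => ⟨(h3 r hr).2, hc.derivWithin_chart_mem h4 hr⟩) ?_ ?_)
        · rw [Function.comp_apply, hc.source, (φ).right_inv (hg.mem_U s hs')]
        · rw [Function.comp_apply, hc.target, (φ).right_inv (hg.mem_U t ht')]
      · rw [← h2]
        exact le_iSup₂ (f := fun (c : ℝ → M) (_ : S.IsCausalCurve c
          ((φ).symm (curve ε z.1 (v z) s)) ((φ).symm (curve ε z.1 (v z) t))) =>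
          (S.length c : EReal)) _ h1.isCausalCurve
    obtain ⟨h1, h2⟩ := isTimelikeCurve_subarc (x₀ := x₀) hε0 hg le_rfl zero_lt_one le_rfl
    have e1 : ((φ).symm ∘ fun r => curve ε z.1 (v z) (0 + r * (1 - 0))) =
        fun t => (φ).symm (curve ε z.1 (v z) t) := by
      funext t
      simp
    rw [e1] at h1 h2
    have hz' : z ∈ N := hNb (Metric.ball_subset_ball (min_le_right _ _) hz)
    refine ⟨⟨by simp [curve_zero], ⟨_, h1⟩, ⟨h1.isCausalCurve, ?_⟩, hl, ?_, ?_, ?_⟩, ?_, ?_⟩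
    · rw [h2]
      exact hl 0 1 le_rfl zero_lt_one le_rfl
    · exact fun t ht => (φ).map_target (hg.mem_U t ht)
    · have h3 := hK.dist_le_mul _ (hN0 z hz) _ hz'
      rw [Real.dist_eq, dist_eq_norm] at h3
      have h4 : ‖(z.1, v z 0) - z‖ ≤ C * ε := by
        have : (z.1, v z 0) - z = (0, v z 0 - z.2) := by ext <;> simp
        rw [this]
        simpa using hvC 0
      refine h3.trans ?_
      have : (K : ℝ) * ‖(z.1, v z 0) - z‖ ≤ K * (C * ε) := by gcongr
      nlinarith [mul_pos hC hε0]
    · intro t ht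
      rw [(φ).right_inv (hg.mem_U t ht)]
      have h3 : ‖∫ s in (0 : ℝ)..t, (v z s - z.2)‖ ≤ C * ε :=
        norm_integral_le_of_le ht fun s => hvC s
      rw [intervalIntegral.integral_sub (hg.continuous.intervalIntegrable _ _) (by simp)] at h3
      have h4 : curve ε z.1 (v z) t - (z.1 + (ε * t) • z.2) =
          ε • ((∫ s in (0 : ℝ)..t, v z s) - ∫ s in (0 : ℝ)..t, z.2) := by
        simp only [curve, intervalIntegral.integral_const, sub_zero]
        module
      rw [h4, norm_smul, Real.norm_of_nonneg hε0.le]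
      have h5 : ε * ‖(∫ s in (0 : ℝ)..t, v z s) - ∫ s in (0 : ℝ)..t, z.2‖ ≤ ε * (C * ε) := by
        gcongr
      have : 0 ≤ C * (K : ℝ) * ε ^ 2 := by positivity
      nlinarith
    · intro h
      simp only [hκ0 h]
    · intro h
      simp only [curve, hκ1 h]

end FinslerSpacetime

/-! ### Convexity of timecones and quadraticity from interpolation -/

namespace IsLorentzMinkowski

variable {n : ℕ} {f : 𝔼 n → ℝ} {X : 𝔼 n}

/-- The timelike vectors in the component of `X`. -/
def timecone (f : 𝔼 n → ℝ) (X : 𝔼 n) : Set (𝔼 n) :=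
  {v | f v < 0} ∩ connectedComponentIn (closure {v | f v < 0} \ {0}) X

theorem timecone_eq {u : 𝔼 n} (hu : u ∈ timecone f X) : timecone f X = timecone f u := by
  rw [timecone, timecone, connectedComponentIn_eq hu.2]

theorem self_mem_timecone (hf : IsLorentzMinkowski f) {u : 𝔼 n} (hu : f u < 0) :
    u ∈ timecone f u :=
  ⟨hu, mem_connectedComponentIn ⟨subset_closure hu, hf.ne_zero_of_neg hu⟩⟩

theorem mem_timecone_of_segment (hf : IsLorentzMinkowski f) {u v : 𝔼 n} (hu : u ∈ timecone f X)
    (h : ∀ s ∈ Icc (0 : ℝ) 1, f (u + s • (v - u)) < 0) : v ∈ timecone f X := by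
  rw [timecone_eq hu]
  refine ⟨?_, hf.cone_of_segment h⟩
  simpa using h 1 (by simp)

theorem smul_mem_timecone (hf : IsLorentzMinkowski f) {v : 𝔼 n} (hv : v ∈ timecone f X) {c : ℝ}
    (hc : 0 < c) : c • v ∈ timecone f X := by
  refine hf.mem_timecone_of_segment hv fun s hs => ?_
  have h1 : v + s • (c • v - v) = (1 - s + s * c) • v := by module
  have h2 : 0 < 1 - s + s * c := by
    rcases hs.1.eq_or_lt with rfl | h
    · simp
    · nlinarith [hs.2, mul_pos h hc]
  rw [h1, hf.homogeneous _ _ h2]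
  exact mul_neg_of_pos_of_neg (by positivity) hv.1

theorem segment_timecone (hf : IsLorentzMinkowski f) {u v : 𝔼 n} (hu : u ∈ timecone f X)
    (hv : v ∈ timecone f X) : ∀ s ∈ Icc (0 : ℝ) 1, f (u + s • (v - u)) < 0 := by
  rw [timecone_eq hu] at hv
  obtain ⟨h0, h1, h2⟩ := hf.mem_cone hu.1 hv.2
  intro s hs
  rcases hs.2.eq_or_lt with rfl | h
  · simpa using hv.1
  · exact hf.segment_neg hu.1 h0 h1.le h2 s ⟨hs.1, h⟩

theorem add_mem_timecone (hf : IsLorentzMinkowski f) {u v : 𝔼 n} (hu : u ∈ timecone f X)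
    (hv : v ∈ timecone f X) : u + v ∈ timecone f X := by
  have h1 : (1 / 2 : ℝ) • (u + v) ∈ timecone f X := by
    refine hf.mem_timecone_of_segment hu fun s hs => ?_
    have := hf.segment_timecone hu hv (s / 2) ⟨by linarith [hs.1], by linarith [hs.2]⟩
    convert this using 2
    module
  have h2 := hf.smul_mem_timecone h1 (c := 2) (by norm_num)
  simpa [smul_smul] using h2

/-- The reverse Cauchy–Schwarz inequality at `u + v`, applied to `u` and to `v` and added. By
Euler's identity the right-hand sides sum to `F(u + v)²`, where `F = √(-2f)`. -/
theorem sqrt_add_lt (hf : IsLorentzMinkowski f) {u v : 𝔼 n} (hu : u ∈ timecone f X)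
    (hv : v ∈ timecone f X) (hi : LinearIndependent ℝ ![u, v]) :
    Real.sqrt (-2 * f u) + Real.sqrt (-2 * f v) < Real.sqrt (-2 * f (u + v)) := by
  have huv := hf.add_mem_timecone hu hv
  have hi1 : LinearIndependent ℝ ![u + v, u] := by
    rw [LinearIndependent.pair_iff] at hi ⊢
    intro a b hab
    obtain ⟨h1, h2⟩ := hi (a + b) a (by rw [← hab]; module)
    exact ⟨h2, by linarith⟩
  have hi2 : LinearIndependent ℝ ![u + v, v] := by
    rw [LinearIndependent.pair_iff] at hi ⊢
    intro a b hab
    obtain ⟨h1, h2⟩ := hi a (a + b) (by rw [← hab]; module)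
    exact ⟨h1, by linarith⟩
  have h1 := hf.sqrt_lt_of_segment huv.1 hi1 fun s hs => (hf.segment_timecone huv hu s hs).le
  have h2 := hf.sqrt_lt_of_segment huv.1 hi2 fun s hs => (hf.segment_timecone huv hv s hs).le
  have h3 := hf.fderiv_self (hf.ne_zero_of_neg huv.1)
  rw [map_add] at h3
  have h0 : 0 < -2 * f (u + v) := by linarith [show f (u + v) < 0 from huv.1]
  have h4 := Real.sqrt_pos.2 h0
  have h5 := Real.mul_self_sqrt h0.le
  nlinarith

/-- If `f` lies, for all `v, w` in a timecone, on one fixed side of the quadratic interpolation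
of its values at `v`, `w` and `v + w`, then `f` is quadratic on the timecone. -/
theorem hessian_eq_of_interpolation (hf : IsLorentzMinkowski f) {σ : ℝ} (hσ : σ ≠ 0)
    (h : ∀ v ∈ timecone f X, ∀ w ∈ timecone f X, LinearIndependent ℝ ![v, w] →
      ∀ α ∈ Ioo (0 : ℝ) 1,
        0 ≤ σ * (f (α • v + w) - (α ^ 2 * f v + f w + α * (f (v + w) - f v - f w)))) :
    ∀ v ∈ timecone f X, ∀ w ∈ timecone f X, fderiv ℝ (fderiv ℝ f) v w w = 2 * f w := by
  -- The difference has a fixed sign for `α < 1` and vanishes at `α = 1`, so its left derivative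
  -- there has the opposite sign.
  have key : ∀ v ∈ timecone f X, ∀ w ∈ timecone f X, LinearIndependent ℝ ![v, w] →
      σ * (fderiv ℝ f (v + w) v - (f v + f (v + w) - f w)) ≤ 0 := by
    intro v hv w hw hi
    have h0 : w + (1 : ℝ) • v ≠ 0 := by
      rw [one_smul, add_comm]
      exact hf.ne_zero_of_neg (hf.add_mem_timecone hv hw).1
    have h1 := hf.hasDerivAt_line h0
    have h2 : HasDerivAt (fun α : ℝ => α ^ 2 * f v + f w + α * (f (v + w) - f v - f w))
        (2 * f v + (f (v + w) - f v - f w)) 1 := by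
      have := (((hasDerivAt_pow 2 (1 : ℝ)).mul_const (f v)).add_const (f w)).add
        ((hasDerivAt_id (1 : ℝ)).mul_const (f (v + w) - f v - f w))
      exact this.congr_deriv (by simp)
    have h3 := (h1.sub h2).const_mul σ
    have h4 := h3.tendsto_slope.mono_left
      (nhdsWithin_mono (1 : ℝ) (show Iio (1 : ℝ) ⊆ {1}ᶜ from fun x hx => ne_of_lt hx))
    have h5 : (fun α : ℝ => σ * (f (w + α • v) - (α ^ 2 * f v + f w + α * (f (v + w) - f v - f w))))
        1 = 0 := by
      simp only [one_smul, add_comm w v]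
      ring
    have h6 := le_of_tendsto h4 (by
      filter_upwards [Ioo_mem_nhdsLT (zero_lt_one' ℝ)] with α hα
      rw [slope_def_field]
      simp only [Pi.sub_apply]
      have h7 := h v hv w hw hi α hα
      simp only [add_comm (α • v)] at h7
      simp only [one_smul, add_comm w v] at h5 ⊢
      rw [h5, sub_zero]
      simp only [add_comm w] at h7 ⊢
      exact div_nonpos_of_nonneg_of_nonpos h7 (by linarith [hα.2]))
    rw [one_smul, add_comm w v] at h6
    rwa [show 2 * f v + (f (v + w) - f v - f w) = f v + f (v + w) - f w by ring] at h6
  -- Exchanging `v` and `w` gives two nonpositive numbers whose sum is zero by Euler's identity at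
  -- `v + w`.
  have key2 : ∀ v ∈ timecone f X, ∀ w ∈ timecone f X, LinearIndependent ℝ ![v, w] →
      fderiv ℝ f (v + w) v = f v + f (v + w) - f w := by
    intro v hv w hw hi
    have h1 := key v hv w hw hi
    have h2 := key w hw v hv (LinearIndependent.pair_symm_iff.1 hi)
    have h3 := hf.fderiv_self (hf.ne_zero_of_neg (hf.add_mem_timecone hv hw).1)
    rw [map_add] at h3
    rw [add_comm w v] at h2
    have h4 : σ * (fderiv ℝ f (v + w) v - (f v + f (v + w) - f w)) +
        σ * (fderiv ℝ f (v + w) w - (f w + f (v + w) - f v)) = 0 := by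
      rw [← mul_add, show fderiv ℝ f (v + w) v - (f v + f (v + w) - f w) +
        (fderiv ℝ f (v + w) w - (f w + f (v + w) - f v)) = 0 by linarith, mul_zero]
    have h5 : σ * (fderiv ℝ f (v + w) v - (f v + f (v + w) - f w)) = 0 := by linarith
    have := (mul_eq_zero.1 h5).resolve_left hσ
    linarith
  intro u hu v hv
  have hu0 := hf.ne_zero_of_neg hu.1
  by_cases hi : LinearIndependent ℝ ![v, u]
  · have h0 : u + (0 : ℝ) • (-v) ≠ 0 := by simpa using hu0
    have hcont : ContinuousAt (fun s : ℝ => f (u + s • (-v))) 0 := (hf.hasDerivAt_line h0).continuousAt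
    obtain ⟨r, hr, hb⟩ := Metric.eventually_nhds_iff_ball.1
      (hcont.eventually (gt_mem_nhds (show f (u + (0 : ℝ) • (-v)) < 0 by simpa using hu.1)))
    have hmem : ∀ δ ∈ Ioo 0 r, u + δ • (-v) ∈ timecone f X := by
      intro δ hδ
      refine hf.mem_timecone_of_segment hu fun s hs => ?_
      have := hb (s * δ) (by
        rw [mem_ball_zero_iff, Real.norm_of_nonneg (mul_nonneg hs.1 hδ.1.le)]
        nlinarith [hs.1, hs.2, hδ.1, hδ.2])
      rwa [show u + s • (u + δ • (-v) - u) = u + (s * δ) • (-v) by module]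
    -- The identity for `δ • v` and `u - δ • v`, whose sum is `u`, makes `f` a quadratic polynomial
    -- along this line for small positive `δ`. One-sided derivatives at `0` then suffice.
    have hval : ∀ δ ∈ Ioo 0 r, f (u + δ • (-v)) = f u - δ * fderiv ℝ f u v + δ ^ 2 * f v := by
      intro δ hδ
      have h1 := key2 (δ • v) (hf.smul_mem_timecone hv hδ.1) (u + δ • (-v)) (hmem δ hδ) (by
        rw [LinearIndependent.pair_iff] at hi ⊢
        intro a b hab
        obtain ⟨h1, h2⟩ := hi (a * δ - b * δ) b (by rw [← hab]; module)
        subst h2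
        exact ⟨by simpa [hδ.1.ne'] using h1, rfl⟩)
      rw [show δ • v + (u + δ • (-v)) = u by module, map_smul, smul_eq_mul,
        hf.homogeneous _ _ hδ.1] at h1
      linarith
    have hder : ∀ δ ∈ Ioo 0 r, fderiv ℝ f (u + δ • (-v)) v = fderiv ℝ f u v - 2 * δ * f v := by
      intro δ hδ
      have h1 := hf.hasDerivAt_line (hf.ne_zero_of_neg (hmem δ hδ).1)
      have h2 : HasDerivAt (fun δ : ℝ => f u - δ * fderiv ℝ f u v + δ ^ 2 * f v)
          (-fderiv ℝ f u v + 2 * δ * f v) δ := by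
        have := (((hasDerivAt_id δ).mul_const (fderiv ℝ f u v)).const_sub (f u)).add
          ((hasDerivAt_pow 2 δ).mul_const (f v))
        exact this.congr_deriv (by simp)
      have h3 := h1.unique (h2.congr_of_eventuallyEq (by
        filter_upwards [isOpen_Ioo.mem_nhds hδ] with x hx using hval x hx))
      rw [map_neg] at h3
      linarith
    have h1 := (hf.hasDerivAt_fderiv_line v h0).hasDerivWithinAt (s := Ioi 0)
    have h2 : HasDerivWithinAt (fun δ : ℝ => fderiv ℝ f u v - 2 * δ * f v) (-(2 * f v)) (Ioi 0) 0 := by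
      have := ((((hasDerivAt_id (0 : ℝ)).const_mul 2).mul_const (f v)).const_sub
        (fderiv ℝ f u v)).hasDerivWithinAt (s := Ioi 0)
      simpa using this
    have h3 := h2.congr_of_eventuallyEq (f₁ := fun s : ℝ => fderiv ℝ f (u + s • (-v)) v) (by
      filter_upwards [Ioo_mem_nhdsGT hr] with δ hδ using hder δ hδ) (by simp)
    have h4 := (uniqueDiffWithinAt_Ioi (0 : ℝ)).eq_deriv _ h1 h3
    rw [zero_smul, add_zero, map_neg] at h4
    have h5 := neg_injective h4
    exact h5
  · have hv0 := hf.ne_zero_of_neg hv.1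
    rw [LinearIndependent.pair_iff' hv0] at hi
    push Not at hi
    obtain ⟨c, rfl⟩ := hi
    -- A negative multiple is impossible: the convex timecone would contain `u + (-c) • v = 0`.
    rcases lt_trichotomy c 0 with hc | rfl | hc
    · have h1 := hf.add_mem_timecone hu (hf.smul_mem_timecone hv (neg_pos.2 hc))
      rw [← add_smul, add_neg_cancel, zero_smul] at h1
      exact absurd rfl (hf.ne_zero_of_neg h1.1)
    · simp at hu0
    · have h1 := congrArg (fun T : 𝔼 n →L[ℝ] ℝ => T v) (hf.fderiv_fderiv_self hu0)
      simp only [map_smul, smul_apply, hf.fderiv_smul hv0 hc, hf.fderiv_self hv0, smul_eq_mul] at h1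
      exact mul_left_cancel₀ hc.ne' h1

end IsLorentzMinkowski

/-! ### Causality of the model planes near the origin -/

namespace FinslerSpacetime

open IsLorentzMinkowski

section

variable {n : ℕ} {M : Type*} [TopologicalSpace M] [ChartedSpace (𝔼 n) M] [IsManifold (𝓡 n) ∞ M]
  (S : FinslerSpacetime n M) (x₀ : M)

theorem futureTimelike_eq_timecone :
    S.futureTimelike x₀ = timecone (fun v : 𝔼 n => S.L ⟨x₀, v⟩) (S.X x₀) := rfl

theorem mem_inChart_cone_self (v : 𝔼 n) :
    v ∈ (S.inChart x₀).cone (extChartAt (𝓡 n) x₀ x₀) ↔ v ∈ (S.futureCausal x₀ : Set (𝔼 n)) := by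
  rw [S.mem_inChart_cone (mem_extChartAt_target x₀), frame_self, extChartAt_to_inv]
  rfl

end

theorem model_L_zero (k : ℝ) (v : 𝔼 2) :
    (model k).L ⟨0, v⟩ = (1 / 2) * (-(v 0 ^ 2) + v 1 ^ 2) := by
  change modelQ k 0 v = _
  simp [modelQ, modelA, modelB]

theorem mem_futureTimelike_model {k : ℝ} {v : 𝔼 2} (h : |v 1| < v 0) :
    v ∈ (model k).futureTimelike (0 : 𝔼 2) := by
  have hf := (model k).isLorentzMinkowski (0 : 𝔼 2)
  rw [futureTimelike_eq_timecone]
  refine hf.mem_timecone_of_segment (hf.self_mem_timecone ((model k).timelike_X 0)) fun s hs => ?_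
  have hX : (model k).X (0 : 𝔼 2) = EuclideanSpace.single (0 : Fin 2) (1 : ℝ) := rfl
  rw [hX, model_L_zero]
  have e0 : (EuclideanSpace.single (0 : Fin 2) (1 : ℝ) +
      s • (v - EuclideanSpace.single (0 : Fin 2) (1 : ℝ)) : 𝔼 2) 0 = 1 - s + s * v 0 := by
    simp
    ring
  have e1 : (EuclideanSpace.single (0 : Fin 2) (1 : ℝ) +
      s • (v - EuclideanSpace.single (0 : Fin 2) (1 : ℝ)) : 𝔼 2) 1 = s * v 1 := by
    simp
  rw [e0, e1]
  have h1 : |s * v 1| < 1 - s + s * v 0 := by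
    rw [abs_mul, abs_of_nonneg hs.1]
    rcases hs.1.eq_or_lt with rfl | h'
    · simp
    · nlinarith [hs.2, mul_lt_mul_of_pos_left h h']
  have h2 := sq_lt_sq' (by linarith [neg_abs_le (s * v 1), abs_nonneg (s * v 1)])
    ((le_abs_self _).trans_lt h1)
  nlinarith [sq_abs (s * v 1)]

/-- Causal vectors of the model plane lie between the two null directions. -/
theorem abs_le_of_mem_futureCausal_model {k : ℝ} {p v : 𝔼 2} (hv : v ∈ (model k).futureCausal p) :
    |v 1| / Real.cosh (Real.sqrt (-k) * p 1) ≤ v 0 := by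
  have hf := (model k).isLorentzMinkowski p
  obtain ⟨-, h1, h2⟩ := hf.mem_cone ((model k).timelike_X p) hv
  have hc := Real.cosh_pos (Real.sqrt (-k) * p 1)
  have hA := modelA_pos k p
  have h3 : (1 / 2) * (-(modelA k p * v 0 ^ 2) + modelB k p * v 1 ^ 2) ≤ 0 := by
    have h3 := h2 1 (by simp)
    have h4 : ∀ X : 𝔼 2, X + (1 : ℝ) • (v - X) = v := fun X => by
      rw [one_smul, add_sub_cancel]
    replace h4 := h4 ((model k).X p)
    exact (congrArg (fun w : 𝔼 2 => (model k).L ⟨p, w⟩) h4).symm.trans_le h3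
  have h4 : 0 < v 0 := by
    have h5 := fundamentalTensor_modelL k p (EuclideanSpace.single 0 1) (EuclideanSpace.single 0 1) v
    have h6 := congrArg (fun T : 𝔼 2 →L[ℝ] ℝ => T v)
      (hf.fderiv_fderiv_self (hf.ne_zero_of_neg ((model k).timelike_X p)))
    have h7 : fundamentalTensor (modelL k) p (EuclideanSpace.single 0 1)
        (EuclideanSpace.single 0 1) v < 0 := h6.trans_lt h1
    rw [h5] at h7
    simp at h7
    exact (mul_pos_iff_of_pos_left hA).1 h7
  have hB : 1 ≤ modelB k p := one_le_pow₀ (Real.one_le_cosh _)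
  rw [div_le_iff₀ hc]
  refine abs_le_of_sq_le_sq ?_ (by positivity)
  have : modelA k p * v 0 ^ 2 = (v 0 * Real.cosh (Real.sqrt (-k) * p 1)) ^ 2 := by
    rw [modelA]; ring
  nlinarith [sq_nonneg (v 1)]

/-- With `H' = 1 / cosh (√(-k) x¹)`, the functions `x⁰ ± H(x¹)` are nondecreasing along causal
curves. A causal curve is therefore trapped in the box that these two functions cut out between its
endpoints. -/
theorem model_locallyCausalAt (k : ℝ) : (model k).LocallyCausalAt (0 : 𝔼 2) := by
  set h : ℝ → ℝ := fun y => (Real.cosh (Real.sqrt (-k) * y))⁻¹ with hh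
  have hpos : ∀ y, 0 < h y := fun y => inv_pos.2 (Real.cosh_pos _)
  have hcont : Continuous h := by
    have : Continuous fun y => Real.cosh (Real.sqrt (-k) * y) :=
      Real.continuous_cosh.comp (continuous_const.mul continuous_id)
    exact this.inv₀ fun y => (Real.cosh_pos _).ne'
  set H : ℝ → ℝ := fun x => ∫ y in (0 : ℝ)..x, h y with hH
  have hd : ∀ x, HasDerivAt H (h x) x := fun x => (hcont.integral_hasStrictDerivAt 0 x).hasDerivAt
  have hmono : StrictMono H := strictMono_of_hasDerivAt_pos hd hpos
  have H0 : H 0 = 0 := by simp [hH]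
  have hHc : Continuous H := continuous_iff_continuousAt.2 fun x => (hd x).continuousAt
  have key : ∀ (c : ℝ → 𝔼 2) (y z : 𝔼 2), (model k).IsCausalCurve c y z → ∀ σ : ℝ, |σ| = 1 →
      MonotoneOn (fun t => c t 0 + σ * H (c t 1)) (Icc 0 1) := by
    intro c y z hc σ hσ
    have hcd : ContDiffOn ℝ 1 c (Icc 0 1) := contMDiffOn_iff_contDiffOn.1 hc.contMDiffOn
    have hci : ∀ i, ContDiffOn ℝ 1 (fun t => c t i) (Icc 0 1) := fun i =>
      (EuclideanSpace.proj i : 𝔼 2 →L[ℝ] ℝ).contDiff.comp_contDiffOn hcd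
    refine monotoneOn_of_deriv_nonneg (convex_Icc 0 1) ?_ ?_ ?_
    · exact (hci 0).continuousOn.add
        (continuousOn_const.mul (hHc.comp_continuousOn (hci 1).continuousOn))
    · intro t ht
      rw [interior_Icc] at ht
      have h1 : ∀ i, DifferentiableAt ℝ (fun t => c t i) t := fun i =>
        ((hci i).differentiableOn (by simp)).differentiableAt (Icc_mem_nhds ht.1 ht.2)
      exact ((h1 0).add (((hd (c t 1)).comp t (h1 1).hasDerivAt).differentiableAt.const_mul
        σ)).differentiableWithinAt
    · intro t ht
      rw [interior_Icc] at ht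
      have h1 : HasDerivAt c (derivWithin c (Icc 0 1) t) t := by
        have := (hcd.differentiableOn (by simp)).hasDerivAt (Icc_mem_nhds ht.1 ht.2)
        rwa [← derivWithin_of_mem_nhds (Icc_mem_nhds ht.1 ht.2)] at this
      have h2 : ∀ i, HasDerivAt (fun t => c t i) (derivWithin c (Icc 0 1) t i) t := fun i =>
        (EuclideanSpace.proj i : 𝔼 2 →L[ℝ] ℝ).hasFDerivAt.comp_hasDerivAt t h1
      have h3 := (h2 0).add (((hd (c t 1)).comp t (h2 1)).const_mul σ)
      rw [HasDerivAt.deriv (f := fun t => c t 0 + σ * H (c t 1)) h3]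
      have h4 := hc.velocity_mem t (Ioo_subset_Icc_self ht)
      have h5 : (velocity c t : 𝔼 2) = derivWithin c (Icc 0 1) t := by
        rw [velocity, mfderivWithin_eq_fderivWithin]
        rfl
      rw [h5] at h4
      have h6 := abs_le_of_mem_futureCausal_model h4
      rw [div_eq_inv_mul] at h6
      change h (c t 1) * |derivWithin c (Icc 0 1) t 1| ≤ _ at h6
      have h7 : |σ * (h (c t 1) * derivWithin c (Icc 0 1) t 1)| ≤ derivWithin c (Icc 0 1) t 0 := by
        rwa [abs_mul, hσ, one_mul, abs_mul, abs_of_pos (hpos _)]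
      have := (abs_le.1 h7).1
      linarith [neg_abs_le (σ * (h (c t 1) * derivWithin c (Icc 0 1) t 1))]
  intro W hW
  obtain ⟨r, hr, hrW⟩ : ∃ r > 0, ∀ p : 𝔼 2, |p 0| < r → |p 1| < r → p ∈ W := by
    obtain ⟨r, hr, hb⟩ := Metric.mem_nhds_iff.1 hW
    refine ⟨r / 2, by positivity, fun p h0 h1 => hb ?_⟩
    rw [mem_ball_zero_iff, EuclideanSpace.norm_eq, Real.sqrt_lt' hr]
    simp only [Fin.sum_univ_two, Real.norm_eq_abs]
    nlinarith [abs_nonneg (p 0), abs_nonneg (p 1)]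
  have hHr : 0 < H r := by rw [← H0]; exact hmono hr
  have hHr' : 0 < -H (-r) := by
    have := hmono (neg_lt_zero.2 hr)
    linarith
  set δ := min r (min (H r) (-H (-r))) with hδ
  have hδ0 : 0 < δ := by positivity
  have hV : ∀ σ : ℝ, Continuous fun p : 𝔼 2 => p 0 + σ * H (p 1) := fun σ => by fun_prop
  refine ⟨{p | |p 0 + 1 * H (p 1)| < δ} ∩ {p | |p 0 + (-1) * H (p 1)| < δ},
    inter_mem ?_ ?_, ?_⟩
  · exact (isOpen_lt (hV 1).abs continuous_const).mem_nhds (by simpa [H0] using hδ0)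
  · exact (isOpen_lt (hV (-1)).abs continuous_const).mem_nhds (by simpa [H0] using hδ0)
  · intro c y z hc hy hz t ht
    have h1 : ∀ σ : ℝ, |σ| = 1 → |y 0 + σ * H (y 1)| < δ → |z 0 + σ * H (z 1)| < δ →
        |c t 0 + σ * H (c t 1)| < δ := by
      intro σ hσ h1 h2
      have h3 := key c y z hc σ hσ (left_mem_Icc.2 zero_le_one) ht ht.1
      have h4 := key c y z hc σ hσ ht (right_mem_Icc.2 zero_le_one) ht.2
      simp only [hc.source, hc.target] at h3 h4
      exact abs_lt.2 ⟨(abs_lt.1 h1).1.trans_le h3, h4.trans_lt (abs_lt.1 h2).2⟩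
    have h2 := abs_lt.1 (h1 1 (by simp) hy.1 hz.1)
    have h3 := abs_lt.1 (h1 (-1) (by simp) hy.2 hz.2)
    have e1 : δ ≤ r := min_le_left _ _
    have e2 : δ ≤ H r := (min_le_right _ _).trans (min_le_left _ _)
    have e3 : δ ≤ -H (-r) := (min_le_right _ _).trans (min_le_right _ _)
    refine hrW _ (abs_lt.2 ⟨by linarith, by linarith⟩) (abs_lt.2 ⟨?_, ?_⟩)
    · exact hmono.lt_iff_lt.1 (by linarith)
    · exact hmono.lt_iff_lt.1 (by linarith)

end FinslerSpacetime

/-! ### Families of short geodesics and their rescaled limits -/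

namespace FinslerSpacetime

variable {n : ℕ} {M : Type*} [TopologicalSpace M] [ChartedSpace (𝔼 n) M] [IsManifold (𝓡 n) ∞ M]
  (S : FinslerSpacetime n M) {x₀ : M}

/-- The chart at `x₀`. -/
local notation "φ" => extChartAt (𝓡 n) x₀

variable (x₀) in
/-- Short maximizing geodesics near `x₀`, depending continuously on the initial point and on the
initial velocity (`κ = 0`) or the displacement (`κ = 1`), divided by the scale `ε`. -/
structure GeodesicFamily (κ : ℝ) (u₀ : 𝔼 n) where
  C : ℝ
  δ : ℝ
  δ_pos : 0 < δ
  ε₀ : ℝ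
  ε₀_pos : 0 < ε₀
  c : ℝ → 𝔼 n × 𝔼 n → ℝ → M
  m : ℝ → 𝔼 n × 𝔼 n → ℝ
  continuousOn_c : ∀ ε ∈ Ioo 0 ε₀, ∀ t ∈ Icc (0 : ℝ) 1,
    ContinuousOn (fun z => (φ) (c ε z t)) (Metric.ball ((φ) x₀, u₀) δ)
  continuousOn_m : ∀ ε ∈ Ioo 0 ε₀, ContinuousOn (m ε) (Metric.ball ((φ) x₀, u₀) δ)
  isShortGeodesic : ∀ ε ∈ Ioo 0 ε₀, ∀ z ∈ Metric.ball ((φ) x₀, u₀) δ,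
    S.IsShortGeodesic x₀ C ε z (c ε z) (m ε z)
  m_eq : κ = 0 → ∀ ε ∈ Ioo 0 ε₀, ∀ z ∈ Metric.ball ((φ) x₀, u₀) δ, m ε z = (S.inChart x₀).F z
  target_eq : κ = 1 → ∀ ε ∈ Ioo 0 ε₀, ∀ z ∈ Metric.ball ((φ) x₀, u₀) δ,
    c ε z 1 = (φ).symm (z.1 + ε • z.2)

variable {S}

theorem LocallyCausalAt.nonempty_geodesicFamily (hS : S.LocallyCausalAt x₀) {u₀ : 𝔼 n}
    (hu : u₀ ∈ S.futureTimelike x₀) {κ : ℝ} (hκ : κ ∈ Icc (0 : ℝ) 1) :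
    Nonempty (S.GeodesicFamily x₀ κ u₀) := by
  obtain ⟨C, -, δ, hδ, ε₀, hε₀, h⟩ := exists_isShortGeodesic hS
    (u₀ := u₀) (by rw [S.inChart_L_self]; exact hu.1)
    ((S.mem_inChart_cone_self x₀ u₀).2 hu.2) hκ
  have : Nonempty M := ⟨x₀⟩
  choose! c m h1 h2 h3 using h
  exact ⟨⟨C, δ, hδ, ε₀, hε₀, c, m, h1, h2, fun ε hε z hz => (h3 ε hε z hz).1,
    fun h0 ε hε z hz => (h3 ε hε z hz).2.1 h0, fun h0 ε hε z hz => (h3 ε hε z hz).2.2 h0⟩⟩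

namespace GeodesicFamily

variable {κ : ℝ} {u₀ : 𝔼 n} (g : S.GeodesicFamily x₀ κ u₀) {ι : Type*} {G : Filter ι} {ε : ι → ℝ}
  {z : ι → 𝔼 n × 𝔼 n} {z₁ : 𝔼 n × 𝔼 n}

theorem eventually_mem (hε : Tendsto ε G (𝓝[>] 0)) (hz : Tendsto z G (𝓝 z₁))
    (hz₁ : z₁ ∈ Metric.ball ((φ) x₀, u₀) g.δ) :
    ∀ᶠ i in G, ε i ∈ Ioo 0 g.ε₀ ∧ z i ∈ Metric.ball ((φ) x₀, u₀) g.δ :=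
  (hε.eventually (Ioo_mem_nhdsGT g.ε₀_pos)).and (hz.eventually (Metric.isOpen_ball.mem_nhds hz₁))

theorem mem_ball_self : ((φ) x₀, u₀) ∈ Metric.ball ((φ) x₀, u₀) g.δ :=
  Metric.mem_ball_self g.δ_pos

/-- The error `C ε` is uniform in the data, so base point and vector may vary together with `ε`, as
they do for the sides and chords of shrinking triangles. -/
theorem tendsto_m (hε : Tendsto ε G (𝓝[>] 0)) (hz : Tendsto z G (𝓝 z₁))
    (hz₁ : z₁ ∈ Metric.ball ((φ) x₀, u₀) g.δ) (hF : ContinuousAt (S.inChart x₀).F z₁) :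
    Tendsto (fun i => g.m (ε i) (z i)) G (𝓝 ((S.inChart x₀).F z₁)) := by
  have h1 : Tendsto (fun i => (S.inChart x₀).F (z i)) G (𝓝 ((S.inChart x₀).F z₁)) :=
    hF.tendsto.comp hz
  have h2 : Tendsto (fun i => g.C * ε i) G (𝓝 0) := by
    simpa using (tendsto_nhds_of_tendsto_nhdsWithin hε).const_mul g.C
  have h3 : Tendsto (fun i => g.m (ε i) (z i) - (S.inChart x₀).F (z i)) G (𝓝 0) := by
    refine squeeze_zero_norm' ?_ h2
    filter_upwards [g.eventually_mem hε hz hz₁] with i hi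
    exact (g.isShortGeodesic _ hi.1 _ hi.2).abs_sub_le
  simpa using h3.add h1

theorem tendsto_displacement (hε : Tendsto ε G (𝓝[>] 0)) (hz : Tendsto z G (𝓝 z₁))
    (hz₁ : z₁ ∈ Metric.ball ((φ) x₀, u₀) g.δ) {t : ℝ} (ht : t ∈ Icc (0 : ℝ) 1) :
    Tendsto (fun i => (ε i)⁻¹ • ((φ) (g.c (ε i) (z i) t) - (z i).1)) G (𝓝 (t • z₁.2)) := by
  have h1 : Tendsto (fun i => t • (z i).2) G (𝓝 (t • z₁.2)) :=
    ((continuous_snd.tendsto z₁).comp hz).const_smul t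
  have h2 : Tendsto (fun i => g.C * ε i) G (𝓝 0) := by
    simpa using (tendsto_nhds_of_tendsto_nhdsWithin hε).const_mul g.C
  have h3 : Tendsto (fun i => (ε i)⁻¹ • ((φ) (g.c (ε i) (z i) t) - (z i).1) - t • (z i).2) G
      (𝓝 0) := by
    refine squeeze_zero_norm' ?_ h2
    filter_upwards [g.eventually_mem hε hz hz₁] with i hi
    have h4 := (g.isShortGeodesic _ hi.1 _ hi.2).norm_sub_le t ht
    have hε0 : 0 < ε i := hi.1.1
    have h5 : (ε i)⁻¹ • ((φ) (g.c (ε i) (z i) t) - (z i).1) - t • (z i).2 =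
        (ε i)⁻¹ • ((φ) (g.c (ε i) (z i) t) - ((z i).1 + (ε i * t) • (z i).2)) := by
      rw [← sub_sub, smul_sub (ε i)⁻¹ _ ((ε i * t) • (z i).2), smul_smul, ← mul_assoc,
        inv_mul_cancel₀ hε0.ne', one_mul]
    rw [h5, norm_smul, norm_inv, Real.norm_of_nonneg hε0.le, inv_mul_le_iff₀ hε0]
    linarith
  simpa using h3.add h1

theorem tendsto_c (hε : Tendsto ε G (𝓝[>] 0)) (hz : Tendsto z G (𝓝 z₁))
    (hz₁ : z₁ ∈ Metric.ball ((φ) x₀, u₀) g.δ) {t : ℝ} (ht : t ∈ Icc (0 : ℝ) 1) :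
    Tendsto (fun i => (φ) (g.c (ε i) (z i) t)) G (𝓝 z₁.1) := by
  have h1 := g.tendsto_displacement hε hz hz₁ ht
  have h2 := ((tendsto_nhds_of_tendsto_nhdsWithin hε).smul h1).add
    ((continuous_fst.tendsto z₁).comp hz)
  rw [zero_smul, zero_add] at h2
  refine h2.congr' ?_
  filter_upwards [g.eventually_mem hε hz hz₁] with i hi
  have hε0 : 0 < ε i := hi.1.1
  simp [smul_smul, hε0.ne']

end GeodesicFamily

theorem continuousAt_F_chart {z : 𝔼 n × 𝔼 n} (hz : z.1 ∈ (φ).target)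
    (h : (S.inChart x₀).L z < 0) : ContinuousAt (S.inChart x₀).F z :=
  (LorentzFinslerDomain.contDiffAt_F (S := S.inChart x₀) hz h).continuousAt

theorem inChart_F_self (v : 𝔼 n) : (S.inChart x₀).F ((φ) x₀, v) = Real.sqrt (-2 * S.L ⟨x₀, v⟩) := by
  rw [LorentzFinslerDomain.F, S.inChart_L_self]

end FinslerSpacetime

/-! ### Small comparison triangles with prescribed sides -/

namespace FinslerSpacetime

/-- The vector of the Minkowski plane of length `r` and rapidity `θ`. -/
def hyperbolicVector (q : ℝ × ℝ) : 𝔼 2 :=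
  (q.1 * Real.cosh q.2) • EuclideanSpace.single 0 1 +
    (q.1 * Real.sinh q.2) • EuclideanSpace.single 1 1

theorem continuous_hyperbolicVector : Continuous hyperbolicVector := by
  have h1 : Continuous fun q : ℝ × ℝ => Real.cosh q.2 := Real.continuous_cosh.comp continuous_snd
  have h2 : Continuous fun q : ℝ × ℝ => Real.sinh q.2 := Real.continuous_sinh.comp continuous_snd
  unfold hyperbolicVector
  fun_prop

theorem hyperbolicVector_zero (q : ℝ × ℝ) : hyperbolicVector q 0 = q.1 * Real.cosh q.2 := by
  simp [hyperbolicVector]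

theorem hyperbolicVector_one (q : ℝ × ℝ) : hyperbolicVector q 1 = q.1 * Real.sinh q.2 := by
  simp [hyperbolicVector]

theorem sqrt_model_L_zero (k : ℝ) (v : 𝔼 2) :
    Real.sqrt (-2 * (model k).L ⟨0, v⟩) = Real.sqrt (v 0 ^ 2 - v 1 ^ 2) := by
  rw [model_L_zero]
  congr 1
  ring

theorem model_F_hyperbolicVector (k : ℝ) {r : ℝ} (hr : 0 < r) (θ : ℝ) :
    Real.sqrt (-2 * (model k).L ⟨0, hyperbolicVector (r, θ)⟩) = r := by
  rw [sqrt_model_L_zero, hyperbolicVector_zero, hyperbolicVector_one,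
    show (r * Real.cosh θ) ^ 2 - (r * Real.sinh θ) ^ 2 =
      r ^ 2 * (Real.cosh θ ^ 2 - Real.sinh θ ^ 2) by ring, Real.cosh_sq_sub_sinh_sq, mul_one,
    Real.sqrt_sq hr.le]

/-- The hyperbolic law of cosines: the length of the third side is governed by the rapidity `θ`. -/
theorem sq_sub_sq_hyperbolicVector (a c θ : ℝ) :
    (hyperbolicVector (c, θ) - hyperbolicVector (a, 0)) 0 ^ 2 -
      (hyperbolicVector (c, θ) - hyperbolicVector (a, 0)) 1 ^ 2 =
      c ^ 2 + a ^ 2 - 2 * a * c * Real.cosh θ := by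
  simp only [PiLp.sub_apply, hyperbolicVector_zero, hyperbolicVector_one, Real.cosh_zero,
    Real.sinh_zero]
  nlinarith [Real.cosh_sq_sub_sinh_sq θ]

theorem hyperbolicVector_mem {k r : ℝ} (hr : 0 < r) (θ : ℝ) :
    hyperbolicVector (r, θ) ∈ (model k).futureTimelike (0 : 𝔼 2) := by
  refine mem_futureTimelike_model ?_
  rw [hyperbolicVector_zero, hyperbolicVector_one, abs_mul, abs_of_pos hr]
  refine mul_lt_mul_of_pos_left (abs_lt_of_sq_lt_sq ?_ (Real.cosh_pos _).le) hr
  linarith [Real.cosh_sq_sub_sinh_sq θ]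

theorem hyperbolicVector_sub_mem {k a c θ : ℝ} (ha : 0 < a) (hac : a < c)
    (h : 0 < c ^ 2 + a ^ 2 - 2 * a * c * Real.cosh θ) :
    hyperbolicVector (c, θ) - hyperbolicVector (a, 0) ∈ (model k).futureTimelike (0 : 𝔼 2) := by
  refine mem_futureTimelike_model (abs_lt_of_sq_lt_sq ?_ ?_)
  · linarith [sq_sub_sq_hyperbolicVector a c θ]
  · simp only [PiLp.sub_apply, hyperbolicVector_zero, Real.cosh_zero]
    nlinarith [Real.one_le_cosh θ]

/-- The chart of the model plane at the origin. -/
local notation "φ'" => extChartAt (𝓡 2) (0 : 𝔼 2)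

/-- The law of cosines in the model plane, in the limit of small triangles: there are small
triangles with prescribed side lengths that converge, after rescaling, to a Minkowski triangle. -/
theorem neBot_model_triangles {k a₀ b₀ c₀ θ₀ : ℝ} (ha₀ : 0 < a₀) (hb₀ : 0 < b₀)
    (hac : a₀ < c₀) (hθ₀ : 0 < θ₀)
    (hcos : c₀ ^ 2 + a₀ ^ 2 - 2 * a₀ * c₀ * Real.cosh θ₀ = b₀ ^ 2) {a b c : ℝ → ℝ}
    (ha : Tendsto a (𝓝[>] 0) (𝓝 a₀)) (hb : Tendsto b (𝓝[>] 0) (𝓝 b₀))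
    (hc : Tendsto c (𝓝[>] 0) (𝓝 c₀))
    (h₁ : (model k).GeodesicFamily (0 : 𝔼 2) 0 (hyperbolicVector (a₀, 0)))
    (h₃ : (model k).GeodesicFamily (0 : 𝔼 2) 0 (hyperbolicVector (c₀, θ₀)))
    (h₂ : (model k).GeodesicFamily (0 : 𝔼 2) 1
      (hyperbolicVector (c₀, θ₀) - hyperbolicVector (a₀, 0)))
    {y : ℝ → 𝔼 2} (hy : ∀ ε, y ε = (φ') (h₁.c ε ((φ') 0, hyperbolicVector (a ε, 0)) 1))
    {z : ℝ × ℝ → 𝔼 2}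
    (hz : ∀ q, z q = (φ') (h₃.c q.1 ((φ') 0, hyperbolicVector (c q.1, q.2)) 1)) :
    NeBot ((𝓝[>] 0 ×ˢ 𝓝 θ₀) ⊓
      𝓟 {q : ℝ × ℝ | h₂.m q.1 (y q.1, q.1⁻¹ • (z q - y q.1)) = b q.1}) := by
  have hc₀ : 0 < c₀ := ha₀.trans hac
  set Φ : ℝ → ℝ := fun θ => c₀ ^ 2 + a₀ ^ 2 - 2 * a₀ * c₀ * Real.cosh θ with hΦ
  have hΦc : Continuous Φ := by
    have := Real.continuous_cosh
    fun_prop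
  set T : Set ℝ := {θ | ((φ') 0, hyperbolicVector (c₀, θ)) ∈
      Metric.ball ((φ') (0 : 𝔼 2), hyperbolicVector (c₀, θ₀)) h₃.δ ∧
    ((φ') 0, hyperbolicVector (c₀, θ) - hyperbolicVector (a₀, 0)) ∈ Metric.ball
      ((φ') (0 : 𝔼 2), hyperbolicVector (c₀, θ₀) - hyperbolicVector (a₀, 0)) h₂.δ ∧
    0 < Φ θ ∧ 0 < θ} with hT
  have hv : Continuous fun θ : ℝ => hyperbolicVector (c₀, θ) :=
    continuous_hyperbolicVector.comp (by fun_prop)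
  have hTo : IsOpen T := by
    refine (Metric.isOpen_ball.preimage ?_).inter ((Metric.isOpen_ball.preimage ?_).inter
      ((isOpen_lt continuous_const hΦc).inter (isOpen_lt continuous_const continuous_id)))
    · fun_prop
    · fun_prop
  have hTθ : θ₀ ∈ T := ⟨h₃.mem_ball_self, h₂.mem_ball_self, by
    change 0 < c₀ ^ 2 + a₀ ^ 2 - 2 * a₀ * c₀ * Real.cosh θ₀
    rw [hcos]
    positivity, hθ₀⟩
  -- Two sides are issued from the origin with exact lengths `ε a` and `ε c` and rapidities `0` and
  -- `θ`. Their rescaled endpoints converge to the corresponding Minkowski vectors, jointly in `ε`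
  -- and `θ`.
  have key : ∀ θ ∈ T, Tendsto (fun q : ℝ × ℝ => (y q.1, q.1⁻¹ • (z q - y q.1)))
        (𝓝[>] 0 ×ˢ 𝓝 θ) (𝓝 ((φ') 0, hyperbolicVector (c₀, θ) - hyperbolicVector (a₀, 0))) ∧
      Tendsto (fun q : ℝ × ℝ => ((φ') (0 : 𝔼 2), hyperbolicVector (c q.1, q.2)))
        (𝓝[>] 0 ×ˢ 𝓝 θ) (𝓝 ((φ') 0, hyperbolicVector (c₀, θ))) := by
    intro θ hθ
    have e1 : Tendsto (fun q : ℝ × ℝ => q.1) (𝓝[>] 0 ×ˢ 𝓝 θ) (𝓝[>] 0) := tendsto_fst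
    have e2 : Tendsto (fun q : ℝ × ℝ => ((φ') (0 : 𝔼 2), hyperbolicVector (a q.1, 0)))
        (𝓝[>] 0 ×ˢ 𝓝 θ) (𝓝 ((φ') 0, hyperbolicVector (a₀, 0))) :=
      tendsto_const_nhds.prodMk_nhds ((continuous_hyperbolicVector.tendsto (a₀, 0)).comp
        ((ha.comp e1).prodMk_nhds tendsto_const_nhds))
    have e3 : Tendsto (fun q : ℝ × ℝ => ((φ') (0 : 𝔼 2), hyperbolicVector (c q.1, q.2)))
        (𝓝[>] 0 ×ˢ 𝓝 θ) (𝓝 ((φ') 0, hyperbolicVector (c₀, θ))) :=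
      tendsto_const_nhds.prodMk_nhds ((continuous_hyperbolicVector.tendsto (c₀, θ)).comp
        ((hc.comp e1).prodMk_nhds tendsto_snd))
    have f1 := h₁.tendsto_displacement e1 e2 h₁.mem_ball_self (t := 1) (by simp)
    have f3 := h₃.tendsto_displacement e1 e3 hθ.1 (t := 1) (by simp)
    have f4 := h₁.tendsto_c e1 e2 h₁.mem_ball_self (t := 1) (by simp)
    simp only [← hy, ← hz, one_smul] at f1 f3 f4
    refine ⟨f4.prodMk_nhds ((f3.sub f1).congr fun q => ?_), e3⟩
    rw [← smul_sub, sub_sub_sub_cancel_right]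
  have key2 : ∀ θ ∈ T, Tendsto (fun ε => h₂.m ε (y ε, ε⁻¹ • (z (ε, θ) - y ε))) (𝓝[>] 0)
      (𝓝 (Real.sqrt (Φ θ))) := by
    intro θ hθ
    have e1 : Tendsto (fun ε : ℝ => (ε, θ)) (𝓝[>] 0) (𝓝[>] 0 ×ˢ 𝓝 θ) :=
      tendsto_id.prodMk tendsto_const_nhds
    have hF : (model k).L ⟨0, hyperbolicVector (c₀, θ) - hyperbolicVector (a₀, 0)⟩ < 0 :=
      (hyperbolicVector_sub_mem ha₀ hac hθ.2.2.1).1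
    have e2 := h₂.tendsto_m tendsto_id ((key θ hθ).1.comp e1) hθ.2.1
      (continuousAt_F_chart (mem_extChartAt_target (I := 𝓡 2) (0 : 𝔼 2))
        (by rw [inChart_L_self]; exact hF))
    rw [inChart_F_self, sqrt_model_L_zero, sq_sub_sq_hyperbolicVector] at e2
    exact e2
  -- Every neighbourhood must contain a pair `(ε, θ)` for which the third side is exact. The limit
  -- length `√Φ` decreases strictly through `b₀` at `θ₀`, so for small `ε` the actual length lies
  -- above `b ε` at `θ₀ - r` and below it at `θ₀ + r`, and the intermediate value theorem applies.
  rw [inf_principal_neBot_iff]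
  intro N hN
  obtain ⟨A, hA, B, hB, hAB⟩ := mem_prod_iff.1 hN
  obtain ⟨r, hr, hrb⟩ := Metric.nhds_basis_closedBall.mem_iff.1 (inter_mem hB (hTo.mem_nhds hTθ))
  rw [Real.closedBall_eq_Icc] at hrb
  have hlm : θ₀ - r ∈ Icc (θ₀ - r) (θ₀ + r) := ⟨le_rfl, by linarith⟩
  have hrm : θ₀ + r ∈ Icc (θ₀ - r) (θ₀ + r) := ⟨by linarith, le_rfl⟩
  have hmono : ∀ θ θ', 0 < θ → θ < θ' → Φ θ' < Φ θ := by
    intro θ θ' h h'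
    have : Real.cosh θ < Real.cosh θ' := by
      rw [Real.cosh_lt_cosh, abs_of_pos h, abs_of_pos (h.trans h')]
      exact h'
    have := mul_lt_mul_of_pos_left this (show 0 < 2 * a₀ * c₀ by positivity)
    simp only [hΦ]
    linarith
  have hb₀' : b₀ = Real.sqrt (Φ θ₀) := by
    change b₀ = Real.sqrt (c₀ ^ 2 + a₀ ^ 2 - 2 * a₀ * c₀ * Real.cosh θ₀)
    rw [hcos, Real.sqrt_sq hb₀.le]
  have hl : b₀ < Real.sqrt (Φ (θ₀ - r)) := by
    rw [hb₀']
    exact Real.sqrt_lt_sqrt hTθ.2.2.1.le (hmono _ _ (hrb hlm).2.2.2.2 (by linarith))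
  have hr' : Real.sqrt (Φ (θ₀ + r)) < b₀ := by
    rw [hb₀']
    exact Real.sqrt_lt_sqrt (hrb hrm).2.2.2.1.le (hmono _ _ hθ₀ (by linarith))
  -- For one fixed `ε` the geodesics must be defined for all `θ` in the interval; compactness makes
  -- the pointwise statements uniform.
  have hunif : ∀ᶠ ε in 𝓝[>] (0 : ℝ), ∀ θ ∈ Icc (θ₀ - r) (θ₀ + r),
      (ε ∈ Ioo 0 h₂.ε₀ ∧ (y ε, ε⁻¹ • (z (ε, θ) - y ε)) ∈ Metric.ball
        ((φ') (0 : 𝔼 2), hyperbolicVector (c₀, θ₀) - hyperbolicVector (a₀, 0)) h₂.δ) ∧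
      (ε ∈ Ioo 0 h₃.ε₀ ∧ ((φ') (0 : 𝔼 2), hyperbolicVector (c ε, θ)) ∈
        Metric.ball ((φ') (0 : 𝔼 2), hyperbolicVector (c₀, θ₀)) h₃.δ) := by
    have h := (isCompact_Icc (a := θ₀ - r) (b := θ₀ + r)).mem_prod_nhdsSet_of_forall
      (l := 𝓝[>] (0 : ℝ)) (s := {q : ℝ × ℝ | (q.1 ∈ Ioo 0 h₂.ε₀ ∧
        (y q.1, q.1⁻¹ • (z q - y q.1)) ∈ Metric.ball
        ((φ') (0 : 𝔼 2), hyperbolicVector (c₀, θ₀) - hyperbolicVector (a₀, 0)) h₂.δ) ∧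
      (q.1 ∈ Ioo 0 h₃.ε₀ ∧ ((φ') (0 : 𝔼 2), hyperbolicVector (c q.1, q.2)) ∈
        Metric.ball ((φ') (0 : 𝔼 2), hyperbolicVector (c₀, θ₀)) h₃.δ)}) fun θ hθ => by
          have hθT := (hrb hθ).2
          exact (h₂.eventually_mem tendsto_fst (key θ hθT).1 hθT.2.1).and
            (h₃.eventually_mem tendsto_fst (key θ hθT).2 hθT.1)
    have h' : ∀ᶠ q : ℝ × ℝ in 𝓝[>] (0 : ℝ) ×ˢ 𝓝ˢ (Icc (θ₀ - r) (θ₀ + r)), _ := h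
    exact h'.curry.mono fun ε h => h.self_of_nhdsSet
  obtain ⟨ε, hεA, hε, hε1, hε2⟩ := ((show ∀ᶠ ε in 𝓝[>] (0 : ℝ), ε ∈ A from hA).and (hunif.and
    ((hb.eventually_lt (key2 _ (hrb hlm).2) hl).and
      ((key2 _ (hrb hrm).2).eventually_lt hb hr')))).exists
  have hzc : ContinuousOn (fun θ => z (ε, θ)) (Icc (θ₀ - r) (θ₀ + r)) := by
    simp only [hz]
    refine (h₃.continuousOn_c ε (hε _ hlm).2.1 1 (by simp)).comp
      (f := fun θ => ((φ') (0 : 𝔼 2), hyperbolicVector (c ε, θ))) ?_ fun θ hθ => (hε θ hθ).2.2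
    exact (continuous_const.prodMk
      (continuous_hyperbolicVector.comp (by fun_prop))).continuousOn
  have hzc' : ContinuousOn (fun θ => ε⁻¹ • (z (ε, θ) - y ε)) (Icc (θ₀ - r) (θ₀ + r)) :=
    (hzc.sub continuousOn_const).const_smul ε⁻¹
  have hmc : ContinuousOn (fun θ => h₂.m ε (y ε, ε⁻¹ • (z (ε, θ) - y ε)))
      (Icc (θ₀ - r) (θ₀ + r)) :=
    (h₂.continuousOn_m ε (hε _ hlm).1.1).comp
      (continuousOn_const.prodMk hzc')
      fun θ hθ => (hε θ hθ).1.2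
  obtain ⟨θ, hθ, hθm⟩ := intermediate_value_Icc' (by linarith) hmc ⟨hε2.le, hε1.le⟩
  exact ⟨(ε, θ), hAB ⟨hεA, (hrb hθ).1⟩, hθm⟩

end FinslerSpacetime

/-! ### The infinitesimal triangle comparison -/

namespace FinslerSpacetime

variable {n : ℕ} {M : Type*} [TopologicalSpace M] [ChartedSpace (𝔼 n) M] [IsManifold (𝓡 n) ∞ M]
  {S : FinslerSpacetime n M} {x₀ : M}

/-- The chart at `x₀`. -/
local notation "φ" => extChartAt (𝓡 n) x₀

/-- The chart of the model plane at the origin. -/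
local notation "φ'" => extChartAt (𝓡 2) (0 : 𝔼 2)

/-- Polarization in the Minkowski plane: after the law of cosines the right-hand side depends only
on `α` and the three squared side lengths, and can be compared with `L` on the original tangent
space. -/
theorem sq_sub_sq_combination (a c θ α : ℝ) :
    ((1 / 2 : ℝ) • (α • hyperbolicVector (a, 0) +
      (hyperbolicVector (c, θ) - hyperbolicVector (a, 0)))) 0 ^ 2 -
    ((1 / 2 : ℝ) • (α • hyperbolicVector (a, 0) +
      (hyperbolicVector (c, θ) - hyperbolicVector (a, 0)))) 1 ^ 2 =
      (1 / 4) * (α ^ 2 * a ^ 2 + (c ^ 2 + a ^ 2 - 2 * a * c * Real.cosh θ) +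
        α * (c ^ 2 - a ^ 2 - (c ^ 2 + a ^ 2 - 2 * a * c * Real.cosh θ))) := by
  simp only [PiLp.sub_apply, PiLp.add_apply, PiLp.smul_apply, smul_eq_mul, hyperbolicVector_zero,
    hyperbolicVector_one, Real.cosh_zero, Real.sinh_zero]
  have h := Real.cosh_sq_sub_sinh_sq θ
  linear_combination (1 / 4) * c ^ 2 * h

theorem IsShortGeodesic.l_source_target {C ε m : ℝ} {z : 𝔼 n × 𝔼 n} {c : ℝ → M}
    (h : S.IsShortGeodesic x₀ C ε z c m) : S.l (c 0) (c 1) = ((ε * m : ℝ) : EReal) := by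
  simpa using h.l_eq 0 1 le_rfl zero_lt_one le_rfl

/-- Nearby points with timelike displacement are joined by a short maximizing geodesic. -/
theorem GeodesicFamily.chord {u₀ : 𝔼 n} (g : S.GeodesicFamily x₀ 1 u₀) {ε : ℝ}
    (hε : ε ∈ Ioo 0 g.ε₀) {p q : M} (hp : p ∈ (φ).source) (hq : q ∈ (φ).source)
    (hz : ((φ) p, ε⁻¹ • ((φ) q - (φ) p)) ∈ Metric.ball ((φ) x₀, u₀) g.δ) :
    S.Chron p q ∧ S.IsMaximizing (g.c ε ((φ) p, ε⁻¹ • ((φ) q - (φ) p))) p q ∧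
      S.l p q = ((ε * g.m ε ((φ) p, ε⁻¹ • ((φ) q - (φ) p)) : ℝ) : EReal) := by
  have h := g.isShortGeodesic ε hε _ hz
  have h1 := h.source
  have h2 := g.target_eq rfl ε hε _ hz
  have hε0 : ε ≠ 0 := hε.1.ne'
  simp only [smul_smul, mul_inv_cancel₀ hε0, one_smul, add_sub_cancel] at h2
  rw [(φ).left_inv hp] at h1
  rw [(φ).left_inv hq] at h2
  have h3 := h.chron
  have h4 := h.maximizing
  have h5 := h.l_source_target
  rw [h1, h2] at h3 h4 h5
  exact ⟨h3, h4, h5⟩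

/-- Points with the same parameter on short geodesics of the same length correspond. -/
theorem IsShortGeodesic.corresponding {k C C' ε m : ℝ} {z : 𝔼 n × 𝔼 n} {z' : 𝔼 2 × 𝔼 2}
    {c : ℝ → M} {c' : ℝ → 𝔼 2} (h : S.IsShortGeodesic x₀ C ε z c m)
    (h' : (model k).IsShortGeodesic (0 : 𝔼 2) C' ε z' c' m) {t : ℝ} (ht : t ∈ Ioo (0 : ℝ) 1) :
    S.Corresponding k (c 0) (c 1) c (c' 0) (c' 1) c' (c t) (c' t) :=
  ⟨⟨t, Ioo_subset_Icc_self ht, rfl⟩, ⟨t, Ioo_subset_Icc_self ht, rfl⟩,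
    (h'.l_eq 0 t le_rfl ht.1 ht.2.le).trans (h.l_eq 0 t le_rfl ht.1 ht.2.le).symm,
    (h'.l_eq t 1 ht.1.le ht.2 le_rfl).trans (h.l_eq t 1 ht.1.le ht.2 le_rfl).symm⟩

set_option maxHeartbeats 1000000 in
/-- The infinitesimal triangle comparison: rescaled distances of corresponding points in small
triangles converge to lengths of corresponding vectors in the tangent spaces. -/
theorem exists_comparison (k : ℝ) (hS : S.LocallyCausalAt x₀) {U : Set M} (hU : U ∈ 𝓝 x₀)
    {v w : 𝔼 n} (hv : v ∈ S.futureTimelike x₀) (hw : w ∈ S.futureTimelike x₀)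
    (hi : LinearIndependent ℝ ![v, w]) {α : ℝ} (hα : α ∈ Ioo (0 : ℝ) 1) {τ : ℝ} (hτ : 0 < τ) :
    ∃ ε > 0, ∃ d d' : ℝ,
      |d - Real.sqrt (-2 * S.L ⟨x₀, (1 / 2 : ℝ) • (α • v + w)⟩)| < τ ∧
      |d' - Real.sqrt ((1 / 4) * (-2 * (α ^ 2 * S.L ⟨x₀, v⟩ + S.L ⟨x₀, w⟩ +
        α * (S.L ⟨x₀, v + w⟩ - S.L ⟨x₀, v⟩ - S.L ⟨x₀, w⟩))))| < τ ∧
      ∀ R : EReal → EReal → Prop, S.TriangleComparisonOn k R U →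
        R ((ε * d : ℝ) : EReal) ((ε * d' : ℝ) : EReal) := by
  have hf := S.isLorentzMinkowski x₀
  have hvw : v + w ∈ S.futureTimelike x₀ := hf.add_mem_timecone hv hw
  have hαv : (1 / 2 : ℝ) • (α • v + w) ∈ S.futureTimelike x₀ :=
    hf.smul_mem_timecone (hf.add_mem_timecone (hf.smul_mem_timecone hv hα.1) hw) (by norm_num)
  have hlt := hf.sqrt_add_lt hv hw hi
  set a₀ := Real.sqrt (-2 * S.L ⟨x₀, v⟩) with ha₀
  set b₀ := Real.sqrt (-2 * S.L ⟨x₀, w⟩) with hb₀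
  set c₀ := Real.sqrt (-2 * S.L ⟨x₀, v + w⟩) with hc₀
  have hsq : ∀ u : 𝔼 n, u ∈ S.futureTimelike x₀ → 0 < Real.sqrt (-2 * S.L ⟨x₀, u⟩) ∧
      Real.sqrt (-2 * S.L ⟨x₀, u⟩) ^ 2 = -2 * S.L ⟨x₀, u⟩ := fun u hu => by
    have : 0 < -2 * S.L ⟨x₀, u⟩ := by linarith [show S.L ⟨x₀, u⟩ < 0 from hu.1]
    exact ⟨Real.sqrt_pos.2 this, Real.sq_sqrt this.le⟩
  obtain ⟨ha, ha2⟩ := hsq v hv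
  obtain ⟨hb, hb2⟩ := hsq w hw
  obtain ⟨hc, hc2⟩ := hsq (v + w) hvw
  rw [← ha₀] at ha ha2
  rw [← hb₀] at hb hb2
  rw [← hc₀] at hc hc2
  have hac : a₀ < c₀ := by linarith
  -- The strict inequality `a₀ + b₀ < c₀` makes the required value of `cosh θ₀` larger than `1`.
  obtain ⟨θ₀, hθ₀, hcos⟩ : ∃ θ₀ : ℝ, 0 < θ₀ ∧
      c₀ ^ 2 + a₀ ^ 2 - 2 * a₀ * c₀ * Real.cosh θ₀ = b₀ ^ 2 := by
    have h1 : 1 < (c₀ ^ 2 + a₀ ^ 2 - b₀ ^ 2) / (2 * a₀ * c₀) := by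
      rw [one_lt_div (by positivity)]
      nlinarith
    refine ⟨Real.arcosh _, Real.arcosh_pos h1, ?_⟩
    rw [Real.cosh_arcosh h1.le]
    field_simp
    ring
  have hv' := hyperbolicVector_mem (k := k) ha 0
  have hu' := hyperbolicVector_mem (k := k) hc θ₀
  have hw' := hyperbolicVector_sub_mem (k := k) ha hac (θ := θ₀) (by rw [hcos]; positivity)
  have hf' := (model k).isLorentzMinkowski (0 : 𝔼 2)
  have hαv' : (1 / 2 : ℝ) • (α • hyperbolicVector (a₀, 0) +
      (hyperbolicVector (c₀, θ₀) - hyperbolicVector (a₀, 0))) ∈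
        (model k).futureTimelike (0 : 𝔼 2) :=
    hf'.smul_mem_timecone (hf'.add_mem_timecone (hf'.smul_mem_timecone hv' hα.1) hw') (by norm_num)
  have h0 : (0 : ℝ) ∈ Icc (0 : ℝ) 1 := by simp
  have h1 : (1 : ℝ) ∈ Icc (0 : ℝ) 1 := by simp
  obtain ⟨g₁⟩ := hS.nonempty_geodesicFamily hv h1
  obtain ⟨g₂⟩ := hS.nonempty_geodesicFamily hw h1
  obtain ⟨g₃⟩ := hS.nonempty_geodesicFamily hvw h1
  obtain ⟨g₄⟩ := hS.nonempty_geodesicFamily hαv h1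
  have hS' := model_locallyCausalAt k
  obtain ⟨h₁⟩ := hS'.nonempty_geodesicFamily hv' h0
  obtain ⟨h₂⟩ := hS'.nonempty_geodesicFamily hw' h1
  obtain ⟨h₃⟩ := hS'.nonempty_geodesicFamily hu' h0
  obtain ⟨h₄⟩ := hS'.nonempty_geodesicFamily hαv' h1
  have hF : ∀ u : 𝔼 n, u ∈ S.futureTimelike x₀ →
      ContinuousAt (S.inChart x₀).F ((φ) x₀, u) := fun u hu =>
    continuousAt_F_chart (mem_extChartAt_target (I := 𝓡 n) x₀) (by rw [inChart_L_self]; exact hu.1)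
  have hF' : ∀ u : 𝔼 2, u ∈ (model k).futureTimelike (0 : 𝔼 2) →
      ContinuousAt ((model k).inChart (0 : 𝔼 2)).F ((φ') 0, u) := fun u hu =>
    continuousAt_F_chart (mem_extChartAt_target (I := 𝓡 2) (0 : 𝔼 2))
      (by rw [inChart_L_self]; exact hu.1)
  -- Rescaled side lengths of the triangle. The second side starts at the endpoint of the first,
  -- hence its moving base point.
  set a : ℝ → ℝ := fun ε => g₁.m ε ((φ) x₀, v) with hadef
  set b : ℝ → ℝ := fun ε => g₂.m ε ((φ) x₀ + ε • v, w) with hbdef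
  set c : ℝ → ℝ := fun ε => g₃.m ε ((φ) x₀, v + w) with hcdef
  have hεc : Tendsto (fun ε : ℝ => (φ) x₀ + ε • v) (𝓝[>] 0) (𝓝 ((φ) x₀)) := by
    have : Continuous fun ε : ℝ => (φ) x₀ + ε • v := by fun_prop
    simpa using (this.tendsto 0).mono_left (nhdsWithin_le_nhds (s := Ioi 0))
  have haT : Tendsto a (𝓝[>] 0) (𝓝 a₀) := by
    have := g₁.tendsto_m tendsto_id tendsto_const_nhds g₁.mem_ball_self (hF v hv)
    rwa [inChart_F_self] at this
  have hbz : Tendsto (fun ε : ℝ => ((φ) x₀ + ε • v, w)) (𝓝[>] 0) (𝓝 ((φ) x₀, w)) :=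
    hεc.prodMk_nhds tendsto_const_nhds
  have hbT : Tendsto b (𝓝[>] 0) (𝓝 b₀) := by
    have := g₂.tendsto_m tendsto_id hbz g₂.mem_ball_self (hF w hw)
    rwa [inChart_F_self] at this
  have hcT : Tendsto c (𝓝[>] 0) (𝓝 c₀) := by
    have := g₃.tendsto_m tendsto_id tendsto_const_nhds g₃.mem_ball_self (hF (v + w) hvw)
    rwa [inChart_F_self] at this
  set y : ℝ → 𝔼 2 := fun ε => (φ') (h₁.c ε ((φ') 0, hyperbolicVector (a ε, 0)) 1) with hy
  set z : ℝ × ℝ → 𝔼 2 :=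
    fun q => (φ') (h₃.c q.1 ((φ') 0, hyperbolicVector (c q.1, q.2)) 1) with hz
  have hG := neBot_model_triangles ha hb hac hθ₀ hcos haT hbT hcT h₁ h₃ h₂ (y := y)
    (fun ε => rfl) (z := z) (fun q => rfl)
  set G := (𝓝[>] 0 ×ˢ 𝓝 θ₀) ⊓
      𝓟 {q : ℝ × ℝ | h₂.m q.1 (y q.1, q.1⁻¹ • (z q - y q.1)) = b q.1} with hGdef
  have hG1 : Tendsto (fun q : ℝ × ℝ => q.1) G (𝓝[>] 0) := tendsto_fst.mono_left inf_le_left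
  have hG2 : Tendsto (fun q : ℝ × ℝ => q.2) G (𝓝 θ₀) := tendsto_snd.mono_left inf_le_left
  have hGb : ∀ᶠ q in G, h₂.m q.1 (y q.1, q.1⁻¹ • (z q - y q.1)) = b q.1 :=
    mem_inf_of_right (mem_principal_self _)
  -- Chosen so that the midpoint of the long side minus the point at `ρ` on the first side has
  -- rescaled displacement `(v + w) / 2 - ρ v = (αv + w) / 2` in the limit.
  set ρ : ℝ := (1 - α) / 2 with hρ
  have hρ0 : 0 < ρ := by linarith [hα.2]
  have hρ1 : ρ < 1 := by linarith [hα.1]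
  have hρm : ρ ∈ Icc (0 : ℝ) 1 := ⟨hρ0.le, hρ1.le⟩
  have h2m : (1 / 2 : ℝ) ∈ Icc (0 : ℝ) 1 := by norm_num
  have z1 : Tendsto (fun _ : ℝ × ℝ => ((φ) x₀, v)) G (𝓝 ((φ) x₀, v)) := tendsto_const_nhds
  have z2 : Tendsto (fun q : ℝ × ℝ => ((φ) x₀ + q.1 • v, w)) G (𝓝 ((φ) x₀, w)) := hbz.comp hG1
  have z3 : Tendsto (fun _ : ℝ × ℝ => ((φ) x₀, v + w)) G (𝓝 ((φ) x₀, v + w)) := tendsto_const_nhds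
  have z1' : Tendsto (fun q : ℝ × ℝ => ((φ') (0 : 𝔼 2), hyperbolicVector (a q.1, 0))) G
      (𝓝 ((φ') 0, hyperbolicVector (a₀, 0))) :=
    tendsto_const_nhds.prodMk_nhds ((continuous_hyperbolicVector.tendsto (a₀, 0)).comp
      ((haT.comp hG1).prodMk_nhds tendsto_const_nhds))
  have z3' : Tendsto (fun q : ℝ × ℝ => ((φ') (0 : 𝔼 2), hyperbolicVector (c q.1, q.2))) G
      (𝓝 ((φ') 0, hyperbolicVector (c₀, θ₀))) :=
    tendsto_const_nhds.prodMk_nhds ((continuous_hyperbolicVector.tendsto (c₀, θ₀)).comp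
      ((hcT.comp hG1).prodMk_nhds hG2))
  have z2' : Tendsto (fun q : ℝ × ℝ => (y q.1, q.1⁻¹ • (z q - y q.1))) G
      (𝓝 ((φ') 0, hyperbolicVector (c₀, θ₀) - hyperbolicVector (a₀, 0))) := by
    have f1 := h₁.tendsto_displacement hG1 z1' h₁.mem_ball_self h1
    have f3 := h₃.tendsto_displacement hG1 z3' h₃.mem_ball_self h1
    have f4 := h₁.tendsto_c hG1 z1' h₁.mem_ball_self h1
    simp only [one_smul] at f1 f3
    refine f4.prodMk_nhds ((f3.sub f1).congr fun q => ?_)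
    rw [← smul_sub, sub_sub_sub_cancel_right]
  have z4 : Tendsto (fun q : ℝ × ℝ => ((φ) (g₁.c q.1 ((φ) x₀, v) ρ),
      q.1⁻¹ • ((φ) (g₃.c q.1 ((φ) x₀, v + w) (1 / 2)) - (φ) (g₁.c q.1 ((φ) x₀, v) ρ)))) G
      (𝓝 ((φ) x₀, (1 / 2 : ℝ) • (α • v + w))) := by
    have f1 := g₁.tendsto_displacement hG1 z1 g₁.mem_ball_self hρm
    have f3 := g₃.tendsto_displacement hG1 z3 g₃.mem_ball_self h2m
    have f4 := g₁.tendsto_c hG1 z1 g₁.mem_ball_self hρm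
    have e : (1 / 2 : ℝ) • (α • v + w) = (1 / 2 : ℝ) • (v + w) - ρ • v := by
      rw [hρ]; module
    rw [e]
    refine f4.prodMk_nhds ((f3.sub f1).congr fun q => ?_)
    rw [← smul_sub, sub_sub_sub_cancel_right]
  have z4' : Tendsto (fun q : ℝ × ℝ =>
      ((φ') (h₁.c q.1 ((φ') 0, hyperbolicVector (a q.1, 0)) ρ),
        q.1⁻¹ • ((φ') (h₃.c q.1 ((φ') 0, hyperbolicVector (c q.1, q.2)) (1 / 2)) -
          (φ') (h₁.c q.1 ((φ') 0, hyperbolicVector (a q.1, 0)) ρ)))) G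
      (𝓝 ((φ') 0, (1 / 2 : ℝ) • (α • hyperbolicVector (a₀, 0) +
        (hyperbolicVector (c₀, θ₀) - hyperbolicVector (a₀, 0))))) := by
    have f1 := h₁.tendsto_displacement hG1 z1' h₁.mem_ball_self hρm
    have f3 := h₃.tendsto_displacement hG1 z3' h₃.mem_ball_self h2m
    have f4 := h₁.tendsto_c hG1 z1' h₁.mem_ball_self hρm
    have e : (1 / 2 : ℝ) • (α • hyperbolicVector (a₀, 0) +
        (hyperbolicVector (c₀, θ₀) - hyperbolicVector (a₀, 0))) =
        (1 / 2 : ℝ) • hyperbolicVector (c₀, θ₀) - ρ • hyperbolicVector (a₀, 0) := by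
      rw [hρ]; module
    rw [e]
    refine f4.prodMk_nhds ((f3.sub f1).congr fun q => ?_)
    rw [← smul_sub, sub_sub_sub_cancel_right]
  have d4 := g₄.tendsto_m hG1 z4 g₄.mem_ball_self (hF _ hαv)
  have d4' := h₄.tendsto_m hG1 z4' h₄.mem_ball_self (hF' _ hαv')
  rw [inChart_F_self] at d4 d4'
  rw [sqrt_model_L_zero, sq_sub_sq_combination, hcos, ha2, hb2, hc2,
    show α ^ 2 * (-2 * S.L ⟨x₀, v⟩) + -2 * S.L ⟨x₀, w⟩ + α * (-2 * S.L ⟨x₀, v + w⟩ -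
      -2 * S.L ⟨x₀, v⟩ - -2 * S.L ⟨x₀, w⟩) = -2 * (α ^ 2 * S.L ⟨x₀, v⟩ + S.L ⟨x₀, w⟩ +
        α * (S.L ⟨x₀, v + w⟩ - S.L ⟨x₀, v⟩ - S.L ⟨x₀, w⟩)) by ring] at d4'
  have D4 := d4.eventually (Metric.ball_mem_nhds _ hτ)
  have D4' := d4'.eventually (Metric.ball_mem_nhds _ hτ)
  have hψ : Tendsto (φ).symm (𝓝 ((φ) x₀)) (𝓝 x₀) := by
    have := continuousAt_extChartAt_symm (I := 𝓡 n) x₀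
    rwa [ContinuousAt, extChartAt_to_inv] at this
  have hUu : ∀ u : 𝔼 n, ∀ᶠ q in G, (φ).symm ((φ) x₀ + q.1 • u) ∈ U := by
    intro u
    have h : Tendsto (fun ε : ℝ => (φ) x₀ + ε • u) (𝓝[>] 0) (𝓝 ((φ) x₀)) := by
      have : Continuous fun ε : ℝ => (φ) x₀ + ε • u := by fun_prop
      simpa using (this.tendsto 0).mono_left (nhdsWithin_le_nhds (s := Ioi 0))
    exact ((hψ.comp h).comp hG1).eventually hU
  -- In the limit the sides satisfy the strict reverse triangle inequality, so the degenerate case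
  -- is vacuous; for `k < 0` the diameter bound holds because the long side shrinks to zero.
  have hsize : ∀ᶠ q in G, SizeBounds k (q.1 * a q.1) (q.1 * b q.1) (q.1 * c q.1) := by
    have s0 : ∀ᶠ ε in 𝓝[>] (0 : ℝ), 0 < ε := self_mem_nhdsWithin
    have s1 := haT.eventually (lt_mem_nhds ha)
    have s2 := hbT.eventually (lt_mem_nhds hb)
    have s3 := (haT.add hbT).eventually_lt hcT hlt
    have s4 : Tendsto (fun ε => ε * c ε) (𝓝[>] 0) (𝓝 0) := by
      simpa using (tendsto_nhds_of_tendsto_nhdsWithin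
        (tendsto_id (α := ℝ) (x := 𝓝[>] (0 : ℝ)))).mul hcT
    have s5 : ∀ᶠ ε in 𝓝[>] (0 : ℝ), k < 0 → ε * c ε < Real.pi / Real.sqrt (-k) := by
      by_cases hk : k < 0
      · filter_upwards [s4.eventually (gt_mem_nhds
          (div_pos Real.pi_pos (Real.sqrt_pos.2 (neg_pos.2 hk))))] with ε h _ using h
      · exact Eventually.of_forall fun ε h => absurd h hk
    refine hG1.eventually (p := fun ε => SizeBounds k (ε * a ε) (ε * b ε) (ε * c ε)) ?_
    filter_upwards [s0, s1, s2, s3, s5] with ε t0 t1 t2 t3 t5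
    have t6 : ε * a ε + ε * b ε < ε * c ε := by
      rw [← mul_add]
      exact mul_lt_mul_of_pos_left t3 t0
    exact ⟨mul_pos t0 t1, mul_pos t0 t2, t6.le, fun h => absurd h t6.ne, fun _ => t5⟩
  obtain ⟨q, q1, q2, q3, q4, q1', q2', q3', q4', qb, qa0, qD, qD', qy, qz, qs⟩ :=
    ((g₁.eventually_mem hG1 z1 g₁.mem_ball_self).and <|
    (g₂.eventually_mem hG1 z2 g₂.mem_ball_self).and <|
    (g₃.eventually_mem hG1 z3 g₃.mem_ball_self).and <|
    (g₄.eventually_mem hG1 z4 g₄.mem_ball_self).and <|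
    (h₁.eventually_mem hG1 z1' h₁.mem_ball_self).and <|
    (h₂.eventually_mem hG1 z2' h₂.mem_ball_self).and <|
    (h₃.eventually_mem hG1 z3' h₃.mem_ball_self).and <|
    (h₄.eventually_mem hG1 z4' h₄.mem_ball_self).and <|
    hGb.and <| ((haT.comp hG1).eventually (lt_mem_nhds ha)).and <|
    D4.and <| D4'.and <| (hUu v).and <| (hUu (v + w)).and hsize).exists
  obtain ⟨ε, θ⟩ := q
  simp only at q1 q2 q3 q4 q1' q2' q3' q4' qb qa0 qD qD' qy qz qs
  replace qa0 : 0 < a ε := qa0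
  have hε : 0 < ε := q1.1.1
  have G1 := g₁.isShortGeodesic ε q1.1 _ q1.2
  have G2 := g₂.isShortGeodesic ε q2.1 _ q2.2
  have G3 := g₃.isShortGeodesic ε q3.1 _ q3.2
  have H1 := h₁.isShortGeodesic ε q1'.1 _ q1'.2
  have H3 := h₃.isShortGeodesic ε q3'.1 _ q3'.2
  have hcpos : 0 < c ε := by
    have := qs.1.trans_le ((le_add_of_nonneg_right qs.2.1.le).trans qs.2.2.1)
    exact (mul_pos_iff_of_pos_left hε).1 this
  -- Two model sides have exactly the required lengths because their initial velocities do (`κ =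
  -- 0`); the third one does by membership in `G`.
  rw [h₁.m_eq rfl ε q1'.1 _ q1'.2, inChart_F_self, model_F_hyperbolicVector k qa0] at H1
  rw [h₃.m_eq rfl ε q3'.1 _ q3'.2, inChart_F_self, model_F_hyperbolicVector k hcpos] at H3
  obtain ⟨-, -, e4⟩ := g₄.chord q4.1 (G1.mem_source ρ hρm) (G3.mem_source (1 / 2) h2m) q4.2
  obtain ⟨-, -, e4'⟩ := h₄.chord q4'.1 (H1.mem_source ρ hρm) (H3.mem_source (1 / 2) h2m) q4'.2
  obtain ⟨H2c, H2m, H2l⟩ := h₂.chord q2'.1 (H1.mem_source 1 h1) (H3.mem_source 1 h1) q2'.2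
  have x1 : g₁.c ε ((φ) x₀, v) 0 = x₀ := G1.source.trans (extChartAt_to_inv x₀)
  have x3 : g₃.c ε ((φ) x₀, v + w) 0 = x₀ := G3.source.trans (extChartAt_to_inv x₀)
  have y1 : g₁.c ε ((φ) x₀, v) 1 = (φ).symm ((φ) x₀ + ε • v) := g₁.target_eq rfl ε q1.1 _ q1.2
  have y2 : g₂.c ε ((φ) x₀ + ε • v, w) 0 = (φ).symm ((φ) x₀ + ε • v) := G2.source
  have z2 : g₂.c ε ((φ) x₀ + ε • v, w) 1 = (φ).symm ((φ) x₀ + ε • (v + w)) := by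
    rw [g₂.target_eq rfl ε q2.1 _ q2.2, smul_add, add_assoc]
  have z3 : g₃.c ε ((φ) x₀, v + w) 1 = (φ).symm ((φ) x₀ + ε • (v + w)) :=
    g₃.target_eq rfl ε q3.1 _ q3.2
  have x1' : h₁.c ε ((φ') 0, hyperbolicVector (a ε, 0)) 0 = 0 :=
    H1.source.trans (extChartAt_to_inv 0)
  have x3' : h₃.c ε ((φ') 0, hyperbolicVector (c ε, θ)) 0 = 0 :=
    H3.source.trans (extChartAt_to_inv 0)
  refine ⟨ε, hε, _, _, qD, qD', fun R hR => ?_⟩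
  rw [← e4, ← e4']
  have T1 := G1.corresponding H1 (t := ρ) ⟨hρ0, hρ1⟩
  have T3 := G3.corresponding H3 (t := 1 / 2) (by norm_num)
  have L1 := G1.l_source_target
  have L2 := G2.l_source_target
  have L3 := G3.l_source_target
  have L1' := H1.l_source_target
  have L3' := H3.l_source_target
  have tri : S.IsTriangle x₀ ((φ).symm ((φ) x₀ + ε • v)) ((φ).symm ((φ) x₀ + ε • (v + w)))
      (g₁.c ε ((φ) x₀, v)) (g₂.c ε ((φ) x₀ + ε • v, w)) (g₃.c ε ((φ) x₀, v + w)) := by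
    have c1 := G1.chron
    have c2 := G2.chron
    have m1 := G1.maximizing
    have m2 := G2.maximizing
    have m3 := G3.maximizing
    rw [x1, y1] at c1 m1
    rw [y2, z2] at c2 m2
    rw [x3, z3] at m3
    exact ⟨c1, c2, m1, m2, m3⟩
  have c1' := H1.chron
  have m1' := H1.maximizing
  have m3' := H3.maximizing
  rw [x1'] at c1' m1' L1'
  rw [x3'] at m3' L3'
  rw [x1, y1, x1'] at T1
  rw [x3, z3, x3'] at T3
  rw [x1, y1] at L1
  rw [y2, z2] at L2
  rw [x3, z3] at L3
  rw [qb] at H2l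
  exact hR x₀ (mem_of_mem_nhds hU) _ qy _ qz _ _ _ tri _ _ _ L1 L2 L3 qs _ _ _ _ _ _
    ⟨c1', H2c, m1', H2m, m3'⟩ L1' H2l L3' _ _ _ _ (Or.inl T1) (Or.inr (Or.inr T3))

end FinslerSpacetime

/-! ### Conclusion from either curvature bound -/

namespace FinslerSpacetime

variable {n : ℕ} {M : Type*} [TopologicalSpace M] [ChartedSpace (𝔼 n) M] [IsManifold (𝓡 n) ∞ M]
  {S : FinslerSpacetime n M} {x₀ : M}

theorem L_half_smul (u : 𝔼 n) : -2 * S.L ⟨x₀, (1 / 2 : ℝ) • u⟩ = (1 / 4) * (-2 * S.L ⟨x₀, u⟩) := by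
  have h : S.L ⟨x₀, (1 / 2 : ℝ) • u⟩ = (1 / 2) ^ 2 * S.L ⟨x₀, u⟩ :=
    S.homogeneous_L x₀ u (1 / 2) (by norm_num)
  rw [h]
  ring

theorem sqrt_L_half_pos {u : 𝔼 n} (hu : u ∈ S.futureTimelike x₀) :
    0 < Real.sqrt ((1 / 4) * (-2 * S.L ⟨x₀, u⟩)) :=
  Real.sqrt_pos.2 (by linarith [show S.L ⟨x₀, u⟩ < 0 from hu.1])

/-- The approximate comparison holds with arbitrary precision `τ`, so it passes to the limiting
lengths. Since `L` is negative on timelike vectors, the inequality `l ≤ l̄` becomes a lower bound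
for `L`, that is, the case `σ = 1`. -/
theorem hessian_eq_of_boundedBelow {k : ℝ} (hS : S.LocallyCausalAt x₀)
    (h : ∃ U ∈ 𝓝 x₀, S.TriangleComparisonOn k (· ≤ ·) U) :
    ∀ v ∈ S.futureTimelike x₀, ∀ w ∈ S.futureTimelike x₀, S.g x₀ v w w = 2 * S.L ⟨x₀, w⟩ := by
  obtain ⟨U, hU, hR⟩ := h
  have hf := S.isLorentzMinkowski x₀
  refine hf.hessian_eq_of_interpolation (σ := 1) one_ne_zero fun v hv w hw hi α hα => ?_
  have hmem : α • v + w ∈ S.futureTimelike x₀ :=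
    hf.add_mem_timecone (hf.smul_mem_timecone hv hα.1) hw
  have key : Real.sqrt ((1 / 4) * (-2 * S.L ⟨x₀, α • v + w⟩)) ≤
      Real.sqrt ((1 / 4) * (-2 * (α ^ 2 * S.L ⟨x₀, v⟩ + S.L ⟨x₀, w⟩ +
        α * (S.L ⟨x₀, v + w⟩ - S.L ⟨x₀, v⟩ - S.L ⟨x₀, w⟩)))) := by
    refine le_of_forall_pos_le_add fun τ hτ => ?_
    obtain ⟨ε, hε, d, d', hd, hd', hcomp⟩ := exists_comparison k hS hU hv hw hi hα (half_pos hτ)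
    have h1 : ε * d ≤ ε * d' := EReal.coe_le_coe_iff.1 (hcomp _ hR)
    have h2 := le_of_mul_le_mul_left h1 hε
    rw [L_half_smul] at hd
    linarith [(abs_lt.1 hd).1, (abs_lt.1 hd').2]
  -- `Real.sqrt` is `0` on negative numbers, so the radicand of the interpolated value is first
  -- shown to be positive before the roots are removed.
  have h3 := Real.sqrt_pos.1 ((sqrt_L_half_pos hmem).trans_le key)
  have h4 := (Real.sqrt_le_sqrt_iff h3.le).1 key
  linarith

theorem hessian_eq_of_boundedAbove {k : ℝ} (hS : S.LocallyCausalAt x₀)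
    (h : ∃ U ∈ 𝓝 x₀, S.TriangleComparisonOn k (· ≥ ·) U) :
    ∀ v ∈ S.futureTimelike x₀, ∀ w ∈ S.futureTimelike x₀, S.g x₀ v w w = 2 * S.L ⟨x₀, w⟩ := by
  obtain ⟨U, hU, hR⟩ := h
  have hf := S.isLorentzMinkowski x₀
  refine hf.hessian_eq_of_interpolation (σ := -1) (by norm_num) fun v hv w hw hi α hα => ?_
  have hmem : α • v + w ∈ S.futureTimelike x₀ :=
    hf.add_mem_timecone (hf.smul_mem_timecone hv hα.1) hw
  have key : Real.sqrt ((1 / 4) * (-2 * (α ^ 2 * S.L ⟨x₀, v⟩ + S.L ⟨x₀, w⟩ +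
        α * (S.L ⟨x₀, v + w⟩ - S.L ⟨x₀, v⟩ - S.L ⟨x₀, w⟩)))) ≤
      Real.sqrt ((1 / 4) * (-2 * S.L ⟨x₀, α • v + w⟩)) := by
    refine le_of_forall_pos_le_add fun τ hτ => ?_
    obtain ⟨ε, hε, d, d', hd, hd', hcomp⟩ := exists_comparison k hS hU hv hw hi hα (half_pos hτ)
    have h1 : ε * d' ≤ ε * d := EReal.coe_le_coe_iff.1 (hcomp _ hR)
    have h2 := le_of_mul_le_mul_left h1 hε
    rw [L_half_smul] at hd
    linarith [(abs_lt.1 hd).2, (abs_lt.1 hd').1]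
  have h3 := Real.sqrt_pos.1 (sqrt_L_half_pos hmem)
  have h4 := (Real.sqrt_le_sqrt_iff h3.le).1 key
  linarith

end FinslerSpacetime

end

theorem mainTheorem7 {n : ℕ} (hn : 2 ≤ n) {M : Type*} [TopologicalSpace M] [T2Space M]
    [SecondCountableTopology M] [ConnectedSpace M]
    [ChartedSpace (EuclideanSpace ℝ (Fin n)) M] [IsManifold (𝓡 n) ∞ M]
    (S : FinslerSpacetime n M) (hS : S.GloballyHyperbolic)
    (hcurv : ∃ k : ℝ, S.TimelikeCurvatureBoundedBelow k ∨ S.TimelikeCurvatureBoundedAbove k) :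
    (∀ x : M, ∀ v ∈ S.futureTimelike x, ∀ w ∈ S.futureTimelike x,
      S.g x v w w = 2 * S.L ⟨x, w⟩) ∧
    (∀ x : M, ∃ B : EuclideanSpace ℝ (Fin n) →L[ℝ] EuclideanSpace ℝ (Fin n) →L[ℝ] ℝ,
      (∀ u w, B u w = B w u) ∧ HasLorentzianSignature B ∧
        ∀ w ∈ S.futureTimelike x, S.L ⟨x, w⟩ = B w w / 2) := by
  have h1 : ∀ x : M, ∀ v ∈ S.futureTimelike x, ∀ w ∈ S.futureTimelike x,
      S.g x v w w = 2 * S.L ⟨x, w⟩ := by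
    intro x
    obtain ⟨k, hk | hk⟩ := hcurv
    · exact FinslerSpacetime.hessian_eq_of_boundedBelow (hS.1.locallyCausalAt x) (hk x)
    · exact FinslerSpacetime.hessian_eq_of_boundedAbove (hS.1.locallyCausalAt x) (hk x)
  refine ⟨h1, fun x => ?_⟩
  have hf := S.isLorentzMinkowski x
  have hX : S.X x ∈ S.futureTimelike x := hf.self_mem_timecone (S.timelike_X x)
  have hsig := S.signature_L x (S.X x) (hf.ne_zero_of_neg (S.timelike_X x))
  refine ⟨S.g x (S.X x), hsig.symm, hsig, fun w hw => ?_⟩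
  rw [h1 x _ hX w hw]
  ring
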